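/- Let $d\ge 1$. For $g\in L^2(\mathbb R^d)$ let $G(g)=\{e^{2\pi i n\cdot x}g(x-m)\}_{(m,n)\in\mathbb Z^{2d}}$ be its Gabor system. It is a Riesz basis of $L^2(\mathbb R^d)$ with bounds $A,B>0$ if it is complete and $A\sum|a_{m,n}|^2\le\|\sum a_{m,n}e^{2\pi i n\cdot x}g(x-m)\|_2^2\le B\sum|a_{m,n}|^2$ for all $(a_{m,n})\in\ell^2(\mathbb Z^{2d})$. Let $\widehat g(\xi)=\int g(x)e^{-2\pi i x\cdot\xi}\,dx$, extended to $L^2$ by Plancherel. (1) For all $A,B>0$ there is a constant $C>0$, depending only on $A$ and $B$ (not on $d$), with the following property. Let $d\ge1$, let $g\in L^2(\mathbb R^d)$ be such that $G(g)$ is a Riesz basis with bounds $A,B$, let $R_1,\dots,R_d,L_1,\dots,L_d\ge 1$, and put $\mathcal R=\prod_{j=1}^d(-R_j,R_j)$, $\mathcal L=\prod_{j=1}^d(-L_j,L_j)$. Then for every $1\le i\le d$ $$\int_{\mathbb R^d\setminus\mathcal R}|g(x)|^2\,dx+\int_{\mathbb R^d\setminus\mathcal L}|\widehat g(\xi)|^2\,d\xi\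 \ge\ \frac{C}{R_iL_i}.$$ (2) In every dimension the term $C/(R_iL_i)$ cannot be replaced by $C\log(R_iL_i)/(R_iL_i)$. More precisely, there is $f\in L^2(\mathbb R)$ whose Zak transform $Zf(x,y)=\sum_{k\in\mathbb Z}f(x-k)e^{2\pi i k y}$ (convergence in $L^2([0,1]^2)$) satisfies $|Zf|=1$ almost everywhere, such that for every $d\ge1$ the function $g(x)=f(x_1)\cdots f(x_d)$ on $\mathbb R^d$ lies in $L^2(\mathbb R^d)$, $G(g)$ is a Riesz basis with bounds $A=B=1$, and for every $C>0$ there are $R_j,L_j\ge1$ $(1\le j\le d)$ such that, with $\mathcal R,\mathcal L$ as in (1), for every $1\le i\le d$ $$\int_{\mathbb R^d\setminus\mathcal R}|g(x)|^2\,dx+\int_{\mathbb R^d\setminus\mathcal L}|\widehat g(\xi)|^2\,d\xi\ <\ \frac{C\log(R_iL_i)}{R_iL_i}.$$ -/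

import Mathlib

open MeasureTheory Filter Topology
open scoped FourierTransform ENNReal

noncomputable section

/-- `v` is a Riesz basis of the complex Hilbert space `H`, and `A`, `B` are constants for which the
two Riesz inequalities hold: `v` is complete, and for every square-summable `a` the series
`∑ aᵢ vᵢ` converges with `A ∑ |aᵢ|² ≤ ‖∑ aᵢ vᵢ‖² ≤ B ∑ |aᵢ|²`. -/
structure IsRieszBasisWith {H ι : Type*} [NormedAddCommGroup H] [InnerProductSpace ℂ H]
    (v : ι → H) (A B : ℝ) : Prop where
  lower_pos : 0 < A
  upper_pos : 0 < B
  complete : (Submodule.span ℂ (Set.range v)).topologicalClosure = ⊤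
  summable : ∀ a : ι → ℂ, Summable (fun i => ‖a i‖ ^ 2) → Summable (fun i => a i • v i)
  lower : ∀ a : ι → ℂ, Summable (fun i => ‖a i‖ ^ 2) →
    A * ∑' i, ‖a i‖ ^ 2 ≤ ‖∑' i, a i • v i‖ ^ 2
  upper : ∀ a : ι → ℂ, Summable (fun i => ‖a i‖ ^ 2) →
    ‖∑' i, a i • v i‖ ^ 2 ≤ B * ∑' i, ‖a i‖ ^ 2

/-- `ℝ^d` with its Euclidean structure. -/
abbrev RSpace (d : ℕ) : Type := EuclideanSpace ℝ (Fin d)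

/-- The space `L²(ℝ^d)` of complex valued functions. -/
abbrev L2 (d : ℕ) : Type := Lp ℂ 2 (volume : Measure (RSpace d))

/-- The lattice point `m ∈ ℤ^d` as a vector of `ℝ^d`. -/
def latticePoint {d : ℕ} (m : Fin d → ℤ) : RSpace d := WithLp.toLp 2 (fun j => (m j : ℝ))

/-- The function `x ↦ e^{2πi n·x} g(x - m)`. -/
def gaborFun {d : ℕ} (g : RSpace d → ℂ) (m n : Fin d → ℤ) (x : RSpace d) : ℂ :=
  Complex.exp (2 * Real.pi * Complex.I * ((∑ j, (n j : ℝ) * x j : ℝ) : ℂ)) * g (x - latticePoint m)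

theorem memLp_gaborFun {d : ℕ} (g : L2 d) (m n : Fin d → ℤ) :
    MemLp (gaborFun (g : RSpace d → ℂ) m n) 2 volume := by
  have h1 : MemLp (fun x : RSpace d => (g : RSpace d → ℂ) (x - latticePoint m)) 2 volume :=
    (Lp.memLp g).comp_measurePreserving (measurePreserving_sub_right volume (latticePoint m))
  refine h1.of_le (AEStronglyMeasurable.mul ?_ h1.1) (ae_of_all _ fun x => ?_)
  · exact (Continuous.aestronglyMeasurable (by fun_prop))
  · have : ‖Complex.exp (2 * Real.pi * Complex.I * ((∑ j, (n j : ℝ) * x j : ℝ) : ℂ))‖ = 1 := by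
      rw [Complex.norm_exp]
      simp
    simp only [gaborFun, norm_mul, this, one_mul, le_refl]

/-- The Gabor system `{e^{2πi n·x} g(x - m)}`, `(m, n) ∈ ℤ^{2d}`, in `L²(ℝ^d)`. -/
def gaborSystem {d : ℕ} (g : L2 d) (p : (Fin d → ℤ) × (Fin d → ℤ)) : L2 d :=
  (memLp_gaborFun g p.1 p.2).toLp

/-- The open rectangle `(-R₁, R₁) × ⋯ × (-R_d, R_d)`. -/
def rectangle {d : ℕ} (R : Fin d → ℝ) : Set (RSpace d) := {x | ∀ j, x j ∈ Set.Ioo (-R j) (R j)}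

/-- `∫_{ℝ^d ∖ 𝓡} |g|² + ∫_{ℝ^d ∖ 𝓛} |ĝ|²` for the rectangles with half side lengths `R` and `L`. -/
def tailMass {d : ℕ} (g : L2 d) (R L : Fin d → ℝ) : ℝ :=
  (∫ x in (rectangle R)ᶜ, ‖g x‖ ^ 2) + ∫ ξ in (rectangle L)ᶜ, ‖(𝓕 g : L2 d) ξ‖ ^ 2

/-- The unit square `[0,1]²`. -/
def unitSquare : Set (ℝ × ℝ) := Set.Icc 0 1 ×ˢ Set.Icc 0 1

/-- On `[0,1]²` the function `z` is the Zak transform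
`Zf(x, y) = ∑_{k ∈ ℤ} f(x - k) e^{2πi k y}` of `f ∈ L²(ℝ)`, the series converging
unconditionally in `L²([0,1]²)`. -/
def IsZakTransform (f : ℝ → ℂ) (z : ℝ × ℝ → ℂ) : Prop :=
  MemLp z 2 (volume.restrict unitSquare) ∧
  Tendsto (fun s : Finset ℤ =>
      eLpNorm (fun p : ℝ × ℝ =>
        (∑ k ∈ s, f (p.1 - k) * Complex.exp (2 * Real.pi * Complex.I * k * p.2)) - z p)
        2 (volume.restrict unitSquare))
    atTop (𝓝 0)

/-- `g` is the `d`-fold tensor power `x ↦ f(x₁) ⋯ f(x_d)` of `f`. -/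
def IsTensorPower {d : ℕ} (f : ℝ → ℂ) (g : L2 d) : Prop :=
  (g : RSpace d → ℂ) =ᵐ[volume] fun x => ∏ j, f (x j)

end

/-!
Everything is read off from the Zak transform `F(x, y) = ∑_k g(x - k) e^{2πi k·y}`, which is
unitary from `L²(ℝ^d)` onto `L²` of `(0,1]^d × 𝕋^d` and turns the Gabor system into the characters
times `F`. Riesz bounds `A`, `B` therefore mean `A ≤ |F|² ≤ B` almost everywhere
(`IsZak.bounds_of_isRieszBasisWith`), and a unimodular `F` gives an orthonormal basis
(`IsZak.isRieszBasisWith_one`). Translating `F` in `x` multiplies `ĝ` by a character, and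
translating it in `y` multiplies `g`, on each cell of the lattice, by a constant. Hence the mean
square size of `∑_j c_j F(x - jv, y)` is a weighted `L²` norm of `ĝ`, the weight being the symbol
of `c`, and similarly in `y` (`IsZak.lintegral_tsum_space`, `IsZak.lintegral_tsum_freq`).

*Lower bound.* Extended quasi-periodically, `F(x + e_i, y) = e^{2πi y_i} F(x, y)`, so `F` winds
once around `0` and cannot be continuous. Quantitatively, on any grid of mesh `1/N` in `x_i` and
`1/M` in `y_i` some step of `F` has to be a definite fraction of `|F|`
(`false_of_slowly_varying_quasiperiodic`). Convolve `F` along the grid with coefficients `c` that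
vary slowly in `j` and whose symbol is `1` near `0` (`exists_trapezoid_multiplier`). The
convolution varies slowly, so `F` differs from its convolution in `x` or in `y` by a fixed amount
at some point of every grid, that is, on a set of measure at least `1/(NM)`
(`exists_grid_point_le_residual`, `one_le_mul_zakMeasure_of_grid`). With `N` a multiple of `L_i`
and `M` a multiple of `R_i` these differences live only on the tails of `ĝ` and `g`, and
Chebyshev's inequality bounds the tails from below by a multiple of `1/(NM)`. The constants do not
involve `d`, since a single coordinate is used.

*Sharpness.* In dimension one take for `Zf` the direction `W / |W|` of the chord
`W(x, y) = (1 - x) + x e^{2πi y}`, with the single singular point `(1/2, 1/2)`. The chord is affine in `x` and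
smooth in `y`, so the second difference of step `s` of `W / |W|` is `O(min(1, s² / r²))` at
distance `r` from the singularity, apart from `O(s)` near the corners at integer `x`. Its square
has integral `O(s²)` with no logarithm, in contrast to first differences, which are of order
`s / r`. The symbol of the second difference is bounded below on a dyadic shell of radius about `1/s`,
and summing over shells gives tails `O(R⁻²)` (`tailMass_le_of_isZak_tensorPhase`), which is
eventually less than `C log(R²) / R²`. For tensor powers the other coordinates contribute
unimodular factors.
-/

/-! ### Fourier series on the torus -/

noncomputable section

open UnitAddTorus

/-- The Haar probability measure on the torus `(ℝ/ℤ)^ι`. -/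
def torusMeasure (ι : Type*) [Fintype ι] : Measure (UnitAddTorus ι) :=
  Measure.pi fun _ => AddCircle.haarAddCircle

variable {ι : Type*} [Fintype ι]

instance : IsProbabilityMeasure (torusMeasure ι) := by unfold torusMeasure; infer_instance

instance : (torusMeasure ι).IsAddRightInvariant := by unfold torusMeasure; infer_instance

/-- The Fourier coefficient `∫ f(t) e^{-2πi k·t} dt` of a function on the torus. -/
def torusCoeff (f : UnitAddTorus ι → ℂ) (k : ι → ℤ) : ℂ :=
  ∫ t, mFourier (-k) t * f t ∂torusMeasure ι

theorem norm_mFourier_apply (k : ι → ℤ) (t : UnitAddTorus ι) : ‖mFourier k t‖ = 1 := by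
  rw [mFourier, ContinuousMap.coe_mk, norm_prod]
  exact Finset.prod_eq_one fun i _ => by rw [fourier_apply, Circle.norm_coe]

theorem torusCoeff_congr_ae {f g : UnitAddTorus ι → ℂ} (h : f =ᵐ[torusMeasure ι] g)
    (k : ι → ℤ) : torusCoeff f k = torusCoeff g k := by
  refine integral_congr_ae ?_
  filter_upwards [h] with t ht
  rw [ht]

theorem integrable_mFourier_mul {f : UnitAddTorus ι → ℂ} (hf : Integrable f (torusMeasure ι))
    (k : ι → ℤ) : Integrable (fun t => mFourier k t * f t) (torusMeasure ι) :=
  hf.bdd_mul (c := 1) ((mFourier k).continuous.aestronglyMeasurable)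
    (ae_of_all _ fun t => (norm_mFourier_apply k t).le)

theorem integral_mFourier (k : ι → ℤ) :
    ∫ t, mFourier k t ∂torusMeasure ι = if k = 0 then 1 else 0 := by
  classical
  have h := (orthonormal_iff_ite.mp (orthonormal_mFourier (d := ι))) 0 k
  rw [ContinuousMap.inner_toLp] at h
  simp only [mFourier_zero, ContinuousMap.one_apply, map_one, mul_one, eq_comm (a := (0 : ι → ℤ))]
    at h
  exact h

theorem torusCoeff_mFourier (l k : ι → ℤ) :
    torusCoeff (mFourier l) k = if l = k then 1 else 0 := by
  have : torusCoeff (mFourier l) k = ∫ t, mFourier (-k + l) t ∂torusMeasure ι := by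
    simp only [torusCoeff, mFourier_add]
  rw [this, integral_mFourier]
  simp only [neg_add_eq_zero, eq_comm]

/-- **Parseval's identity** on the torus. -/
theorem lintegral_enorm_sq_eq_tsum_torusCoeff {f : UnitAddTorus ι → ℂ}
    (hf : MemLp f 2 (torusMeasure ι)) :
    ∫⁻ t, ‖f t‖ₑ ^ 2 ∂torusMeasure ι = ∑' k, ‖torusCoeff f k‖ₑ ^ 2 := by
  have h : HasSum (fun k => ‖torusCoeff (hf.toLp f) k‖ ^ 2)
      (∫ t, ‖hf.toLp f t‖ ^ 2 ∂torusMeasure ι) := hasSum_sq_mFourierCoeff (d := ι) (hf.toLp f)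
  simp_rw [torusCoeff_congr_ae hf.coeFn_toLp] at h
  have h2 : ∫ t, ‖hf.toLp f t‖ ^ 2 ∂torusMeasure ι = ∫ t, ‖f t‖ ^ 2 ∂torusMeasure ι :=
    integral_congr_ae (by filter_upwards [hf.coeFn_toLp] with t ht; rw [ht])
  rw [h2] at h
  have h3 := congrArg ENNReal.ofReal h.tsum_eq
  rw [ENNReal.ofReal_tsum_of_nonneg (fun _ => by positivity) h.summable,
    ofReal_integral_eq_lintegral_ofReal ((memLp_two_iff_integrable_sq_norm hf.1).1 hf)
      (ae_of_all _ fun _ => by positivity)] at h3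
  simpa only [ENNReal.ofReal_pow (norm_nonneg _), ofReal_norm] using h3.symm

theorem torusCoeff_sub_sum {f : UnitAddTorus ι → ℂ} (hf : Integrable f (torusMeasure ι))
    (a : (ι → ℤ) → ℂ) (s : Finset (ι → ℤ)) (k : ι → ℤ) [Decidable (k ∈ s)] :
    torusCoeff (fun t => f t - ∑ l ∈ s, a l * mFourier l t) k
      = torusCoeff f k - if k ∈ s then a k else 0 := by
  classical
  have hm : ∀ l : ι → ℤ, Integrable (fun t => mFourier (-k) t * (a l * mFourier l t))
      (torusMeasure ι) := fun l => by
    refine integrable_mFourier_mul (Integrable.const_mul ?_ _) _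
    exact (integrable_const (1 : ℝ)).mono' (mFourier l).continuous.aestronglyMeasurable
      (ae_of_all _ fun t => (norm_mFourier_apply l t).le)
  simp only [torusCoeff, mul_sub, Finset.mul_sum]
  rw [integral_sub (integrable_mFourier_mul hf _) (integrable_finsetSum _ fun l _ => hm l),
    integral_finsetSum _ fun l _ => hm l]
  congr 1
  have h1 : ∀ l : ι → ℤ, ∫ t, mFourier (-k) t * (a l * mFourier l t) ∂torusMeasure ι
      = if l = k then a l else 0 := fun l => by
    have := torusCoeff_mFourier l k
    simp only [torusCoeff] at this
    simp_rw [mul_left_comm _ (a l)]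
    rw [integral_const_mul, this]
    split_ifs <;> simp
  simp_rw [h1]
  rw [Finset.sum_ite_eq' s k a]
  congr

theorem memLp_sub_sum_mFourier {f : UnitAddTorus ι → ℂ} (hf : MemLp f 2 (torusMeasure ι))
    (a : (ι → ℤ) → ℂ) (s : Finset (ι → ℤ)) :
    MemLp (fun t => f t - ∑ l ∈ s, a l * mFourier l t) 2 (torusMeasure ι) := by
  refine hf.sub (memLp_finsetSum _ fun l _ => MemLp.const_mul ?_ _)
  exact MemLp.of_bound (mFourier l).continuous.aestronglyMeasurable 1
    (ae_of_all _ fun t => (norm_mFourier_apply l t).le)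

theorem torusCoeff_sum_mFourier (a : (ι → ℤ) → ℂ) (s : Finset (ι → ℤ)) (k : ι → ℤ)
    [Decidable (k ∈ s)] :
    torusCoeff (fun t => ∑ l ∈ s, a l * mFourier l t) k = if k ∈ s then a k else 0 := by
  have h := torusCoeff_sub_sum (integrable_zero _ ℂ (torusMeasure ι)) (fun l => -a l) s k
  simp only [Pi.zero_apply, neg_mul, Finset.sum_neg_distrib, zero_sub, neg_neg] at h
  rw [h]
  simp only [torusCoeff, Pi.zero_apply, mul_zero, integral_zero]
  split_ifs <;> simp

theorem memLp_mFourier (k : ι → ℤ) : MemLp (mFourier k) 2 (torusMeasure ι) :=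
  MemLp.of_bound (mFourier k).continuous.aestronglyMeasurable 1
    (ae_of_all _ fun t => (norm_mFourier_apply k t).le)

theorem memLp_sum_mFourier (a : (ι → ℤ) → ℂ) (s : Finset (ι → ℤ)) :
    MemLp (fun t => ∑ l ∈ s, a l * mFourier l t) 2 (torusMeasure ι) :=
  memLp_finsetSum _ fun k _ => (memLp_mFourier k).const_mul _

theorem lintegral_enorm_sq_sum_mFourier (a : (ι → ℤ) → ℂ) (s : Finset (ι → ℤ)) :
    ∫⁻ t, ‖∑ l ∈ s, a l * mFourier l t‖ₑ ^ 2 ∂torusMeasure ι = ∑ l ∈ s, ‖a l‖ₑ ^ 2 := by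
  classical
  rw [lintegral_enorm_sq_eq_tsum_torusCoeff (memLp_sum_mFourier a s)]
  simp_rw [torusCoeff_sum_mFourier]
  rw [tsum_eq_sum (s := s) fun k hk => by simp [hk]]
  exact Finset.sum_congr rfl fun k hk => by simp [hk]

/-- The squared `L²` distance of `f` to a partial sum of its Fourier series is the sum of the
remaining squared coefficients. -/
theorem lintegral_enorm_sq_sub_partialSum {f : UnitAddTorus ι → ℂ}
    (hf : MemLp f 2 (torusMeasure ι)) (s : Finset (ι → ℤ)) :
    ∫⁻ t, ‖f t - ∑ l ∈ s, torusCoeff f l * mFourier l t‖ₑ ^ 2 ∂torusMeasure ι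
      = ∑' k : {k // k ∉ s}, ‖torusCoeff f k‖ₑ ^ 2 := by
  classical
  rw [lintegral_enorm_sq_eq_tsum_torusCoeff (memLp_sub_sum_mFourier hf _ s)]
  simp_rw [torusCoeff_sub_sum (hf.integrable one_le_two)]
  rw [← tsum_subtype_eq_of_support_subset (s := {k | k ∉ s})]
  · exact tsum_congr fun k => by rw [if_neg k.2, sub_zero]
  · intro k hk hks
    exact hk (by simp [hks])

theorem tendsto_partialSum {f : UnitAddTorus ι → ℂ} (hf : MemLp f 2 (torusMeasure ι)) :
    Tendsto (fun s : Finset (ι → ℤ) =>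
      ∫⁻ t, ‖f t - ∑ l ∈ s, torusCoeff f l * mFourier l t‖ₑ ^ 2 ∂torusMeasure ι) atTop (𝓝 0) := by
  simp_rw [lintegral_enorm_sq_sub_partialSum hf]
  refine ENNReal.tendsto_tsum_compl_atTop_zero (f := fun k => ‖torusCoeff f k‖ₑ ^ 2) ?_
  rw [← lintegral_enorm_sq_eq_tsum_torusCoeff hf]
  have := hf.2
  rw [eLpNorm_lt_top_iff_lintegral_rpow_enorm_lt_top (by simp) (by simp)] at this
  simpa using this.ne

theorem ae_eq_zero_of_torusCoeff_eq_zero {f : UnitAddTorus ι → ℂ}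
    (hf : MemLp f 2 (torusMeasure ι)) (h : ∀ k, torusCoeff f k = 0) :
    f =ᵐ[torusMeasure ι] 0 := by
  have := lintegral_enorm_sq_eq_tsum_torusCoeff hf
  simp only [h, enorm_zero, ne_eq, OfNat.ofNat_ne_zero, not_false_eq_true, zero_pow,
    tsum_zero] at this
  rw [lintegral_eq_zero_iff' (hf.1.enorm.pow_const 2)] at this
  filter_upwards [this] with t ht
  simpa using ht

end

/-! ### The unit cube as a fundamental domain -/

noncomputable section

open UnitAddTorus

variable {d : ℕ}

/-- The half-open unit cube `(0,1]^d`, a fundamental domain for the translations by `ℤ^d`. -/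
def unitCube (d : ℕ) : Set (RSpace d) := {x | ∀ j, x j ∈ Set.Ioc (0 : ℝ) 1}

/-- Lebesgue measure on the unit cube. -/
def cubeMeasure (d : ℕ) : Measure (RSpace d) := volume.restrict (unitCube d)

/-- The `m ∈ ℤ^d` with `x ∈ m + (0,1]^d`. -/
def cellIndex (x : RSpace d) : Fin d → ℤ := fun j => ⌈x j⌉ - 1

/-- Reduction modulo `ℤ^d`. -/
def toTorus (x : RSpace d) : UnitAddTorus (Fin d) := fun j => (x j : UnitAddCircle)

/-- The representative in `(0,1]^d` of a point of the torus. -/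
def torusRep (t : UnitAddTorus (Fin d)) : RSpace d :=
  WithLp.toLp 2 fun j => (AddCircle.equivIoc 1 0 (t j) : ℝ)

@[simp] theorem latticePoint_apply (m : Fin d → ℤ) (j : Fin d) : latticePoint m j = (m j : ℝ) := rfl

theorem latticePoint_add (m n : Fin d → ℤ) :
    latticePoint (m + n) = latticePoint m + latticePoint n := by
  ext j; simp

theorem latticePoint_neg (m : Fin d → ℤ) : latticePoint (-m) = -latticePoint m := by
  ext j; simp

theorem latticePoint_sub (m n : Fin d → ℤ) :
    latticePoint (m - n) = latticePoint m - latticePoint n := by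
  ext j; simp

theorem latticePoint_zero : latticePoint (0 : Fin d → ℤ) = 0 := by
  ext j; simp

theorem measurableSet_unitCube : MeasurableSet (unitCube d) := by
  have : unitCube d = ⋂ j, (fun x : RSpace d => x j) ⁻¹' Set.Ioc (0 : ℝ) 1 := by
    ext x; simp [unitCube]
  rw [this]
  exact MeasurableSet.iInter fun j => measurableSet_Ioc.preimage (by fun_prop)

theorem cellIndex_eq_zero_iff {x : RSpace d} : cellIndex x = 0 ↔ x ∈ unitCube d := by
  simp only [funext_iff, cellIndex, unitCube, Pi.zero_apply, Set.mem_ofPred_eq, Set.mem_Ioc,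
    sub_eq_zero, Int.ceil_eq_iff]
  simp

theorem cellIndex_sub (x : RSpace d) (m : Fin d → ℤ) :
    cellIndex (x - latticePoint m) = cellIndex x - m := by
  ext j
  simp only [cellIndex, PiLp.sub_apply, latticePoint_apply, Int.ceil_sub_intCast, Pi.sub_apply]
  ring

theorem cellIndex_add (x : RSpace d) (m : Fin d → ℤ) :
    cellIndex (x + latticePoint m) = cellIndex x + m := by
  have := cellIndex_sub x (-m)
  rwa [latticePoint_neg, sub_neg_eq_add, sub_neg_eq_add] at this

theorem sub_latticePoint_mem_unitCube_iff {x : RSpace d} {m : Fin d → ℤ} :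
    x - latticePoint m ∈ unitCube d ↔ cellIndex x = m := by
  rw [← cellIndex_eq_zero_iff, cellIndex_sub, sub_eq_zero]

theorem sub_cellIndex_mem_unitCube (x : RSpace d) :
    x - latticePoint (cellIndex x) ∈ unitCube d :=
  sub_latticePoint_mem_unitCube_iff.2 rfl

theorem measurable_cellIndex : Measurable (cellIndex (d := d)) := by
  unfold cellIndex
  fun_prop

theorem measurable_latticePoint : Measurable (latticePoint (d := d)) := measurable_of_countable _

theorem continuous_toTorus : Continuous (toTorus (d := d)) :=
  continuous_pi fun j => (AddCircle.continuous_mk' 1).comp (by fun_prop)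

theorem toTorus_sub (x y : RSpace d) : toTorus (x - y) = toTorus x - toTorus y := by
  ext j; simp [toTorus]

theorem toTorus_latticePoint (m : Fin d → ℤ) : toTorus (latticePoint m) = 0 := by
  ext j
  simp only [toTorus, latticePoint_apply, Pi.zero_apply]
  rw [AddCircle.coe_eq_zero_iff]
  exact ⟨m j, by simp⟩

theorem toTorus_sub_latticePoint (x : RSpace d) (m : Fin d → ℤ) :
    toTorus (x - latticePoint m) = toTorus x := by
  rw [toTorus_sub, toTorus_latticePoint, sub_zero]

theorem toTorus_torusRep (t : UnitAddTorus (Fin d)) : toTorus (torusRep t) = t := by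
  ext j
  simp [toTorus, torusRep]

theorem mFourier_toTorus (n : Fin d → ℤ) (x : RSpace d) :
    mFourier n (toTorus x)
      = Complex.exp (2 * Real.pi * Complex.I * ((∑ j, (n j : ℝ) * x j : ℝ) : ℂ)) := by
  simp only [mFourier, ContinuousMap.coe_mk, toTorus]
  rw [Complex.ofReal_sum, Finset.mul_sum, Complex.exp_sum]
  refine Finset.prod_congr rfl fun j _ => ?_
  rw [fourier_coe_apply]
  congr 1
  push_cast
  ring

theorem measurePreserving_toLp_restrict (s : Fin d → Set ℝ) :
    MeasurePreserving (fun x : Fin d → ℝ => (WithLp.toLp 2 x : RSpace d))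
      (Measure.pi fun j => volume.restrict (s j))
      (volume.restrict {x : RSpace d | ∀ j, x j ∈ s j}) := by
  rw [← Measure.restrict_pi_pi, ← volume_pi]
  have h := (EuclideanSpace.volume_preserving_symm_measurableEquiv_toLp (Fin d))
  have h2 := h.symm.restrict_preimage_emb (MeasurableEquiv.measurableEmbedding _)
    {x : RSpace d | ∀ j, x j ∈ s j}
  have : (MeasurableEquiv.toLp 2 (Fin d → ℝ)).symm.symm ⁻¹' {x : RSpace d | ∀ j, x j ∈ s j}
      = Set.univ.pi s := by
    ext x; simp
  rw [this] at h2
  exact h2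

theorem measurePreserving_torusRep :
    MeasurePreserving (torusRep (d := d)) (torusMeasure (Fin d)) (cubeMeasure d) := by
  have h1 : MeasurePreserving (fun t : UnitAddCircle => (AddCircle.equivIoc 1 0 t : ℝ))
      AddCircle.haarAddCircle (volume.restrict (Set.Ioc 0 1)) := by
    have hm := AddCircle.measurePreserving_mk (1 : ℝ) 0
    have hmeas : Measurable (fun t : UnitAddCircle => (AddCircle.equivIoc 1 0 t : ℝ)) :=
      measurable_subtype_coe.comp (AddCircle.measurableEquivIoc 1 0).measurable
    refine ⟨hmeas, ?_⟩
    have hv : (AddCircle.haarAddCircle : Measure UnitAddCircle) = volume := by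
      simp [AddCircle.volume_eq_smul_haarAddCircle]
    rw [hv, ← hm.map_eq, Measure.map_map hmeas hm.measurable]
    have h01 : Set.Ioc (0 : ℝ) (0 + 1) = Set.Ioc 0 1 := by rw [zero_add]
    simp only [h01]
    conv_rhs => rw [← Measure.map_id (μ := volume.restrict (Set.Ioc (0 : ℝ) 1))]
    refine Measure.map_congr ?_
    filter_upwards [ae_restrict_mem measurableSet_Ioc] with x hx
    simp only [Function.comp_apply, id]
    rw [AddCircle.equivIoc_coe_of_mem]
    simpa using hx
  have h2 := measurePreserving_pi (fun _ : Fin d =>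
    (AddCircle.haarAddCircle : Measure UnitAddCircle)) (fun _ => volume.restrict (Set.Ioc (0 : ℝ) 1)) (fun _ => h1)
  exact (measurePreserving_toLp_restrict fun _ => Set.Ioc (0 : ℝ) 1).comp h2

instance : IsProbabilityMeasure (cubeMeasure d) :=
  ⟨by rw [← measurePreserving_torusRep.map_eq,
    Measure.map_apply measurePreserving_torusRep.measurable MeasurableSet.univ, Set.preimage_univ,
    measure_univ]⟩

/-- Tiling of `ℝ^d` by the translates of the unit cube. -/
theorem lintegral_eq_tsum_cube (φ : RSpace d → ℝ≥0∞) :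
    ∫⁻ x, φ x = ∑' k : Fin d → ℤ, ∫⁻ x, φ (x - latticePoint k) ∂cubeMeasure d := by
  have hS : ∀ k : Fin d → ℤ, MeasurableSet {x : RSpace d | cellIndex x = -k} := fun k =>
    measurable_cellIndex (measurableSet_singleton _)
  have hU : (⋃ k : Fin d → ℤ, {x : RSpace d | cellIndex x = -k}) = Set.univ := by
    refine Set.eq_univ_of_forall fun x => Set.mem_iUnion.2 ⟨-cellIndex x, by simp⟩
  rw [← setLIntegral_univ φ, ← hU, lintegral_iUnion hS]
  · refine tsum_congr fun k => ?_
    have h := (measurePreserving_sub_right (volume : Measure (RSpace d)) (latticePoint k)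
      ).setLIntegral_comp_preimage_emb (measurableEmbedding_subRight _) φ
      {x : RSpace d | cellIndex x = -k}
    have h2 : (fun x : RSpace d => x - latticePoint k) ⁻¹' {x : RSpace d | cellIndex x = -k}
        = unitCube d := by
      ext x
      simp only [Set.mem_preimage, Set.mem_ofPred_eq, cellIndex_sub]
      rw [sub_eq_neg_self, cellIndex_eq_zero_iff]
    rw [h2] at h
    exact h.symm
  · intro k l hkl
    refine Set.disjoint_left.2 fun x hx hx' => hkl ?_
    simp only [Set.mem_ofPred_eq] at hx hx'
    exact neg_injective (hx.symm.trans hx')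

theorem ae_sub_right {p : RSpace d → Prop} (h : ∀ᵐ x, p x) (v : RSpace d) :
    ∀ᵐ x, p (x - v) :=
  (measurePreserving_sub_right volume v).quasiMeasurePreserving.ae h

/-- A property holding almost everywhere on the unit cube holds almost everywhere on `ℝ^d` after
translation back to the cube. -/
theorem ae_sub_cellIndex {p : RSpace d → Prop} (h : ∀ᵐ x ∂cubeMeasure d, p x) :
    ∀ᵐ x, p (x - latticePoint (cellIndex x)) := by
  rw [cubeMeasure, ae_restrict_iff' measurableSet_unitCube] at h
  have h2 : ∀ k : Fin d → ℤ, ∀ᵐ x, x - latticePoint k ∈ unitCube d → p (x - latticePoint k) :=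
    fun k => ae_sub_right h _
  filter_upwards [ae_all_iff.2 h2] with x hx
  exact hx _ (sub_cellIndex_mem_unitCube x)

theorem ae_cube_of_ae {p : RSpace d → Prop} (h : ∀ᵐ x, p x) : ∀ᵐ x ∂cubeMeasure d, p x :=
  ae_restrict_of_ae h

end

/-! ### Zak transforms -/

noncomputable section

open UnitAddTorus

variable {d : ℕ}

theorem eLpNorm_two_sq {α : Type*} [MeasurableSpace α] (μ : Measure α) (f : α → ℂ) :
    eLpNorm f 2 μ ^ 2 = ∫⁻ x, ‖f x‖ₑ ^ 2 ∂μ := by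
  rw [eLpNorm_eq_lintegral_rpow_enorm_toReal (by simp) (by simp), ← ENNReal.rpow_natCast,
    ← ENNReal.rpow_mul]
  simp

theorem memLp_two_iff {α : Type*} [MeasurableSpace α] {μ : Measure α} {f : α → ℂ}
    (hf : AEStronglyMeasurable f μ) : MemLp f 2 μ ↔ ∫⁻ x, ‖f x‖ₑ ^ 2 ∂μ < ∞ := by
  rw [← eLpNorm_two_sq, ENNReal.pow_lt_top_iff]
  simp [MemLp, hf]

theorem Lp_enorm_sq {α : Type*} [MeasurableSpace α] {μ : Measure α} (f : Lp ℂ 2 μ) :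
    ‖f‖ₑ ^ 2 = ∫⁻ x, ‖f x‖ₑ ^ 2 ∂μ := by
  rw [← eLpNorm_two_sq, Lp.enorm_def]

theorem toLp_enorm_sq {α : Type*} [MeasurableSpace α] {μ : Measure α} {f : α → ℂ}
    (hf : MemLp f 2 μ) : ‖hf.toLp f‖ₑ ^ 2 = ∫⁻ x, ‖f x‖ₑ ^ 2 ∂μ := by
  rw [← eLpNorm_two_sq, Lp.enorm_toLp]

/-- The measure on `(0,1]^d × 𝕋^d`, the domain of Zak transforms. -/
def zakMeasure (d : ℕ) : Measure (RSpace d × UnitAddTorus (Fin d)) :=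
  (cubeMeasure d).prod (torusMeasure (Fin d))

instance : IsProbabilityMeasure (zakMeasure d) := by unfold zakMeasure; infer_instance

theorem lintegral_zakMeasure {φ : RSpace d × UnitAddTorus (Fin d) → ℝ≥0∞}
    (hφ : AEMeasurable φ (zakMeasure d)) :
    ∫⁻ p, φ p ∂zakMeasure d = ∫⁻ x, ∫⁻ y, φ (x, y) ∂torusMeasure (Fin d) ∂cubeMeasure d :=
  lintegral_prod _ hφ

/-- `F` is the Zak transform of `g` on the fundamental domain `(0,1]^d × 𝕋^d`: for almost every
`x` the function `F(x, ·)` is square integrable with Fourier coefficients `g(x - k)`. -/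
structure IsZak (g : RSpace d → ℂ) (F : RSpace d × UnitAddTorus (Fin d) → ℂ) : Prop where
  aesm : AEStronglyMeasurable F (zakMeasure d)
  slice : ∀ᵐ x ∂cubeMeasure d, MemLp (fun y => F (x, y)) 2 (torusMeasure (Fin d)) ∧
    ∀ k, torusCoeff (fun y => F (x, y)) k = g (x - latticePoint k)

theorem ae_all_translates {p : RSpace d → Prop} (h : ∀ᵐ x, p x) :
    ∀ᵐ x ∂cubeMeasure d, ∀ k : Fin d → ℤ, p (x - latticePoint k) :=
  ae_cube_of_ae (ae_all_iff.2 fun k => ae_sub_right h (latticePoint k))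

namespace IsZak

variable {g g₁ g₂ : RSpace d → ℂ} {F F₁ F₂ : RSpace d × UnitAddTorus (Fin d) → ℂ}

theorem congr_left (h : IsZak g₁ F) (hg : g₁ =ᵐ[volume] g₂) : IsZak g₂ F := by
  refine ⟨h.aesm, ?_⟩
  filter_upwards [h.slice, ae_all_translates hg] with x hx hx2
  exact ⟨hx.1, fun k => by rw [hx.2, hx2]⟩

theorem congr_right (h : IsZak g F₁) (hF : F₁ =ᵐ[zakMeasure d] F₂) : IsZak g F₂ := by
  refine ⟨h.aesm.congr hF, ?_⟩
  filter_upwards [h.slice, Measure.ae_ae_of_ae_prod hF] with x hx hx2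
  exact ⟨hx.1.ae_eq hx2, fun k => by rw [← hx.2, torusCoeff_congr_ae hx2]⟩

theorem add (h₁ : IsZak g₁ F₁) (h₂ : IsZak g₂ F₂) :
    IsZak (fun x => g₁ x + g₂ x) (fun p => F₁ p + F₂ p) := by
  refine ⟨h₁.aesm.add h₂.aesm, ?_⟩
  filter_upwards [h₁.slice, h₂.slice] with x hx₁ hx₂
  refine ⟨hx₁.1.add hx₂.1, fun k => ?_⟩
  rw [← hx₁.2, ← hx₂.2]
  simp only [torusCoeff, mul_add]
  exact integral_add (integrable_mFourier_mul (hx₁.1.integrable one_le_two) _)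
    (integrable_mFourier_mul (hx₂.1.integrable one_le_two) _)

theorem const_mul (h : IsZak g F) (c : ℂ) : IsZak (fun x => c * g x) (fun p => c * F p) := by
  refine ⟨h.aesm.const_mul c, ?_⟩
  filter_upwards [h.slice] with x hx
  refine ⟨hx.1.const_mul c, fun k => ?_⟩
  rw [← hx.2]
  simp only [torusCoeff, mul_left_comm _ c]
  exact integral_const_mul _ _

protected theorem zero : IsZak (fun _ : RSpace d => 0) (fun _ => 0) := by
  refine ⟨aestronglyMeasurable_const, ae_of_all _ fun x => ⟨MemLp.zero', fun k => ?_⟩⟩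
  simp [torusCoeff]

theorem finset_sum {ι : Type*} (s : Finset ι) {g : ι → RSpace d → ℂ}
    {F : ι → RSpace d × UnitAddTorus (Fin d) → ℂ} (h : ∀ i ∈ s, IsZak (g i) (F i)) :
    IsZak (fun x => ∑ i ∈ s, g i x) (fun p => ∑ i ∈ s, F i p) := by
  classical
  induction s using Finset.induction_on with
  | empty => simpa using IsZak.zero
  | insert i s hi ih =>
    simp only [Finset.sum_insert hi]
    exact (h i (Finset.mem_insert_self _ _)).add
      (ih fun j hj => h j (Finset.mem_insert_of_mem hj))

/-- The Zak transform is an isometry. -/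
theorem lintegral_eq (h : IsZak g F) (hg : AEStronglyMeasurable g) :
    ∫⁻ p, ‖F p‖ₑ ^ 2 ∂zakMeasure d = ∫⁻ x, ‖g x‖ₑ ^ 2 := by
  rw [lintegral_zakMeasure (h.aesm.enorm.pow_const 2), lintegral_eq_tsum_cube,
    ← lintegral_tsum]
  · refine lintegral_congr_ae ?_
    filter_upwards [h.slice] with x hx
    rw [lintegral_enorm_sq_eq_tsum_torusCoeff hx.1]
    simp_rw [hx.2]
  · intro k
    exact (((hg.comp_measurePreserving (measurePreserving_sub_right volume (latticePoint k))
      ).enorm.pow_const 2).restrict)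

theorem memLp (h : IsZak g F) (hg : MemLp g 2 volume) : MemLp F 2 (zakMeasure d) := by
  rw [memLp_two_iff h.aesm, h.lintegral_eq hg.1]
  exact (memLp_two_iff hg.1).1 hg

/-- Time-frequency shifts become multiplications by characters. -/
theorem gabor (h : IsZak g F) (m n : Fin d → ℤ) :
    IsZak (gaborFun g m n)
      (fun p => mFourier n (toTorus p.1) * mFourier (-m) p.2 * F p) := by
  have hc : Continuous fun p : RSpace d × UnitAddTorus (Fin d) =>
      mFourier n (toTorus p.1) * mFourier (-m) p.2 :=
    ((mFourier n).continuous.comp (continuous_toTorus.comp continuous_fst)).mul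
      ((mFourier (-m)).continuous.comp continuous_snd)
  refine ⟨hc.aestronglyMeasurable.mul h.aesm, ?_⟩
  filter_upwards [h.slice] with x hx
  refine ⟨?_, fun k => ?_⟩
  · refine hx.1.of_le ?_ (ae_of_all _ fun y => ?_)
    · refine AEStronglyMeasurable.mul ?_ hx.1.1
      exact (hc.comp (Continuous.prodMk_right x)).aestronglyMeasurable
    · simp [norm_mFourier_apply]
  · have h1 : ∀ y, mFourier (-k) y * (mFourier n (toTorus x) * mFourier (-m) y * F (x, y))
        = mFourier n (toTorus x) * (mFourier (-(k + m)) y * F (x, y)) := fun y => by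
      rw [neg_add, mFourier_add]; ring
    simp only [torusCoeff, h1]
    rw [integral_const_mul]
    have h2 := hx.2 (k + m)
    rw [torusCoeff] at h2
    rw [h2, gaborFun, ← mFourier_toTorus, toTorus_sub_latticePoint, latticePoint_add, sub_sub]

/-- Two inner products agree when the norms of all linear combinations do. -/
theorem _root_.inner_eq_inner_of_norm {E E' : Type*} [NormedAddCommGroup E] [InnerProductSpace ℂ E]
    [NormedAddCommGroup E'] [InnerProductSpace ℂ E'] {x y : E} {x' y' : E'}
    (h : ∀ c : ℂ, ‖x + c • y‖ = ‖x' + c • y'‖) : inner ℂ x y = inner ℂ x' y' := by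
  have h1 := h 1
  have h2 := h (-1)
  have h3 := h Complex.I
  have h4 := h (-Complex.I)
  rw [inner_eq_sum_norm_sq_div_four, inner_eq_sum_norm_sq_div_four]
  simp only [one_smul, neg_smul, ← sub_eq_add_neg, RCLike.I_to_complex] at h1 h2 h3 h4 ⊢
  rw [h1, h2, h3, h4]

theorem inner_eq (h₁ : IsZak g₁ F₁) (h₂ : IsZak g₂ F₂) (hg₁ : MemLp g₁ 2 volume)
    (hg₂ : MemLp g₂ 2 volume) :
    inner ℂ (hg₁.toLp g₁) (hg₂.toLp g₂)
      = inner ℂ ((h₁.memLp hg₁).toLp F₁) ((h₂.memLp hg₂).toLp F₂) := by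
  refine inner_eq_inner_of_norm fun c => ?_
  have h := h₁.add (h₂.const_mul c)
  have hg : MemLp (fun x => g₁ x + c * g₂ x) 2 volume := hg₁.add (hg₂.const_mul c)
  have e1 : hg₁.toLp g₁ + c • hg₂.toLp g₂ = hg.toLp _ := rfl
  have e2 : (h₁.memLp hg₁).toLp F₁ + c • (h₂.memLp hg₂).toLp F₂ = (h.memLp hg).toLp _ := rfl
  have : ‖hg.toLp _‖ₑ ^ 2 = ‖(h.memLp hg).toLp _‖ₑ ^ 2 := by
    rw [toLp_enorm_sq, toLp_enorm_sq, h.lintegral_eq hg.1]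
  rw [e1, e2, ← toReal_enorm, ← toReal_enorm]
  congr 1
  exact (ENNReal.pow_right_strictMono two_ne_zero).injective this

end IsZak

/-! ### Existence -/

theorem memLp_zakTerm {g : RSpace d → ℂ} (hg : MemLp g 2 volume) (k : Fin d → ℤ) :
    MemLp (fun p : RSpace d × UnitAddTorus (Fin d) => g (p.1 - latticePoint k) * mFourier k p.2)
      2 (zakMeasure d) := by
  have h1 : MemLp (fun x => g (x - latticePoint k)) 2 (cubeMeasure d) :=
    (hg.comp_measurePreserving (measurePreserving_sub_right volume (latticePoint k))).restrict _
  refine (h1.comp_fst (torusMeasure (Fin d))).of_le ?_ (ae_of_all _ fun p => ?_)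
  · refine (h1.comp_fst (torusMeasure (Fin d))).1.mul ?_
    exact ((mFourier k).continuous.comp continuous_snd).aestronglyMeasurable
  · simp [norm_mFourier_apply]

theorem lintegral_zakSum {g : RSpace d → ℂ} (hg : MemLp g 2 volume) (s : Finset (Fin d → ℤ)) :
    ∫⁻ p, ‖∑ k ∈ s, g (p.1 - latticePoint k) * mFourier k p.2‖ₑ ^ 2 ∂zakMeasure d
      = ∑ k ∈ s, ∫⁻ x, ‖g (x - latticePoint k)‖ₑ ^ 2 ∂cubeMeasure d := by
  have hm : MemLp (fun p : RSpace d × UnitAddTorus (Fin d) =>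
      ∑ k ∈ s, g (p.1 - latticePoint k) * mFourier k p.2) 2 (zakMeasure d) :=
    memLp_finsetSum _ fun k _ => memLp_zakTerm hg k
  rw [lintegral_zakMeasure (hm.1.enorm.pow_const 2), ← lintegral_finsetSum']
  · refine lintegral_congr fun x => ?_
    exact lintegral_enorm_sq_sum_mFourier (fun k => g (x - latticePoint k)) s
  · intro k _
    exact (((hg.1.comp_measurePreserving (measurePreserving_sub_right volume (latticePoint k))
      ).enorm.pow_const 2).restrict)

/-- Every `g ∈ L²(ℝ^d)` has a Zak transform. -/
theorem exists_isZak {g : RSpace d → ℂ} (hg : MemLp g 2 volume) :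
    ∃ F : RSpace d × UnitAddTorus (Fin d) → ℂ, StronglyMeasurable F ∧ IsZak g F := by
  classical
  set v : (Fin d → ℤ) → Lp ℂ 2 (zakMeasure d) := fun k => (memLp_zakTerm hg k).toLp _ with hv
  set c : (Fin d → ℤ) → ℝ≥0∞ := fun k => ∫⁻ x, ‖g (x - latticePoint k)‖ₑ ^ 2 ∂cubeMeasure d
  have hmem : ∀ s : Finset (Fin d → ℤ), MemLp (fun p : RSpace d × UnitAddTorus (Fin d) =>
      ∑ k ∈ s, g (p.1 - latticePoint k) * mFourier k p.2) 2 (zakMeasure d) := fun s =>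
    memLp_finsetSum _ fun k _ => memLp_zakTerm hg k
  have hsum : ∀ s : Finset (Fin d → ℤ), ⇑(∑ k ∈ s, v k : Lp ℂ 2 (zakMeasure d)) =ᵐ[zakMeasure d]
      fun p => ∑ k ∈ s, g (p.1 - latticePoint k) * mFourier k p.2 := fun s => by
    have h1 : ∀ᵐ p ∂zakMeasure d, ∀ k, v k p = g (p.1 - latticePoint k) * mFourier k p.2 :=
      ae_all_iff.2 fun k => (memLp_zakTerm hg k).coeFn_toLp
    filter_upwards [h1, Lp.coeFn_finsetSum s v] with p hp hp2
    rw [hp2, Finset.sum_apply]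
    exact Finset.sum_congr rfl fun k _ => hp k
  have hnorm : ∀ s : Finset (Fin d → ℤ), ‖∑ k ∈ s, v k‖ₑ ^ 2 = ∑ k ∈ s, c k := fun s => by
    rw [Lp_enorm_sq, ← lintegral_zakSum hg s]
    refine lintegral_congr_ae ?_
    filter_upwards [hsum s] with p hp
    rw [hp]
  have hc : ∑' k, c k ≠ ∞ := by
    rw [← lintegral_eq_tsum_cube fun x => ‖g x‖ₑ ^ 2]
    exact ((memLp_two_iff hg.1).1 hg).ne
  have hsummable : Summable v := by
    rw [summable_iff_vanishing_norm]
    intro ε hε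
    have h0 := ENNReal.tendsto_tsum_compl_atTop_zero hc
    have hε2 : 0 < ENNReal.ofReal ε ^ 2 := ENNReal.pow_pos (ENNReal.ofReal_pos.2 hε) 2
    have h1 := h0.eventually (gt_mem_nhds hε2)
    obtain ⟨s, hs⟩ := h1.exists
    refine ⟨s, fun t ht => ?_⟩
    have h2 : ‖∑ k ∈ t, v k‖ₑ ^ 2 < ENNReal.ofReal ε ^ 2 := by
      rw [hnorm]
      refine lt_of_le_of_lt ?_ hs
      have h3 := tsum_subtype {k | k ∉ s} c
      refine le_trans ?_ h3.ge
      refine le_trans (le_of_eq ?_) (ENNReal.sum_le_tsum t)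
      refine Finset.sum_congr rfl fun k hk => ?_
      rw [Set.indicator_of_mem]
      exact Finset.disjoint_left.1 ht hk
    have h3 := (ENNReal.pow_right_strictMono two_ne_zero).lt_iff_lt.1 h2
    rw [← ofReal_norm] at h3
    exact (ENNReal.ofReal_lt_ofReal_iff hε).1 h3
  set F := ∑' k, v k with hF
  have hFs : HasSum v F := hsummable.hasSum
  refine ⟨F, Lp.stronglyMeasurable F, (Lp.aestronglyMeasurable F), ?_⟩
  have hFm : ∀ᵐ x ∂cubeMeasure d, MemLp (fun y => F (x, y)) 2 (torusMeasure (Fin d)) := by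
    have h1 : ∫⁻ p, ‖F p‖ₑ ^ 2 ∂zakMeasure d < ∞ :=
      (memLp_two_iff (Lp.aestronglyMeasurable F)).1 (Lp.memLp F)
    have hme : Measurable fun p => ‖F p‖ₑ ^ 2 :=
      (Lp.stronglyMeasurable F).measurable.enorm.pow_const 2
    rw [lintegral_zakMeasure hme.aemeasurable] at h1
    filter_upwards [ae_lt_top hme.lintegral_prod_right' h1.ne] with x hx
    rw [memLp_two_iff]
    · exact hx
    · exact ((Lp.stronglyMeasurable F).comp_measurable measurable_prodMk_left).aestronglyMeasurable
  have hcoef : ∀ k, ∀ᵐ x ∂cubeMeasure d,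
      torusCoeff (fun y => F (x, y)) k = g (x - latticePoint k) := by
    intro k
    have hle : ∀ s : Finset (Fin d → ℤ), k ∈ s →
        ∫⁻ x, ‖torusCoeff (fun y => F (x, y)) k - g (x - latticePoint k)‖ₑ ^ 2 ∂cubeMeasure d
          ≤ ‖F - ∑ l ∈ s, v l‖ₑ ^ 2 := by
      intro s hks
      have h1 : ‖F - ∑ l ∈ s, v l‖ₑ ^ 2 = ∫⁻ p, ‖F p - ∑ l ∈ s, g (p.1 - latticePoint l)
          * mFourier l p.2‖ₑ ^ 2 ∂zakMeasure d := by
        rw [Lp_enorm_sq]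
        refine lintegral_congr_ae ?_
        filter_upwards [hsum s, Lp.coeFn_sub F (∑ l ∈ s, v l)] with p hp hp2
        rw [hp2, Pi.sub_apply, hp]
      have h2 : AEMeasurable (fun p : RSpace d × UnitAddTorus (Fin d) =>
          ‖F p - ∑ l ∈ s, g (p.1 - latticePoint l) * mFourier l p.2‖ₑ ^ 2) (zakMeasure d) :=
        ((Lp.aestronglyMeasurable F).sub (hmem s).1).enorm.pow_const 2
      rw [h1, lintegral_zakMeasure h2]
      refine lintegral_mono_ae ?_
      filter_upwards [hFm] with x hx
      rw [lintegral_enorm_sq_eq_tsum_torusCoeff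
        (memLp_sub_sum_mFourier hx (fun l => g (x - latticePoint l)) s)]
      refine le_trans (le_of_eq ?_) (ENNReal.le_tsum k)
      rw [torusCoeff_sub_sum (hx.integrable one_le_two), if_pos hks]
    have hlim : Tendsto (fun s : Finset (Fin d → ℤ) => ‖F - ∑ l ∈ s, v l‖ₑ ^ 2) atTop (𝓝 0) := by
      have h1 : Tendsto (fun s : Finset (Fin d → ℤ) => F - ∑ l ∈ s, v l) atTop (𝓝 (F - F)) :=
        tendsto_const_nhds.sub hFs
      rw [sub_self] at h1
      have h2 := (continuous_enorm.tendsto _).comp h1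
      rw [enorm_zero] at h2
      simpa using ENNReal.Tendsto.pow (n := 2) h2
    have h0 : ∫⁻ x, ‖torusCoeff (fun y => F (x, y)) k - g (x - latticePoint k)‖ₑ ^ 2
        ∂cubeMeasure d = 0 := by
      refine le_antisymm (ge_of_tendsto hlim ?_) zero_le
      filter_upwards [eventually_ge_atTop {k}] with s hs
      exact hle s (hs (Finset.mem_singleton_self k))
    have hmeas : AEMeasurable (fun x => ‖torusCoeff (fun y => F (x, y)) k
        - g (x - latticePoint k)‖ₑ ^ 2) (cubeMeasure d) := by
      refine (AEStronglyMeasurable.sub ?_ ?_).enorm.pow_const 2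
      · have : StronglyMeasurable fun p : RSpace d × UnitAddTorus (Fin d) =>
            mFourier (-k) p.2 * F p :=
          ((mFourier (-k)).continuous.stronglyMeasurable.comp_measurable measurable_snd).mul
            (Lp.stronglyMeasurable F)
        exact (this.integral_prod_right' (ν := torusMeasure (Fin d))).aestronglyMeasurable
      · exact (hg.1.comp_measurePreserving
          (measurePreserving_sub_right volume (latticePoint k))).restrict
    rw [lintegral_eq_zero_iff' hmeas] at h0
    filter_upwards [h0] with x hx
    simpa [sub_eq_zero] using hx
  filter_upwards [hFm, ae_all_iff.2 hcoef] with x hx hx2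
  exact ⟨hx, hx2⟩

end

/-! ### Riesz bounds and the Zak transform -/

noncomputable section

open UnitAddTorus

section Weight

variable {ι : Type*} [Fintype ι]

/-- A weight `V` on the torus is bounded above and below as soon as the weighted `L²` norm of
trigonometric polynomials is comparable with the unweighted one. -/
theorem weight_bounds_of_trigPolynomials {V : UnitAddTorus ι → ℝ≥0∞}
    (hV : AEMeasurable V (torusMeasure ι)) {a b : ℝ≥0∞} (ha : a ≠ ∞) (hb : b ≠ ∞)
    (hlow : ∀ (s : Finset (ι → ℤ)) (c : (ι → ℤ) → ℂ),
      a * eLpNorm (fun t => ∑ k ∈ s, c k * mFourier k t) 2 (torusMeasure ι)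
        ≤ eLpNorm (fun t => ∑ k ∈ s, c k * mFourier k t) 2 ((torusMeasure ι).withDensity V))
    (hup : ∀ (s : Finset (ι → ℤ)) (c : (ι → ℤ) → ℂ),
      eLpNorm (fun t => ∑ k ∈ s, c k * mFourier k t) 2 ((torusMeasure ι).withDensity V)
        ≤ b * eLpNorm (fun t => ∑ k ∈ s, c k * mFourier k t) 2 (torusMeasure ι)) :
    ∀ᵐ t ∂torusMeasure ι, a ^ 2 ≤ V t ∧ V t ≤ b ^ 2 := by
  set τ := torusMeasure ι
  set ν := τ.withDensity V
  have hac : ν ≪ τ := withDensity_absolutelyContinuous _ _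
  -- the partial sums of the Fourier series of `f`
  let P : (UnitAddTorus ι → ℂ) → Finset (ι → ℤ) → UnitAddTorus ι → ℂ :=
    fun f s t => ∑ k ∈ s, torusCoeff f k * mFourier k t
  have hPmem : ∀ f s, MemLp (P f s) 2 τ := fun f s =>
    memLp_sum_mFourier _ s
  have hlim : ∀ f, MemLp f 2 τ → Tendsto (fun s => eLpNorm (P f s - f) 2 τ) atTop (𝓝 0) := by
    intro f hf
    have h1 := tendsto_partialSum hf
    have h2 : ∀ s, ∫⁻ t, ‖f t - ∑ l ∈ s, torusCoeff f l * mFourier l t‖ₑ ^ 2 ∂τ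
        = eLpNorm (P f s - f) 2 τ ^ 2 := fun s => by
      rw [eLpNorm_two_sq]
      refine lintegral_congr fun t => ?_
      rw [Pi.sub_apply, ← enorm_neg, neg_sub]
    replace h1 := h1.congr h2
    have h3 := (ENNReal.continuous_rpow_const (y := 1 / 2)).tendsto 0 |>.comp h1
    rw [ENNReal.zero_rpow_of_pos (by norm_num)] at h3
    refine h3.congr fun s => ?_
    simp only [Function.comp_apply]
    rw [← ENNReal.rpow_natCast, ← ENNReal.rpow_mul]
    norm_num
  have hPle : ∀ f, MemLp f 2 τ → ∀ s, eLpNorm (P f s) 2 τ ≤ eLpNorm f 2 τ := by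
    intro f hf s
    refine (ENNReal.pow_right_strictMono two_ne_zero).le_iff_le.1 ?_
    rw [eLpNorm_two_sq, eLpNorm_two_sq, lintegral_enorm_sq_eq_tsum_torusCoeff hf,
      lintegral_enorm_sq_eq_tsum_torusCoeff (hPmem f s)]
    refine ENNReal.tsum_le_tsum fun k => ?_
    classical
    rw [torusCoeff_sum_mFourier]
    split_ifs <;> simp
  -- the upper bound passes to the limit by Fatou's lemma, and then the lower bound by continuity
  have hupper : ∀ f : UnitAddTorus ι → ℂ, MemLp f 2 τ → eLpNorm f 2 ν ≤ b * eLpNorm f 2 τ := by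
    intro f hf
    have h1 := tendstoInMeasure_of_tendsto_eLpNorm two_ne_zero (fun s => (hPmem f s).1) hf.1
      (hlim f hf)
    obtain ⟨ns, -, hns⟩ := h1.exists_seq_tendsto_ae'
    refine (Lp.eLpNorm_lim_le_liminf_eLpNorm (fun n => ((hPmem f (ns n)).1.mono_ac hac)) f
      (hac.ae_le hns)).trans ?_
    refine liminf_le_of_frequently_le' (Frequently.of_forall fun n => ?_)
    exact (hup _ _).trans (by gcongr; exact hPle f hf _)
  have hlower : ∀ f : UnitAddTorus ι → ℂ, MemLp f 2 τ → a * eLpNorm f 2 τ ≤ eLpNorm f 2 ν := by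
    intro f hf
    have h1 : ∀ s, a * eLpNorm f 2 τ ≤ eLpNorm f 2 ν + (a + b) * eLpNorm (P f s - f) 2 τ := by
      intro s
      have hd : MemLp (P f s - f) 2 τ := (hPmem f s).sub hf
      calc a * eLpNorm f 2 τ
          ≤ a * (eLpNorm (P f s) 2 τ + eLpNorm (P f s - f) 2 τ) := by
            gcongr
            have : f = P f s - (P f s - f) := by ext; simp
            conv_lhs => rw [this]
            exact eLpNorm_sub_le (hPmem f s).1 hd.1 one_le_two
        _ ≤ eLpNorm (P f s) 2 ν + a * eLpNorm (P f s - f) 2 τ := by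
            rw [mul_add]; gcongr; exact hlow _ _
        _ ≤ (eLpNorm f 2 ν + eLpNorm (P f s - f) 2 ν) + a * eLpNorm (P f s - f) 2 τ := by
            gcongr
            have : P f s = f + (P f s - f) := by ext; simp
            conv_lhs => rw [this]
            exact eLpNorm_add_le (hf.1.mono_ac hac) (hd.1.mono_ac hac) one_le_two
        _ ≤ (eLpNorm f 2 ν + b * eLpNorm (P f s - f) 2 τ) + a * eLpNorm (P f s - f) 2 τ := by
            gcongr; exact hupper _ hd
        _ = _ := by ring
    have h2 : Tendsto (fun s => eLpNorm f 2 ν + (a + b) * eLpNorm (P f s - f) 2 τ) atTop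
        (𝓝 (eLpNorm f 2 ν + (a + b) * 0)) :=
      tendsto_const_nhds.add (ENNReal.Tendsto.const_mul (hlim f hf)
        (Or.inr (ENNReal.add_ne_top.2 ⟨ha, hb⟩)))
    rw [mul_zero, add_zero] at h2
    exact ge_of_tendsto h2 (Eventually.of_forall h1)
  have hind : ∀ s, MeasurableSet s → a ^ 2 * τ s ≤ ∫⁻ t in s, V t ∂τ ∧
      ∫⁻ t in s, V t ∂τ ≤ b ^ 2 * τ s := by
    intro s hs
    have hf : MemLp (s.indicator fun _ => (1 : ℂ)) 2 τ :=
      memLp_indicator_const 2 hs 1 (Or.inr (measure_ne_top _ _))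
    have hn : ∀ ρ : Measure (UnitAddTorus ι), eLpNorm (s.indicator fun _ => (1 : ℂ)) 2 ρ ^ 2
        = ρ s := fun ρ => by
      rw [eLpNorm_two_sq]
      have : (fun t => ‖s.indicator (fun _ => (1 : ℂ)) t‖ₑ ^ 2) = s.indicator fun _ => 1 := by
        ext t
        by_cases ht : t ∈ s <;> simp [ht]
      rw [this]
      exact lintegral_indicator_one hs
    have e1 := pow_le_pow_left' (hlower _ hf) 2
    have e2 := pow_le_pow_left' (hupper _ hf) 2
    rw [mul_pow, hn, hn, withDensity_apply _ hs] at e1 e2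
    exact ⟨e1, e2⟩
  have hA : (fun _ => a ^ 2) ≤ᵐ[τ] V :=
    ae_le_of_forall_setLIntegral_le_of_sigmaFinite₀ aemeasurable_const fun s hs _ => by
      rw [setLIntegral_const]; exact (hind s hs).1
  have hB : V ≤ᵐ[τ] fun _ => b ^ 2 :=
    ae_le_of_forall_setLIntegral_le_of_sigmaFinite₀ hV fun s hs _ => by
      rw [setLIntegral_const]; exact (hind s hs).2
  filter_upwards [hA, hB] with t h1 h2
  exact ⟨h1, h2⟩

end Weight

variable {d : ℕ}

/-- Coordinates `(x, y) ∈ (0,1]^d × 𝕋^d` of a point of the `2d`-dimensional torus. -/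
def zakCoord (t : UnitAddTorus (Fin d ⊕ Fin d)) : RSpace d × UnitAddTorus (Fin d) :=
  (torusRep fun j => t (Sum.inl j), fun j => t (Sum.inr j))

theorem measurePreserving_zakCoord :
    MeasurePreserving (zakCoord (d := d)) (torusMeasure (Fin d ⊕ Fin d)) (zakMeasure d) := by
  have h1 := measurePreserving_sumPiEquivProdPi (fun _ : Fin d ⊕ Fin d =>
    (AddCircle.haarAddCircle : Measure UnitAddCircle))
  have h2 : MeasurePreserving (Prod.map (torusRep (d := d)) id)
      ((torusMeasure (Fin d)).prod (torusMeasure (Fin d))) (zakMeasure d) :=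
    measurePreserving_torusRep.prod (MeasurePreserving.id _)
  exact h2.comp h1

/-- The character `e^{2πi (n·x - m·y)}` of `ℝ^d × 𝕋^d`. -/
def zakChar (m n : Fin d → ℤ) (p : RSpace d × UnitAddTorus (Fin d)) : ℂ :=
  mFourier n (toTorus p.1) * mFourier (-m) p.2

theorem zakChar_zakCoord (m n : Fin d → ℤ) (t : UnitAddTorus (Fin d ⊕ Fin d)) :
    zakChar m n (zakCoord t) = mFourier (Sum.elim n (-m)) t := by
  simp only [zakChar, zakCoord, toTorus_torusRep, mFourier, ContinuousMap.coe_mk,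
    Fintype.prod_sum_type, Sum.elim_inl, Sum.elim_inr]

theorem lintegral_zakCoord {φ : RSpace d × UnitAddTorus (Fin d) → ℝ≥0∞}
    (hφ : AEMeasurable φ (zakMeasure d)) :
    ∫⁻ t, φ (zakCoord t) ∂torusMeasure (Fin d ⊕ Fin d) = ∫⁻ p, φ p ∂zakMeasure d := by
  rw [← measurePreserving_zakCoord.map_eq] at hφ ⊢
  rw [lintegral_map' hφ measurePreserving_zakCoord.measurable.aemeasurable]

theorem integral_zakCoord {φ : RSpace d × UnitAddTorus (Fin d) → ℂ}
    (hφ : AEStronglyMeasurable φ (zakMeasure d)) :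
    ∫ t, φ (zakCoord t) ∂torusMeasure (Fin d ⊕ Fin d) = ∫ p, φ p ∂zakMeasure d := by
  rw [← measurePreserving_zakCoord.map_eq] at hφ ⊢
  rw [integral_map measurePreserving_zakCoord.measurable.aemeasurable hφ]

theorem gaborSystem_congr (g : L2 d) (p : (Fin d → ℤ) × (Fin d → ℤ)) :
    gaborSystem g p =ᵐ[volume] gaborFun g p.1 p.2 :=
  (memLp_gaborFun g p.1 p.2).coeFn_toLp

theorem IsZak.zakChar_mul {g : RSpace d → ℂ} {F : RSpace d × UnitAddTorus (Fin d) → ℂ}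
    (h : IsZak g F) (m n : Fin d → ℤ) :
    IsZak (gaborFun g m n) (fun p => zakChar m n p * F p) := h.gabor m n

/-- The Riesz inequalities for finite sums. -/
theorem IsRieszBasisWith.bounds_finset {H ι : Type*} [NormedAddCommGroup H] [InnerProductSpace ℂ H]
    {v : ι → H} {A B : ℝ} (h : IsRieszBasisWith v A B) (s : Finset ι) (c : ι → ℂ) :
    A * ∑ i ∈ s, ‖c i‖ ^ 2 ≤ ‖∑ i ∈ s, c i • v i‖ ^ 2 ∧
      ‖∑ i ∈ s, c i • v i‖ ^ 2 ≤ B * ∑ i ∈ s, ‖c i‖ ^ 2 := by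
  classical
  set a : ι → ℂ := fun i => if i ∈ s then c i else 0 with ha
  have h0 : ∀ i ∉ s, ‖a i‖ ^ 2 = 0 := fun i hi => by simp [ha, hi]
  have h1 : ∀ i ∉ s, a i • v i = 0 := fun i hi => by simp [ha, hi]
  have hs : Summable fun i => ‖a i‖ ^ 2 := summable_of_ne_finset_zero (s := s) h0
  have e1 : ∑' i, ‖a i‖ ^ 2 = ∑ i ∈ s, ‖c i‖ ^ 2 := by
    rw [tsum_eq_sum h0]
    exact Finset.sum_congr rfl fun i hi => by simp [ha, hi]
  have e2 : ∑' i, a i • v i = ∑ i ∈ s, c i • v i := by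
    rw [tsum_eq_sum h1]
    exact Finset.sum_congr rfl fun i hi => by simp [ha, hi]
  have hlow := h.lower a hs
  have hup := h.upper a hs
  rw [e1, e2] at hlow hup
  exact ⟨hlow, hup⟩

/-- The frequency `(n, -m)` of the character attached to the time-frequency shift `(m, n)`. -/
def gaborIndex (d : ℕ) : (Fin d ⊕ Fin d → ℤ) ≃ (Fin d → ℤ) × (Fin d → ℤ) where
  toFun l := (-fun j => l (Sum.inr j), fun j => l (Sum.inl j))
  invFun p := Sum.elim p.2 (-p.1)
  left_inv l := by ext j; cases j <;> simp
  right_inv p := by ext j <;> simp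

theorem zakChar_gaborIndex (l : Fin d ⊕ Fin d → ℤ) (t : UnitAddTorus (Fin d ⊕ Fin d)) :
    zakChar (gaborIndex d l).1 (gaborIndex d l).2 (zakCoord t) = mFourier l t := by
  rw [zakChar_zakCoord]
  exact congrArg (fun l => mFourier l t) ((gaborIndex d).symm_apply_apply l)

/-- The Riesz bounds of a Gabor system are pointwise bounds for the Zak transform of its window:
under the Zak transform a finite combination of time-frequency shifts becomes `F` times a
trigonometric polynomial, so `|F|²` is a weight to which `weight_bounds_of_trigPolynomials`
applies. -/
theorem IsZak.bounds_of_isRieszBasisWith {g : L2 d} {A B : ℝ}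
    (hR : IsRieszBasisWith (gaborSystem g) A B)
    {F : RSpace d × UnitAddTorus (Fin d) → ℂ} (h : IsZak g F) :
    ∀ᵐ p ∂zakMeasure d, A ≤ ‖F p‖ ^ 2 ∧ ‖F p‖ ^ 2 ≤ B := by
  have hA := hR.lower_pos
  have hB := hR.upper_pos
  have hmp := measurePreserving_zakCoord (d := d)
  set V : UnitAddTorus (Fin d ⊕ Fin d) → ℝ≥0∞ := fun t => ‖F (zakCoord t)‖ₑ ^ 2 with hVdef
  have hV : AEMeasurable V (torusMeasure (Fin d ⊕ Fin d)) :=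
    (h.aesm.comp_measurePreserving hmp).enorm.pow_const 2
  have hnorm : ∀ (s : Finset (Fin d ⊕ Fin d → ℤ)) (c : (Fin d ⊕ Fin d → ℤ) → ℂ),
      eLpNorm (fun t => ∑ k ∈ s, c k * mFourier k t) 2
        ((torusMeasure (Fin d ⊕ Fin d)).withDensity V) ^ 2
        = ‖∑ k ∈ s, c k • gaborSystem g (gaborIndex d k)‖ₑ ^ 2 := by
    intro s c
    have hz : IsZak (fun x => ∑ k ∈ s, c k * gaborFun g (gaborIndex d k).1 (gaborIndex d k).2 x)
        (fun p => ∑ k ∈ s, c k * (zakChar (gaborIndex d k).1 (gaborIndex d k).2 p * F p)) :=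
      IsZak.finset_sum s fun k _ => (h.zakChar_mul _ _).const_mul _
    have hae : (∑ k ∈ s, c k • gaborSystem g (gaborIndex d k) : L2 d) =ᵐ[volume]
        fun x => ∑ k ∈ s, c k * gaborFun g (gaborIndex d k).1 (gaborIndex d k).2 x := by
      have h1 := Lp.coeFn_fun_finsetSum s fun k => c k • gaborSystem g (gaborIndex d k)
      have h2 : ∀ᵐ x, ∀ k, (c k • gaborSystem g (gaborIndex d k) : L2 d) x
          = c k * gaborFun g (gaborIndex d k).1 (gaborIndex d k).2 x := by
        refine ae_all_iff.2 fun k => ?_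
        filter_upwards [Lp.coeFn_smul (c k) (gaborSystem g (gaborIndex d k)),
          gaborSystem_congr g (gaborIndex d k)] with x hx hx2
        rw [hx, Pi.smul_apply, hx2, smul_eq_mul]
      filter_upwards [h1, h2] with x hx hx2
      rw [hx]
      exact Finset.sum_congr rfl fun k _ => hx2 k
    have hmeas : AEStronglyMeasurable
        (fun x => ∑ k ∈ s, c k * gaborFun g (gaborIndex d k).1 (gaborIndex d k).2 x) volume :=
      (Lp.aestronglyMeasurable _).congr hae
    have hzl := hz.lintegral_eq hmeas
    have hcont : Continuous fun t : UnitAddTorus (Fin d ⊕ Fin d) =>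
        ∑ k ∈ s, c k * mFourier k t := by fun_prop
    rw [Lp_enorm_sq, eLpNorm_two_sq, lintegral_withDensity_eq_lintegral_mul₀' hV
      (by exact hcont.aestronglyMeasurable.enorm.pow_const 2)]
    have e1 : ∫⁻ x, ‖(∑ k ∈ s, c k • gaborSystem g (gaborIndex d k) : L2 d) x‖ₑ ^ 2
        = ∫⁻ x, ‖∑ k ∈ s, c k * gaborFun g (gaborIndex d k).1 (gaborIndex d k).2 x‖ₑ ^ 2 :=
      lintegral_congr_ae (by filter_upwards [hae] with x hx; rw [hx])
    rw [e1, ← hzl, ← lintegral_zakCoord (hz.aesm.enorm.pow_const 2)]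
    refine lintegral_congr fun t => ?_
    simp only [Pi.mul_apply, hVdef, zakChar_gaborIndex]
    rw [← mul_pow, ← enorm_mul, mul_comm, Finset.sum_mul]
    simp only [mul_assoc]
  have hP : ∀ (s : Finset (Fin d ⊕ Fin d → ℤ)) (c : (Fin d ⊕ Fin d → ℤ) → ℂ),
      eLpNorm (fun t => ∑ k ∈ s, c k * mFourier k t) 2 (torusMeasure (Fin d ⊕ Fin d)) ^ 2
        = ENNReal.ofReal (∑ k ∈ s, ‖c k‖ ^ 2) := by
    intro s c
    rw [eLpNorm_two_sq, lintegral_enorm_sq_sum_mFourier,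
      ENNReal.ofReal_sum_of_nonneg fun _ _ => by positivity]
    refine Finset.sum_congr rfl fun k _ => ?_
    rw [ENNReal.ofReal_pow (norm_nonneg _), ofReal_norm]
  have hRs : ∀ (s : Finset (Fin d ⊕ Fin d → ℤ)) (c : (Fin d ⊕ Fin d → ℤ) → ℂ),
      A * ∑ k ∈ s, ‖c k‖ ^ 2 ≤ ‖∑ k ∈ s, c k • gaborSystem g (gaborIndex d k)‖ ^ 2 ∧
      ‖∑ k ∈ s, c k • gaborSystem g (gaborIndex d k)‖ ^ 2 ≤ B * ∑ k ∈ s, ‖c k‖ ^ 2 := by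
    intro s c
    have := IsRieszBasisWith.bounds_finset hR (s.map (gaborIndex d).toEmbedding)
      fun p => c ((gaborIndex d).symm p)
    simpa only [Finset.sum_map, Equiv.coe_toEmbedding, Equiv.symm_apply_apply] using this
  have hsq : ∀ {x y : ℝ≥0∞}, x ^ 2 ≤ y ^ 2 → x ≤ y := fun {x y} hxy =>
    (ENNReal.pow_right_strictMono two_ne_zero).le_iff_le.1 hxy
  have key := weight_bounds_of_trigPolynomials hV (a := ENNReal.ofReal √A)
    (b := ENNReal.ofReal √B) ENNReal.ofReal_ne_top ENNReal.ofReal_ne_top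
    (fun s c => hsq (by
      rw [mul_pow, hnorm, hP, ← ENNReal.ofReal_pow (Real.sqrt_nonneg _), Real.sq_sqrt hA.le,
        ← ENNReal.ofReal_mul hA.le, ← ofReal_norm, ← ENNReal.ofReal_pow (norm_nonneg _)]
      exact ENNReal.ofReal_le_ofReal (hRs s c).1))
    (fun s c => hsq (by
      rw [mul_pow, hnorm, hP, ← ENNReal.ofReal_pow (Real.sqrt_nonneg _), Real.sq_sqrt hB.le,
        ← ENNReal.ofReal_mul hB.le, ← ofReal_norm, ← ENNReal.ofReal_pow (norm_nonneg _)]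
      exact ENNReal.ofReal_le_ofReal (hRs s c).2))
  rw [← ENNReal.ofReal_pow (Real.sqrt_nonneg _), ← ENNReal.ofReal_pow (Real.sqrt_nonneg _),
    Real.sq_sqrt hA.le, Real.sq_sqrt hB.le] at key
  have hFn : AEMeasurable (fun p => ‖F p‖ ^ 2) (zakMeasure d) :=
    h.aesm.norm.aemeasurable.pow_const 2
  have hnull : NullMeasurableSet {p | A ≤ ‖F p‖ ^ 2 ∧ ‖F p‖ ^ 2 ≤ B} (zakMeasure d) :=
    (nullMeasurableSet_le aemeasurable_const hFn).inter
      (nullMeasurableSet_le hFn aemeasurable_const)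
  rw [ae_iff, ← hmp.map_eq, Measure.map_apply₀ hmp.measurable.aemeasurable
    (by rw [hmp.map_eq]; exact hnull.compl)]
  suffices key2 : ∀ᵐ t ∂torusMeasure (Fin d ⊕ Fin d),
      A ≤ ‖F (zakCoord t)‖ ^ 2 ∧ ‖F (zakCoord t)‖ ^ 2 ≤ B from ae_iff.1 key2
  filter_upwards [key] with t ht
  simp only [hVdef] at ht
  rw [← ofReal_norm, ← ENNReal.ofReal_pow (norm_nonneg _),
    ENNReal.ofReal_le_ofReal_iff (by positivity), ENNReal.ofReal_le_ofReal_iff hB.le] at ht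
  exact ht

/-- A unimodular Zak transform makes the Gabor system orthonormal. -/
theorem IsZak.orthonormal {g : L2 d} {F : RSpace d × UnitAddTorus (Fin d) → ℂ} (h : IsZak g F)
    (hF : ∀ᵐ p ∂zakMeasure d, ‖F p‖ = 1) : Orthonormal ℂ (gaborSystem g) := by
  classical
  rw [orthonormal_iff_ite]
  intro p q
  have hp := memLp_gaborFun g p.1 p.2
  have hq := memLp_gaborFun g q.1 q.2
  have h1 := (h.zakChar_mul p.1 p.2).inner_eq (h.zakChar_mul q.1 q.2) hp hq
  change inner ℂ (gaborSystem g p) (gaborSystem g q) = _ at h1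
  rw [h1, L2.inner_def]
  set l := (gaborIndex d).symm p with hl
  set k := (gaborIndex d).symm q with hk
  have hpl : p = gaborIndex d l := by simp [hl]
  have hqk : q = gaborIndex d k := by simp [hk]
  have e1 : ∫ w, inner ℂ (((h.zakChar_mul p.1 p.2).memLp hp).toLp _ w)
      (((h.zakChar_mul q.1 q.2).memLp hq).toLp _ w) ∂zakMeasure d
      = ∫ w, (starRingEnd ℂ) (zakChar p.1 p.2 w) * zakChar q.1 q.2 w ∂zakMeasure d := by
    refine integral_congr_ae ?_
    filter_upwards [((h.zakChar_mul p.1 p.2).memLp hp).coeFn_toLp,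
      ((h.zakChar_mul q.1 q.2).memLp hq).coeFn_toLp, hF] with w h1 h2 h3
    rw [h1, h2, RCLike.inner_apply', map_mul]
    have : (starRingEnd ℂ) (F w) * F w = 1 := by
      rw [mul_comm, Complex.mul_conj, Complex.normSq_eq_norm_sq, h3]; simp
    linear_combination (starRingEnd ℂ) (zakChar p.1 p.2 w) * zakChar q.1 q.2 w * this
  rw [e1, ← integral_zakCoord]
  · rw [hpl, hqk]
    have e2 : ∀ t : UnitAddTorus (Fin d ⊕ Fin d), (starRingEnd ℂ) (zakChar (gaborIndex d l).1
        (gaborIndex d l).2 (zakCoord t)) * zakChar (gaborIndex d k).1 (gaborIndex d k).2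
        (zakCoord t) = mFourier (-l + k) t := fun t => by
      rw [zakChar_gaborIndex, zakChar_gaborIndex, mFourier_add, mFourier_neg]
    simp_rw [e2]
    rw [integral_mFourier]
    simp only [neg_add_eq_zero, EmbeddingLike.apply_eq_iff_eq]
  · have hc : ∀ m n : Fin d → ℤ, Continuous (zakChar m n) := fun m n =>
      ((mFourier n).continuous.comp (continuous_toTorus.comp continuous_fst)).mul
        ((mFourier (-m)).continuous.comp continuous_snd)
    exact ((Complex.continuous_conj.comp (hc _ _)).mul (hc _ _)).aestronglyMeasurable

/-- A unimodular Zak transform makes the Gabor system complete. -/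
theorem IsZak.orthogonal_span_eq_bot {g : L2 d} {F : RSpace d × UnitAddTorus (Fin d) → ℂ}
    (h : IsZak g F) (hF : ∀ᵐ p ∂zakMeasure d, ‖F p‖ = 1) :
    (Submodule.span ℂ (Set.range (gaborSystem g)))ᗮ = ⊥ := by
  rw [Submodule.eq_bot_iff]
  intro u hu
  -- all Fourier coefficients of `conj F * U`, with `U` the Zak transform of `u`, vanish
  obtain ⟨U, -, hU⟩ := exists_isZak (Lp.memLp u)
  have hmp := measurePreserving_zakCoord (d := d)
  set f : UnitAddTorus (Fin d ⊕ Fin d) → ℂ := fun t =>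
    (starRingEnd ℂ) (F (zakCoord t)) * U (zakCoord t) with hf
  have hFU : AEStronglyMeasurable (fun p => (starRingEnd ℂ) (F p) * U p) (zakMeasure d) :=
    (Complex.continuous_conj.comp_aestronglyMeasurable h.aesm).mul hU.aesm
  have hF' : ∀ᵐ t ∂torusMeasure (Fin d ⊕ Fin d), ‖F (zakCoord t)‖ = 1 :=
    hmp.quasiMeasurePreserving.ae hF
  have hfmem : MemLp f 2 (torusMeasure (Fin d ⊕ Fin d)) := by
    refine ((hU.memLp (Lp.memLp u)).comp_measurePreserving hmp).of_le
      (hFU.comp_measurePreserving hmp) ?_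
    filter_upwards [hF'] with t ht
    simp [hf, ht]
  have hzero : ∀ l, torusCoeff f l = 0 := by
    intro l
    set p := gaborIndex d l with hp
    have hpm := memLp_gaborFun g p.1 p.2
    have h1 := (h.zakChar_mul p.1 p.2).inner_eq hU hpm (Lp.memLp u)
    have h2 : inner ℂ (hpm.toLp _) ((Lp.memLp u).toLp u) = 0 := by
      rw [Lp.toLp_coeFn]
      exact hu _ (Submodule.subset_span ⟨p, rfl⟩)
    rw [h2, L2.inner_def] at h1
    have e1 : ∫ w, inner ℂ (((h.zakChar_mul p.1 p.2).memLp hpm).toLp _ w)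
        ((hU.memLp (Lp.memLp u)).toLp _ w) ∂zakMeasure d
        = ∫ w, (starRingEnd ℂ) (zakChar p.1 p.2 w) * ((starRingEnd ℂ) (F w) * U w)
          ∂zakMeasure d := by
      refine integral_congr_ae ?_
      filter_upwards [((h.zakChar_mul p.1 p.2).memLp hpm).coeFn_toLp,
        (hU.memLp (Lp.memLp u)).coeFn_toLp] with w h1 h2
      rw [h1, h2, RCLike.inner_apply', map_mul, mul_assoc]
    have hc : Continuous fun w => (starRingEnd ℂ) (zakChar p.1 p.2 w) :=
      Complex.continuous_conj.comp
        (((mFourier p.2).continuous.comp (continuous_toTorus.comp continuous_fst)).mul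
          ((mFourier (-p.1)).continuous.comp continuous_snd))
    have e2 := integral_zakCoord (hc.aestronglyMeasurable.mul hFU)
    rw [torusCoeff, h1, e1]
    refine Eq.trans ?_ e2
    refine integral_congr_ae (ae_of_all _ fun t => ?_)
    simp only [hf, hp, mFourier_neg, Pi.mul_apply]
    rw [zakChar_gaborIndex]
  have h0 := ae_eq_zero_of_torusCoeff_eq_zero hfmem hzero
  have hU0 : ∫⁻ p, ‖U p‖ₑ ^ 2 ∂zakMeasure d = 0 := by
    rw [← lintegral_zakCoord (hU.aesm.enorm.pow_const 2),
      ← lintegral_zero (μ := torusMeasure (Fin d ⊕ Fin d))]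
    refine lintegral_congr_ae ?_
    filter_upwards [h0, hF'] with t ht ht2
    have : F (zakCoord t) ≠ 0 := by rw [← norm_ne_zero_iff, ht2]; exact one_ne_zero
    have h3 : U (zakCoord t) = 0 := by simpa [hf, this] using ht
    simp [h3]
  rw [hU.lintegral_eq (Lp.aestronglyMeasurable u), ← Lp_enorm_sq] at hU0
  simpa using hU0

theorem isRieszBasisWith_one_of_orthonormal {H ι : Type*} [NormedAddCommGroup H]
    [InnerProductSpace ℂ H] [CompleteSpace H] {v : ι → H} (hv : Orthonormal ℂ v)
    (hc : (Submodule.span ℂ (Set.range v))ᗮ = ⊥) : IsRieszBasisWith v 1 1 := by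
  set b := HilbertBasis.mkOfOrthogonalEqBot hv hc with hb
  have hbv : ⇑b = v := HilbertBasis.coe_mkOfOrthogonalEqBot hv hc
  have key : ∀ a : ι → ℂ, Summable (fun i => ‖a i‖ ^ 2) →
      Summable (fun i => a i • v i) ∧ ‖∑' i, a i • v i‖ ^ 2 = ∑' i, ‖a i‖ ^ 2 := by
    intro a ha
    have hmem : Memℓp a 2 := by
      rw [memℓp_gen_iff (by simp)]
      simpa using ha
    have h1 := b.hasSum_repr_symm ⟨a, hmem⟩
    rw [hbv] at h1
    refine ⟨h1.summable, ?_⟩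
    have h2 : ∑' i, a i • v i = b.repr.symm ⟨a, hmem⟩ := h1.tsum_eq
    rw [h2, LinearIsometryEquiv.norm_map]
    have h3 := lp.norm_rpow_eq_tsum (p := 2) (by simp) (⟨a, hmem⟩ : lp (fun _ : ι => ℂ) 2)
    simpa using h3
  refine ⟨one_pos, one_pos, ?_, fun a ha => (key a ha).1, fun a ha => ?_, fun a ha => ?_⟩
  · exact (Submodule.topologicalClosure_eq_top_iff).2 hc
  · rw [(key a ha).2, one_mul]
  · rw [(key a ha).2, one_mul]

/-- A unimodular Zak transform makes the Gabor system an orthonormal basis. -/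
theorem IsZak.isRieszBasisWith_one {g : L2 d} {F : RSpace d × UnitAddTorus (Fin d) → ℂ}
    (h : IsZak g F) (hF : ∀ᵐ p ∂zakMeasure d, ‖F p‖ = 1) :
    IsRieszBasisWith (gaborSystem g) 1 1 :=
  isRieszBasisWith_one_of_orthonormal (h.orthonormal hF) (h.orthogonal_span_eq_bot hF)

end

noncomputable section

open UnitAddTorus

variable {d : ℕ}

/-! ### Fourier transform of translations -/

/-- The character `e^{-2πi v·ξ}`. -/
def phase (v ξ : RSpace d) : ℂ := Complex.exp (-(2 * Real.pi * Complex.I * (inner ℝ v ξ : ℝ)))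

theorem norm_phase (v ξ : RSpace d) : ‖phase v ξ‖ = 1 := by
  rw [phase, Complex.norm_exp]
  simp

theorem continuous_phase (v : RSpace d) : Continuous (phase v) := by
  unfold phase
  fun_prop

/-- Translation by `v` on `L²(ℝ^d)`. -/
def translateL2 (v : RSpace d) : L2 d →ₗᵢ[ℂ] L2 d :=
  Lp.compMeasurePreservingₗᵢ ℂ (fun x => x - v) (measurePreserving_sub_right volume v)

theorem translateL2_ae (v : RSpace d) (u : L2 d) :
    translateL2 v u =ᵐ[volume] fun x => u (x - v) :=
  Lp.coeFn_compMeasurePreserving u (measurePreserving_sub_right volume v)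

theorem memLp_phase_mul (v : RSpace d) (u : L2 d) :
    MemLp (fun ξ => phase v ξ * u ξ) 2 volume :=
  (Lp.memLp u).of_le ((continuous_phase v).aestronglyMeasurable.mul (Lp.aestronglyMeasurable u))
    (ae_of_all _ fun ξ => by simp [norm_phase])

/-- Multiplication by the character `e^{-2πi v·ξ}` on `L²(ℝ^d)`. -/
def phaseL2 (v : RSpace d) (u : L2 d) : L2 d := (memLp_phase_mul v u).toLp

theorem phaseL2_ae (v : RSpace d) (u : L2 d) :
    phaseL2 v u =ᵐ[volume] fun ξ => phase v ξ * u ξ :=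
  (memLp_phase_mul v u).coeFn_toLp

theorem continuous_phaseL2 (v : RSpace d) : Continuous (phaseL2 v) := by
  refine Isometry.continuous fun u w => ?_
  rw [Lp.edist_def, Lp.edist_def]
  refine eLpNorm_congr_norm_ae ?_
  filter_upwards [phaseL2_ae v u, phaseL2_ae v w] with ξ h1 h2
  rw [Pi.sub_apply, Pi.sub_apply, h1, h2, ← mul_sub, norm_mul, norm_phase, one_mul]

/-- The Fourier transform on `L²` turns translations into multiplications by characters. -/
theorem fourier_translateL2 (v : RSpace d) (u : L2 d) :
    (𝓕 (translateL2 v u) : L2 d) = phaseL2 v (𝓕 u) := by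
  refine DenseRange.induction_on (p := fun u : L2 d =>
    (𝓕 (translateL2 v u) : L2 d) = phaseL2 v (𝓕 u))
    (SchwartzMap.denseRange_toLpCLM (p := 2) (E := RSpace d) (F := ℂ) (μ := volume)
      ENNReal.ofNat_ne_top) u ?_ ?_
  · refine isClosed_eq ?_ ?_
    · exact (Lp.fourierTransformₗᵢ (RSpace d) ℂ).continuous.comp (translateL2 v).continuous
    · exact (continuous_phaseL2 v).comp (Lp.fourierTransformₗᵢ (RSpace d) ℂ).continuous
  · intro f
    have h1 : translateL2 v (f.toLp 2) = (SchwartzMap.compSubConstCLM ℂ v f).toLp 2 := by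
      refine Lp.ext ?_
      have h2 := ae_sub_right (f.coeFn_toLp 2 (volume : Measure (RSpace d))) v
      filter_upwards [translateL2_ae v (f.toLp 2), h2,
        (SchwartzMap.compSubConstCLM ℂ v f).coeFn_toLp 2 volume] with x hx hx2 hx3
      rw [hx, hx2, hx3, SchwartzMap.compSubConstCLM_apply]
    change (𝓕 (translateL2 v (f.toLp 2)) : L2 d) = phaseL2 v (𝓕 (f.toLp 2))
    rw [h1, SchwartzMap.toLp_fourier_eq, SchwartzMap.toLp_fourier_eq]
    refine Lp.ext ?_
    filter_upwards [(𝓕 (SchwartzMap.compSubConstCLM ℂ v f)).coeFn_toLp 2 volume,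
      (𝓕 f).coeFn_toLp 2 volume, phaseL2_ae v ((𝓕 f).toLp 2)] with ξ h3 h4 h5
    rw [h3, h5, h4, SchwartzMap.fourier_coe, SchwartzMap.fourier_coe]
    have h6 := congrFun (VectorFourier.fourierIntegral_comp_add_right Real.fourierChar volume
      (innerₗ (RSpace d)) (f : RSpace d → ℂ) (-v)) ξ
    have h7 : ⇑(SchwartzMap.compSubConstCLM ℂ v f) = (f : RSpace d → ℂ) ∘ fun x => x + -v := by
      ext x; simp [sub_eq_add_neg]
    rw [h7]
    refine h6.trans ?_
    rw [Circle.smul_def, Real.fourierChar_apply, smul_eq_mul]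
    congr 1
    rw [phase]
    congr 1
    simp only [innerₗ_apply_apply, inner_neg_left]
    push_cast
    ring

/-! ### Symbols -/

/-- The symbol `θ ↦ ∑ c_j e^{-2πi jθ}` of the convolution with the sequence `c`. -/
def symbol (c : ℤ → ℂ) (θ : ℝ) : ℂ :=
  ∑' j : ℤ, c j * Complex.exp (-(2 * Real.pi * Complex.I * ((j * θ : ℝ) : ℂ)))

theorem norm_exp_neg_two_pi (r : ℝ) :
    ‖Complex.exp (-(2 * Real.pi * Complex.I * (r : ℂ)))‖ = 1 := by
  rw [Complex.norm_exp]; simp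

theorem continuous_symbol {c : ℤ → ℂ} (hc : Summable fun j => ‖c j‖) : Continuous (symbol c) := by
  refine continuous_tsum (fun j => by fun_prop) hc fun j θ => ?_
  rw [norm_mul, norm_exp_neg_two_pi, mul_one]

theorem tsum_enorm_ne_top {c : ℤ → ℂ} (hc : Summable fun j => ‖c j‖) : ∑' j, ‖c j‖ₑ ≠ ∞ :=
  tsum_enorm_ne_top_iff_summable_norm.2 hc

theorem tsum_translateL2_ae {c : ℤ → ℂ} (hc : Summable fun j => ‖c j‖) (u : L2 d) (v : RSpace d) :
    (∑' j : ℤ, c j • translateL2 ((j : ℝ) • v) u : L2 d) =ᵐ[volume]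
      fun x => ∑' j : ℤ, c j * u (x - (j : ℝ) • v) := by
  have h1 := Lp.coeFn_tsum (f := fun j : ℤ => c j • translateL2 ((j : ℝ) • v) u) (by
    simp_rw [enorm_smul, LinearIsometry.enorm_map]
    rw [ENNReal.tsum_mul_right]
    exact ENNReal.mul_ne_top (tsum_enorm_ne_top hc) enorm_ne_top)
  have h2 : ∀ᵐ x, ∀ j : ℤ, (c j • translateL2 ((j : ℝ) • v) u : L2 d) x
      = c j * u (x - (j : ℝ) • v) := ae_all_iff.2 fun j => by
    filter_upwards [Lp.coeFn_smul (c j) (translateL2 ((j : ℝ) • v) u),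
      translateL2_ae ((j : ℝ) • v) u] with x hx hx2
    rw [hx, Pi.smul_apply, hx2, smul_eq_mul]
  filter_upwards [h1, h2] with x hx hx2
  rw [hx]
  exact tsum_congr hx2

/-- Convolution with a summable sequence of point masses on the line `ℝv`, on the Fourier side. -/
theorem lintegral_tsum_translate {c : ℤ → ℂ} (hc : Summable fun j => ‖c j‖) (u : L2 d)
    (v : RSpace d) :
    ∫⁻ x, ‖∑' j : ℤ, c j * u (x - (j : ℝ) • v)‖ₑ ^ 2
      = ∫⁻ ξ, ‖symbol c (inner ℝ v ξ)‖ₑ ^ 2 * ‖(𝓕 u : L2 d) ξ‖ₑ ^ 2 := by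
  have hs : ∑' j : ℤ, ‖c j • translateL2 ((j : ℝ) • v) u‖ₑ ≠ ∞ := by
    simp_rw [enorm_smul, LinearIsometry.enorm_map]
    rw [ENNReal.tsum_mul_right]
    exact ENNReal.mul_ne_top (tsum_enorm_ne_top hc) enorm_ne_top
  have hsum : Summable fun j : ℤ => c j • translateL2 ((j : ℝ) • v) u :=
    (tsum_enorm_ne_top_iff_summable_norm.1 hs).of_norm
  set w : L2 d := ∑' j : ℤ, c j • translateL2 ((j : ℝ) • v) u with hw
  have e1 : ∫⁻ x, ‖∑' j : ℤ, c j * u (x - (j : ℝ) • v)‖ₑ ^ 2 = ‖w‖ₑ ^ 2 := by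
    rw [Lp_enorm_sq]
    refine lintegral_congr_ae ?_
    filter_upwards [tsum_translateL2_ae hc u v] with x hx
    rw [hw, hx]
  have e2 : ‖w‖ₑ = ‖(𝓕 w : L2 d)‖ₑ := by
    rw [← ofReal_norm, ← ofReal_norm, Lp.norm_fourier_eq]
  have e3 : (𝓕 w : L2 d) = ∑' j : ℤ, c j • phaseL2 ((j : ℝ) • v) (𝓕 u) := by
    have := (Lp.fourierTransformₗᵢ (RSpace d) ℂ).toContinuousLinearEquiv.map_tsum
      (L := SummationFilter.unconditional ℤ) (f := fun j : ℤ => c j • translateL2 ((j : ℝ) • v) u)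
    refine this.trans (tsum_congr fun j => ?_)
    rw [map_smul, ← fourier_translateL2]
    rfl
  have hn : ∀ (v : RSpace d) (u : L2 d), ‖phaseL2 v u‖ₑ = ‖u‖ₑ := fun v u => by
    rw [Lp.enorm_def, Lp.enorm_def]
    refine eLpNorm_congr_norm_ae ?_
    filter_upwards [phaseL2_ae v u] with ξ h1
    rw [h1, norm_mul, norm_phase, one_mul]
  have h1 := Lp.coeFn_tsum (f := fun j : ℤ => c j • phaseL2 ((j : ℝ) • v) (𝓕 u)) (by
    simp_rw [enorm_smul, hn]
    rw [ENNReal.tsum_mul_right]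
    exact ENNReal.mul_ne_top (tsum_enorm_ne_top hc) enorm_ne_top)
  have h2 : ∀ᵐ ξ, ∀ j : ℤ, (c j • phaseL2 ((j : ℝ) • v) (𝓕 u) : L2 d) ξ
      = c j * (phase ((j : ℝ) • v) ξ * (𝓕 u : L2 d) ξ) := ae_all_iff.2 fun j => by
    filter_upwards [Lp.coeFn_smul (c j) (phaseL2 ((j : ℝ) • v) (𝓕 u)),
      phaseL2_ae ((j : ℝ) • v) (𝓕 u)] with x hx hx2
    rw [hx, Pi.smul_apply, hx2, smul_eq_mul]
  rw [e1, e2, e3, Lp_enorm_sq]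
  refine lintegral_congr_ae ?_
  filter_upwards [h1, h2] with ξ hx hx2
  rw [hx, ← mul_pow, ← enorm_mul, symbol, ← tsum_mul_right]
  simp_rw [hx2]
  congr 3
  ext j
  rw [phase, real_inner_smul_left]
  ring

/-! ### Quasi-periodic extension -/

/-- The quasi-periodic extension of a function on `(0,1]^d × 𝕋^d` to `ℝ^d × 𝕋^d`, with
`F(x + m, y) = e^{2πi m·y} F(x, y)`. -/
def qpExt (F : RSpace d × UnitAddTorus (Fin d) → ℂ) (p : RSpace d × UnitAddTorus (Fin d)) : ℂ :=
  mFourier (cellIndex p.1) p.2 * F (p.1 - latticePoint (cellIndex p.1), p.2)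

theorem qpExt_add_latticePoint (F : RSpace d × UnitAddTorus (Fin d) → ℂ) (x : RSpace d)
    (y : UnitAddTorus (Fin d)) (m : Fin d → ℤ) :
    qpExt F (x + latticePoint m, y) = mFourier m y * qpExt F (x, y) := by
  simp only [qpExt, cellIndex_add, latticePoint_add, mFourier_add]
  rw [show x + latticePoint m - (latticePoint (cellIndex x) + latticePoint m)
    = x - latticePoint (cellIndex x) by abel]
  ring

theorem qpExt_of_mem (F : RSpace d × UnitAddTorus (Fin d) → ℂ) {x : RSpace d}
    (hx : x ∈ unitCube d) (y : UnitAddTorus (Fin d)) : qpExt F (x, y) = F (x, y) := by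
  simp [qpExt, cellIndex_eq_zero_iff.2 hx, latticePoint_zero, mFourier_zero]

theorem norm_qpExt (F : RSpace d × UnitAddTorus (Fin d) → ℂ)
    (p : RSpace d × UnitAddTorus (Fin d)) :
    ‖qpExt F p‖ = ‖F (p.1 - latticePoint (cellIndex p.1), p.2)‖ := by
  rw [qpExt, norm_mul, norm_mFourier_apply, one_mul]

theorem stronglyMeasurable_qpExt {F : RSpace d × UnitAddTorus (Fin d) → ℂ}
    (hF : StronglyMeasurable F) : StronglyMeasurable (qpExt F) := by
  have h1 : Measurable fun p : RSpace d × UnitAddTorus (Fin d) => mFourier (cellIndex p.1) p.2 := by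
    have h2 : ∀ j : Fin d, Measurable fun q : ℤ × UnitAddTorus (Fin d) => fourier q.1 (q.2 j) :=
      fun j => measurable_from_prod_countable_right fun n =>
        ((fourier (T := 1) n).continuous.comp (continuous_apply j)).measurable
    simp only [mFourier, ContinuousMap.coe_mk]
    refine Finset.measurable_fun_prod _ fun j _ => ?_
    have h3 : Measurable fun p : RSpace d × UnitAddTorus (Fin d) => (cellIndex p.1 j, p.2) :=
      ((measurable_pi_apply j).comp (measurable_cellIndex.comp measurable_fst)).prodMk
        measurable_snd
    exact (h2 j).comp h3
  refine h1.stronglyMeasurable.mul (hF.comp_measurable ?_)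
  exact (measurable_fst.sub (measurable_latticePoint.comp
    (measurable_cellIndex.comp measurable_fst))).prodMk measurable_snd

theorem torusCoeff_mFourier_mul (f : UnitAddTorus (Fin d) → ℂ) (n k : Fin d → ℤ) :
    torusCoeff (fun y => mFourier n y * f y) k = torusCoeff f (k - n) := by
  simp only [torusCoeff]
  congr 1
  ext y
  rw [← mul_assoc, ← mFourier_add]
  congr 2
  abel_nf

/-- The Fourier coefficients of the quasi-periodic extension are `g(x - k)` for almost every
`x ∈ ℝ^d`. -/
theorem IsZak.ae_qpExt {g : RSpace d → ℂ} {F : RSpace d × UnitAddTorus (Fin d) → ℂ}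
    (h : IsZak g F) :
    ∀ᵐ x, ∀ k, torusCoeff (fun y => qpExt F (x, y)) k = g (x - latticePoint k) := by
  filter_upwards [ae_sub_cellIndex h.slice] with x hx k
  simp only [qpExt]
  rw [torusCoeff_mFourier_mul, hx.2, latticePoint_sub]
  congr 1
  abel

theorem torusCoeff_tsum {f : ℤ → UnitAddTorus (Fin d) → ℂ} {K : ℝ}
    (hf : ∀ j, AEStronglyMeasurable (f j) (torusMeasure (Fin d))) (hK : ∀ j y, ‖f j y‖ ≤ K)
    {c : ℤ → ℂ} (hc : Summable fun j => ‖c j‖) (k : Fin d → ℤ) :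
    torusCoeff (fun y => ∑' j, c j * f j y) k = ∑' j, c j * torusCoeff (f j) k := by
  have hint : ∀ j, Integrable (fun y => c j * (mFourier (-k) y * f j y)) (torusMeasure (Fin d)) :=
    fun j => (integrable_mFourier_mul
      ((integrable_const K).mono' (hf j) (ae_of_all _ (hK j))) _).const_mul _
  have hb : ∀ j y, ‖c j * (mFourier (-k) y * f j y)‖ ≤ K * ‖c j‖ := fun j y => by
    rw [norm_mul, norm_mul, norm_mFourier_apply, one_mul, mul_comm]
    exact mul_le_mul_of_nonneg_right (hK j y) (norm_nonneg _)
  have h1 := hasSum_integral_of_summable_integral_norm hint (by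
    refine Summable.of_nonneg_of_le (fun j => integral_nonneg fun _ => norm_nonneg _)
      (fun j => ?_) (hc.mul_left K)
    calc ∫ y, ‖c j * (mFourier (-k) y * f j y)‖ ∂torusMeasure (Fin d)
        ≤ ∫ _, K * ‖c j‖ ∂torusMeasure (Fin d) :=
          integral_mono (hint j).norm (integrable_const _) (hb j)
      _ = K * ‖c j‖ := by simp)
  simp_rw [integral_const_mul] at h1
  rw [torusCoeff]
  simp_rw [← tsum_mul_left, mul_left_comm _ (c _)]
  exact h1.tsum_eq.symm

theorem stronglyMeasurable_tsum {α : Type*} [MeasurableSpace α] {f : ℤ → α → ℂ} {K : ℝ}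
    (hf : ∀ j, StronglyMeasurable (f j)) (hK : ∀ j y, ‖f j y‖ ≤ K) {c : ℤ → ℂ}
    (hc : Summable fun j => ‖c j‖) : StronglyMeasurable fun y => ∑' j, c j * f j y := by
  refine stronglyMeasurable_of_tendsto (f := fun (s : Finset ℤ) y => ∑ j ∈ s, c j * f j y)
    atTop (fun s => ?_) ?_
  · exact Finset.stronglyMeasurable_fun_sum _ fun j _ => (hf j).const_mul _
  · refine tendsto_pi_nhds.2 fun y => ?_
    refine (Summable.of_norm_bounded (hc.mul_left K) fun j => ?_).hasSum
    rw [norm_mul, mul_comm]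
    exact mul_le_mul_of_nonneg_right (hK j y) (norm_nonneg _)

theorem norm_tsum_le_of_bound {f : ℤ → ℂ} {K : ℝ} (hK : ∀ j, ‖f j‖ ≤ K) {c : ℤ → ℂ}
    (hc : Summable fun j => ‖c j‖) : ‖∑' j, c j * f j‖ ≤ K * ∑' j, ‖c j‖ := by
  rw [← tsum_mul_left]
  refine tsum_of_norm_bounded (hc.mul_left K).hasSum fun j => ?_
  rw [norm_mul, mul_comm]
  exact mul_le_mul_of_nonneg_right (hK j) (norm_nonneg _)

/-- Weighted sums of translates of a Zak transform in the space variable, in terms of the Fourier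
transform of the window. -/
theorem IsZak.lintegral_tsum_space {u : L2 d} {F : RSpace d × UnitAddTorus (Fin d) → ℂ}
    (h : IsZak u F) (hFm : StronglyMeasurable F) {K : ℝ} (hK : ∀ p, ‖F p‖ ≤ K) {c : ℤ → ℂ}
    (hc : Summable fun j => ‖c j‖) (v : RSpace d) :
    ∫⁻ p, ‖∑' j : ℤ, c j * qpExt F (p.1 - (j : ℝ) • v, p.2)‖ₑ ^ 2 ∂zakMeasure d
      = ∫⁻ ξ, ‖symbol c (inner ℝ v ξ)‖ₑ ^ 2 * ‖(𝓕 u : L2 d) ξ‖ₑ ^ 2 := by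
  have hKq : ∀ p, ‖qpExt F p‖ ≤ K := fun p => by rw [norm_qpExt]; exact hK _
  have hm := stronglyMeasurable_qpExt hFm
  have hmj : ∀ j : ℤ, StronglyMeasurable fun p : RSpace d × UnitAddTorus (Fin d) =>
      qpExt F (p.1 - (j : ℝ) • v, p.2) := fun j => hm.comp_measurable (by fun_prop)
  have hZ : IsZak (fun x => ∑' j : ℤ, c j * u (x - (j : ℝ) • v))
      (fun p => ∑' j : ℤ, c j * qpExt F (p.1 - (j : ℝ) • v, p.2)) := by
    have hG := stronglyMeasurable_tsum hmj (fun j p => hKq _) hc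
    refine ⟨hG.aestronglyMeasurable, ?_⟩
    have h1 : ∀ᵐ x ∂cubeMeasure d, ∀ j : ℤ, ∀ k,
        torusCoeff (fun y => qpExt F (x - (j : ℝ) • v, y)) k
          = u (x - (j : ℝ) • v - latticePoint k) :=
      ae_cube_of_ae (ae_all_iff.2 fun j => ae_sub_right h.ae_qpExt _)
    filter_upwards [h1] with x hx
    refine ⟨?_, fun k => ?_⟩
    · refine MemLp.of_bound ?_ (K * ∑' j, ‖c j‖)
        (ae_of_all _ fun y => norm_tsum_le_of_bound (fun j => hKq _) hc)
      exact (hG.comp_measurable measurable_prodMk_left).aestronglyMeasurable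
    · rw [torusCoeff_tsum (f := fun j y => qpExt F (x - (j : ℝ) • v, y))
        (fun j => ((hmj j).comp_measurable measurable_prodMk_left).aestronglyMeasurable)
        (fun j y => hKq _) hc]
      refine tsum_congr fun j => ?_
      rw [hx, sub_right_comm]
  rw [hZ.lintegral_eq ((Lp.aestronglyMeasurable _).congr (tsum_translateL2_ae hc u v)),
    lintegral_tsum_translate hc u v]

theorem mFourier_apply_add (k : Fin d → ℤ) (s t : UnitAddTorus (Fin d)) :
    mFourier k (s + t) = mFourier k s * mFourier k t := by
  simp only [mFourier, ContinuousMap.coe_mk, ← Finset.prod_mul_distrib]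
  refine Finset.prod_congr rfl fun j _ => ?_
  rw [fourier_apply, fourier_apply, fourier_apply, ← Circle.coe_mul, ← AddCircle.toCircle_add,
    ← smul_add, Pi.add_apply]

theorem torusCoeff_comp_sub (f : UnitAddTorus (Fin d) → ℂ) (s : UnitAddTorus (Fin d))
    (k : Fin d → ℤ) :
    torusCoeff (fun y => f (y - s)) k = mFourier (-k) s * torusCoeff f k := by
  simp only [torusCoeff]
  rw [← integral_const_mul, ← integral_sub_right_eq_self
    (fun y => mFourier (-k) s * (mFourier (-k) y * f y)) s]
  congr 1
  ext y
  rw [← mul_assoc, ← mFourier_apply_add, add_sub_cancel]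

/-- Weighted sums of translates of a Zak transform in the frequency variable, in terms of the
window. -/
theorem IsZak.lintegral_tsum_freq {u : L2 d} {F : RSpace d × UnitAddTorus (Fin d) → ℂ}
    (h : IsZak u F) (hFm : StronglyMeasurable F) {K : ℝ} (hK : ∀ p, ‖F p‖ ≤ K) {c : ℤ → ℂ}
    (hc : Summable fun j => ‖c j‖) (v : RSpace d) :
    ∫⁻ p, ‖∑' j : ℤ, c j * F (p.1, p.2 - toTorus ((j : ℝ) • v))‖ₑ ^ 2 ∂zakMeasure d
      = ∫⁻ x, ‖symbol c (-inner ℝ v (latticePoint (cellIndex x)))‖ₑ ^ 2 * ‖u x‖ₑ ^ 2 := by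
  have hmj : ∀ j : ℤ, StronglyMeasurable fun p : RSpace d × UnitAddTorus (Fin d) =>
      F (p.1, p.2 - toTorus ((j : ℝ) • v)) := fun j => hFm.comp_measurable (by fun_prop)
  have hsm : Measurable fun x : RSpace d => symbol c (-inner ℝ v (latticePoint (cellIndex x))) :=
    (continuous_symbol hc).measurable.comp (Measurable.neg
      ((measurable_latticePoint.comp measurable_cellIndex).const_inner))
  have hZ : IsZak (fun x => symbol c (-inner ℝ v (latticePoint (cellIndex x))) * u x)
      (fun p => ∑' j : ℤ, c j * F (p.1, p.2 - toTorus ((j : ℝ) • v))) := by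
    have hG := stronglyMeasurable_tsum hmj (fun j p => hK _) hc
    refine ⟨hG.aestronglyMeasurable, ?_⟩
    filter_upwards [h.slice, ae_restrict_mem measurableSet_unitCube] with x hx hxQ
    refine ⟨?_, fun k => ?_⟩
    · refine MemLp.of_bound ?_ (K * ∑' j, ‖c j‖)
        (ae_of_all _ fun y => norm_tsum_le_of_bound (fun j => hK _) hc)
      exact (hG.comp_measurable measurable_prodMk_left).aestronglyMeasurable
    · rw [torusCoeff_tsum (f := fun j y => F (x, y - toTorus ((j : ℝ) • v)))
        (fun j => ((hmj j).comp_measurable measurable_prodMk_left).aestronglyMeasurable)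
        (fun j y => hK _) hc]
      rw [symbol, ← tsum_mul_right]
      refine tsum_congr fun j => ?_
      rw [torusCoeff_comp_sub (fun y => F (x, y)), hx.2, mul_assoc, mFourier_toTorus,
        cellIndex_sub, cellIndex_eq_zero_iff.2 hxQ, zero_sub]
      congr 3
      rw [← mul_neg]
      congr 1
      rw [← Complex.ofReal_neg]
      congr 1
      simp only [PiLp.inner_apply, latticePoint_apply, RCLike.inner_apply, conj_trivial,
        Pi.neg_apply, PiLp.smul_apply, smul_eq_mul]
      rw [← Finset.sum_neg_distrib, Finset.mul_sum, ← Finset.sum_neg_distrib]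
      refine Finset.sum_congr rfl fun l _ => ?_
      push_cast
      ring
  rw [hZ.lintegral_eq (hsm.aestronglyMeasurable.mul (Lp.aestronglyMeasurable u))]
  simp_rw [enorm_mul, mul_pow]

end

/-! ### A multiplier with slowly varying coefficients -/

noncomputable section

open AddCircle

theorem hasSum_conj_mul_fourierCoeff {f g : UnitAddCircle → ℂ} (hf : MemLp f 2 haarAddCircle)
    (hg : MemLp g 2 haarAddCircle) :
    HasSum (fun j => (starRingEnd ℂ) (fourierCoeff f j) * fourierCoeff g j)
      (∫ u, (starRingEnd ℂ) (f u) * g u ∂haarAddCircle) := by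
  have h := (fourierBasis (T := 1)).hasSum_inner_mul_inner (hf.toLp f) (hg.toLp g)
  rw [L2.inner_def] at h
  have e1 : ∫ u, inner ℂ (hf.toLp f u) (hg.toLp g u) ∂haarAddCircle
      = ∫ u, (starRingEnd ℂ) (f u) * g u ∂haarAddCircle := by
    refine integral_congr_ae ?_
    filter_upwards [hf.coeFn_toLp, hg.coeFn_toLp] with u h1 h2
    rw [h1, h2, RCLike.inner_apply']
  rw [e1] at h
  refine h.congr_fun fun j => ?_
  rw [← inner_conj_symm (hf.toLp f), ← HilbertBasis.repr_apply_apply,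
    ← HilbertBasis.repr_apply_apply, fourierBasis_repr, fourierBasis_repr,
    fourierCoeff_congr_ae hf.coeFn_toLp, fourierCoeff_congr_ae hg.coeFn_toLp]

theorem hasSum_sq_fourierCoeff_of_memLp {f : UnitAddCircle → ℂ} (hf : MemLp f 2 haarAddCircle) :
    HasSum (fun j => ‖fourierCoeff f j‖ ^ 2) (∫ u, ‖f u‖ ^ 2 ∂haarAddCircle) := by
  have h := hasSum_sq_fourierCoeff (hf.toLp f)
  simp_rw [fourierCoeff_congr_ae hf.coeFn_toLp] at h
  convert h using 1
  refine integral_congr_ae ?_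
  filter_upwards [hf.coeFn_toLp] with u hu
  rw [hu]

theorem fourier_add_apply (j : ℤ) (u w : UnitAddCircle) :
    fourier j (u + w) = fourier j u * fourier j w := by
  rw [fourier_apply, fourier_apply, fourier_apply, smul_add, AddCircle.toCircle_add,
    Circle.coe_mul]

theorem fourierCoeff_comp_sub (f : UnitAddCircle → ℂ) (a : UnitAddCircle) (j : ℤ) :
    fourierCoeff (fun u => f (u - a)) j = fourier (-j) a * fourierCoeff f j := by
  simp only [fourierCoeff, smul_eq_mul]
  rw [← integral_const_mul, ← integral_sub_right_eq_self
    (fun u => fourier (-j) a * (fourier (-j) u * f u)) a]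
  congr 1
  ext u
  rw [← mul_assoc, ← fourier_add_apply, add_sub_cancel]

theorem fourierCoeff_sub_shift {f : UnitAddCircle → ℂ} (hf : Integrable f haarAddCircle) (j : ℤ) :
    fourierCoeff (fun u => f u - fourier 1 u * f u) j
      = fourierCoeff f j - fourierCoeff f (j - 1) := by
  have h1 : Integrable (fun u => fourier (-j) u * f u) haarAddCircle := hf.fourier_smul _
  have h2 : Integrable (fun u => fourier (-(j - 1)) u * f u) haarAddCircle := hf.fourier_smul _
  simp only [fourierCoeff, smul_eq_mul]
  rw [← integral_sub h1 h2]
  congr 1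
  ext u
  rw [mul_sub, ← mul_assoc (fourier (-j) u), ← fourier_add, neg_sub, neg_add_eq_sub]

theorem norm_one_sub_fourier_one_le (u : UnitAddCircle) :
    ‖1 - fourier 1 u‖ ≤ 2 * Real.pi * ‖u‖ := by
  induction u using QuotientAddGroup.induction_on with
  | H x =>
    have h1 : ((x : UnitAddCircle)) = ((x - round x : ℝ) : UnitAddCircle) := by
      rw [AddCircle.coe_sub, eq_comm, sub_eq_self, AddCircle.coe_eq_zero_iff]
      exact ⟨round x, by simp⟩
    have h2 : ‖(x : UnitAddCircle)‖ = |x - round x| := UnitAddCircle.norm_eq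
    change ‖1 - fourier 1 (x : UnitAddCircle)‖ ≤ 2 * Real.pi * ‖(x : UnitAddCircle)‖
    rw [h2, h1, fourier_coe_apply, norm_sub_rev]
    have h3 := Real.norm_exp_I_mul_ofReal_sub_one_le (x := 2 * Real.pi * (x - round x))
    rw [Real.norm_eq_abs, abs_mul, abs_of_pos Real.two_pi_pos] at h3
    convert h3 using 3
    congr 1
    push_cast
    ring_nf

/-- The indicator function of the closed arc of radius `r` about `a`. -/
def arcIndicator (a : UnitAddCircle) (r : ℝ) : UnitAddCircle → ℂ :=
  (Metric.closedBall a r).indicator fun _ => 1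

theorem memLp_arcIndicator (a : UnitAddCircle) (r : ℝ) :
    MemLp (arcIndicator a r) 2 haarAddCircle :=
  memLp_indicator_const 2 measurableSet_closedBall 1 (Or.inr (measure_ne_top _ _))

theorem integral_arcIndicator_real (a : UnitAddCircle) {r : ℝ} (hr : 0 ≤ r) (hr2 : 2 * r ≤ 1) :
    ∫ u, (Metric.closedBall a r).indicator (fun _ => (1 : ℝ)) u ∂haarAddCircle = 2 * r := by
  have hv : (haarAddCircle : Measure UnitAddCircle) = volume := by
    simp [AddCircle.volume_eq_smul_haarAddCircle]
  rw [integral_indicator_const _ measurableSet_closedBall, hv, Measure.real,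
    AddCircle.volume_closedBall, min_eq_right hr2, ENNReal.toReal_ofReal (by linarith)]
  simp

theorem arcIndicator_sq_integral (a : UnitAddCircle) {r : ℝ} (hr : 0 ≤ r) (hr2 : 2 * r ≤ 1) :
    ∫ u, ‖arcIndicator a r u‖ ^ 2 ∂haarAddCircle = 2 * r := by
  rw [← integral_arcIndicator_real a hr hr2]
  congr 1
  ext u
  by_cases hu : u ∈ Metric.closedBall a r
  · rw [arcIndicator, Set.indicator_of_mem hu, Set.indicator_of_mem hu]; simp
  · rw [arcIndicator, Set.indicator_of_notMem hu, Set.indicator_of_notMem hu]; simp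

theorem memLp_sub_fourier_mul_arcIndicator (r : ℝ) :
    MemLp (fun u => arcIndicator 0 r u - fourier 1 u * arcIndicator 0 r u) 2 haarAddCircle := by
  refine (memLp_arcIndicator 0 r).sub ((memLp_arcIndicator 0 r).of_le
    ((fourier 1).continuous.aestronglyMeasurable.mul (memLp_arcIndicator 0 r).1)
    (ae_of_all _ fun u => ?_))
  rw [norm_mul, fourier_apply, Circle.norm_coe, one_mul]

theorem arcIndicator_diff_sq_integral {r : ℝ} (hr : 0 ≤ r) (hr2 : 2 * r ≤ 1) :
    ∫ u, ‖arcIndicator 0 r u - fourier 1 u * arcIndicator 0 r u‖ ^ 2 ∂haarAddCircle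
      ≤ (2 * Real.pi * r) ^ 2 * (2 * r) := by
  rw [← arcIndicator_sq_integral 0 hr hr2, ← integral_const_mul]
  refine integral_mono ?_ ?_ fun u => ?_
  · exact (memLp_two_iff_integrable_sq_norm (memLp_sub_fourier_mul_arcIndicator r).1).1
      (memLp_sub_fourier_mul_arcIndicator r)
  · exact ((memLp_two_iff_integrable_sq_norm (memLp_arcIndicator 0 r).1).1
      (memLp_arcIndicator 0 r)).const_mul _
  · have h1 : arcIndicator 0 r u - fourier 1 u * arcIndicator 0 r u
        = (1 - fourier 1 u) * arcIndicator 0 r u := by ring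
    simp only [h1, norm_mul, mul_pow]
    by_cases hu : u ∈ Metric.closedBall 0 r
    · refine mul_le_mul_of_nonneg_right ?_ (by positivity)
      rw [← mul_pow, ← mul_pow]
      refine pow_le_pow_left₀ (norm_nonneg _) ((norm_one_sub_fourier_one_le u).trans ?_) 2
      have : ‖u‖ ≤ r := by simpa using hu
      gcongr
    · rw [arcIndicator, Set.indicator_of_notMem hu]; simp

/-- A summable sequence `c` whose symbol is a trapezoid: it equals `1` near `0` and is bounded by
`1`, while `∑ |c_j - c_{j-1}|` is as small as desired. The trapezoid is the normalized convolution
of the indicators of two short arcs around `0`, so that `c_j` is a product of Fourier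
coefficients of indicators; differencing in `j` is multiplication of an indicator by `1 - e^{2πi u}`, which is small
on a short arc. -/
theorem exists_trapezoid_multiplier {η : ℝ} (hη : 0 < η) :
    ∃ κ : ℝ, 0 < κ ∧ ∃ c : ℤ → ℂ, Summable (fun j => ‖c j‖) ∧
      (∀ θ : ℝ, |θ| ≤ κ → symbol c θ = 1) ∧ (∀ θ, ‖symbol c θ‖ ≤ 1) ∧
      ∑' j, ‖c j - c (j - 1)‖ ≤ η := by
  -- `1 / 4` keeps the wider arc, of length `3κ`, embedded in the circle
  set κ := min (1 / 4) (η / 150) with hκdef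
  have hκ : 0 < κ := lt_min (by norm_num) (by positivity)
  have hκ1 : κ ≤ 1 / 4 := min_le_left _ _
  have hκ2 : 150 * κ ≤ η := by
    have : κ ≤ η / 150 := min_le_right _ _
    linarith
  refine ⟨κ, hκ, ?_⟩
  set s := arcIndicator 0 (3 * κ / 2) with hs
  set t := arcIndicator 0 (κ / 2) with ht
  have hsm : MemLp s 2 haarAddCircle := memLp_arcIndicator _ _
  have htm : MemLp t 2 haarAddCircle := memLp_arcIndicator _ _
  have hss := hasSum_sq_fourierCoeff_of_memLp hsm
  have hts := hasSum_sq_fourierCoeff_of_memLp htm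
  rw [hs, arcIndicator_sq_integral _ (by positivity) (by linarith), ← hs] at hss
  rw [ht, arcIndicator_sq_integral _ (by positivity) (by linarith), ← ht] at hts
  set c : ℤ → ℂ := fun j => (κ : ℂ)⁻¹ * ((starRingEnd ℂ) (fourierCoeff s j) * fourierCoeff t j)
    with hc
  have hcsum : Summable fun j => ‖c j‖ := by
    refine Summable.of_nonneg_of_le (fun _ => norm_nonneg _) (fun j => ?_)
      ((hss.summable.add hts.summable).mul_left κ⁻¹)
    simp only [hc, norm_mul, norm_inv, Complex.norm_real, Real.norm_eq_abs, abs_of_pos hκ,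
      RCLike.norm_conj]
    refine mul_le_mul_of_nonneg_left ?_ (by positivity)
    nlinarith [sq_nonneg (‖fourierCoeff s j‖ - ‖fourierCoeff t j‖),
      sq_nonneg ‖fourierCoeff s j‖, sq_nonneg ‖fourierCoeff t j‖]
  -- the symbol is the normalized convolution of the two indicator functions
  have hsymb : ∀ θ : ℝ, symbol c θ
      = (κ : ℂ)⁻¹ * ∫ u, (starRingEnd ℂ) (s u) * arcIndicator θ (κ / 2) u ∂haarAddCircle := by
    intro θ
    have h1 : arcIndicator (θ : UnitAddCircle) (κ / 2) = fun u => t (u - θ) := by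
      ext u
      have h0 : u ∈ Metric.closedBall (θ : UnitAddCircle) (κ / 2)
          ↔ u - θ ∈ Metric.closedBall (0 : UnitAddCircle) (κ / 2) := by
        rw [mem_closedBall_iff_norm, mem_closedBall_iff_norm, sub_zero]
      by_cases hu : u ∈ Metric.closedBall (θ : UnitAddCircle) (κ / 2)
      · rw [ht, arcIndicator, arcIndicator, Set.indicator_of_mem hu,
          Set.indicator_of_mem (h0.1 hu)]
      · rw [ht, arcIndicator, arcIndicator, Set.indicator_of_notMem hu,
          Set.indicator_of_notMem (mt h0.2 hu)]
    have h2 := hasSum_conj_mul_fourierCoeff hsm (memLp_arcIndicator (θ : UnitAddCircle) (κ / 2))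
    rw [← h2.tsum_eq, symbol, ← tsum_mul_left]
    refine tsum_congr fun j => ?_
    rw [h1, fourierCoeff_comp_sub, fourier_coe_apply]
    have : (2 * Real.pi * Complex.I * ((-j : ℤ) : ℂ) * (θ : ℂ) / ((1 : ℝ) : ℂ))
        = -(2 * Real.pi * Complex.I * ((j * θ : ℝ) : ℂ)) := by push_cast; ring
    rw [this]
    simp only [hc]
    ring
  have hint : ∀ θ : UnitAddCircle, ∫ u, arcIndicator θ (κ / 2) u ∂haarAddCircle = κ := by
    intro θ
    have h1 : ∀ u, arcIndicator θ (κ / 2) u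
        = (((Metric.closedBall θ (κ / 2)).indicator (fun _ => (1 : ℝ)) u : ℝ) : ℂ) := fun u => by
      rw [arcIndicator]
      by_cases hu : u ∈ Metric.closedBall θ (κ / 2) <;> simp [hu]
    simp_rw [h1]
    rw [integral_complex_ofReal, integral_arcIndicator_real _ (by positivity) (by linarith)]
    congr 1
    ring
  refine ⟨c, hcsum, fun θ hθ => ?_, fun θ => ?_, ?_⟩
  · rw [hsymb]
    have h1 : ∀ u, (starRingEnd ℂ) (s u) * arcIndicator θ (κ / 2) u
        = arcIndicator (θ : UnitAddCircle) (κ / 2) u := fun u => by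
      by_cases hu : u ∈ Metric.closedBall (θ : UnitAddCircle) (κ / 2)
      · have h2 : u ∈ Metric.closedBall (0 : UnitAddCircle) (3 * κ / 2) := by
          rw [mem_closedBall_iff_norm] at hu
          rw [mem_closedBall_iff_norm, sub_zero]
          have h3 : ‖(θ : UnitAddCircle)‖ ≤ κ := by
            rw [UnitAddCircle.norm_eq]
            exact (round_le θ 0).trans (by simpa using hθ)
          calc ‖u‖ = ‖(u - θ) + θ‖ := by rw [sub_add_cancel]
            _ ≤ ‖u - θ‖ + ‖(θ : UnitAddCircle)‖ := norm_add_le _ _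
            _ ≤ 3 * κ / 2 := by linarith
        rw [hs, arcIndicator, Set.indicator_of_mem h2]
        simp
      · rw [arcIndicator, Set.indicator_of_notMem hu, mul_zero]
    simp_rw [h1]
    rw [hint, inv_mul_cancel₀ (by exact_mod_cast hκ.ne')]
  · rw [hsymb, norm_mul, norm_inv, Complex.norm_real, Real.norm_eq_abs, abs_of_pos hκ,
      inv_mul_le_iff₀ hκ, mul_one]
    have h2 : ∫ u, (Metric.closedBall (θ : UnitAddCircle) (κ / 2)).indicator
        (fun _ => (1 : ℝ)) u ∂haarAddCircle = κ := by
      rw [integral_arcIndicator_real _ (by positivity) (by linarith)]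
      ring
    conv_rhs => rw [← h2]
    refine norm_integral_le_of_norm_le ?_ (ae_of_all _ fun u => ?_)
    · exact (integrable_const _).indicator measurableSet_closedBall
    · rw [norm_mul, RCLike.norm_conj]
      have h3 : ‖s u‖ ≤ 1 := by
        rw [hs, arcIndicator]
        refine (norm_indicator_le_norm_self _ _).trans (by simp)
      by_cases hu : u ∈ Metric.closedBall (θ : UnitAddCircle) (κ / 2)
      · rw [arcIndicator, Set.indicator_of_mem hu, Set.indicator_of_mem hu]
        simpa using h3
      · rw [arcIndicator, Set.indicator_of_notMem hu, Set.indicator_of_notMem hu]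
        simp
  · have hds := hasSum_sq_fourierCoeff_of_memLp (memLp_sub_fourier_mul_arcIndicator (3 * κ / 2))
    have hdt := hasSum_sq_fourierCoeff_of_memLp (memLp_sub_fourier_mul_arcIndicator (κ / 2))
    rw [← hs] at hds
    rw [← ht] at hdt
    simp_rw [fourierCoeff_sub_shift (hsm.integrable one_le_two)] at hds
    simp_rw [fourierCoeff_sub_shift (htm.integrable one_le_two)] at hdt
    have hds_le := arcIndicator_diff_sq_integral (r := 3 * κ / 2) (by positivity) (by linarith)
    have hdt_le := arcIndicator_diff_sq_integral (r := κ / 2) (by positivity) (by linarith)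
    have hss' := (Equiv.subRight (1 : ℤ)).hasSum_iff.2 hss
    simp only [Function.comp_def, Equiv.subRight_apply] at hss'
    -- weighted arithmetic-geometric mean, balancing the sizes `κ³` and `κ` of the two sums
    have hle : ∀ j, ‖c j - c (j - 1)‖ ≤ (2 * κ)⁻¹ *
        (κ⁻¹ * ‖fourierCoeff s j - fourierCoeff s (j - 1)‖ ^ 2 + κ * ‖fourierCoeff t j‖ ^ 2
        + (κ * ‖fourierCoeff s (j - 1)‖ ^ 2
          + κ⁻¹ * ‖fourierCoeff t j - fourierCoeff t (j - 1)‖ ^ 2)) := by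
      intro j
      have h1 : c j - c (j - 1) = (κ : ℂ)⁻¹ *
          ((starRingEnd ℂ) (fourierCoeff s j - fourierCoeff s (j - 1)) * fourierCoeff t j
          + (starRingEnd ℂ) (fourierCoeff s (j - 1))
            * (fourierCoeff t j - fourierCoeff t (j - 1))) := by
        simp only [hc, map_sub]; ring
      have amgm : ∀ x y : ℝ, 2 * (x * y) ≤ κ⁻¹ * x ^ 2 + κ * y ^ 2 := fun x y => by
        have : κ⁻¹ * x ^ 2 + κ * y ^ 2 - 2 * (x * y) = κ⁻¹ * (x - κ * y) ^ 2 := by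
          field_simp; ring
        have h2 : 0 ≤ κ⁻¹ * (x - κ * y) ^ 2 := by positivity
        linarith
      rw [h1, norm_mul, norm_inv, Complex.norm_real, Real.norm_eq_abs, abs_of_pos hκ, mul_inv,
        mul_comm (2⁻¹ : ℝ), mul_assoc]
      refine mul_le_mul_of_nonneg_left ((norm_add_le _ _).trans ?_) (by positivity)
      rw [norm_mul, norm_mul, RCLike.norm_conj, RCLike.norm_conj]
      have a1 := amgm ‖fourierCoeff s j - fourierCoeff s (j - 1)‖ ‖fourierCoeff t j‖
      have a2 := amgm ‖fourierCoeff t j - fourierCoeff t (j - 1)‖ ‖fourierCoeff s (j - 1)‖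
      linarith
    have htot := (((hds.mul_left κ⁻¹).add (hts.mul_left κ)).add
      ((hss'.mul_left κ).add (hdt.mul_left κ⁻¹))).mul_left (2 * κ)⁻¹
    have hsum : Summable fun j => ‖c j - c (j - 1)‖ :=
      Summable.of_nonneg_of_le (fun _ => norm_nonneg _) hle htot.summable
    refine (hsum.tsum_le_tsum hle htot.summable).trans ?_
    rw [htot.tsum_eq]
    refine le_trans ?_ hκ2
    have hpi : Real.pi ^ 2 ≤ 10 := by nlinarith [Real.pi_lt_d2, Real.pi_pos]
    have e1 : κ⁻¹ * ∫ u, ‖s u - fourier 1 u * s u‖ ^ 2 ∂haarAddCircle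
        ≤ 27 * Real.pi ^ 2 * κ ^ 2 := by
      rw [inv_mul_le_iff₀ hκ]
      refine hds_le.trans (le_of_eq ?_)
      ring
    have e2 : κ⁻¹ * ∫ u, ‖t u - fourier 1 u * t u‖ ^ 2 ∂haarAddCircle
        ≤ Real.pi ^ 2 * κ ^ 2 := by
      rw [inv_mul_le_iff₀ hκ]
      refine hdt_le.trans (le_of_eq ?_)
      ring
    rw [inv_mul_le_iff₀ (by positivity)]
    nlinarith [sq_nonneg κ, mul_le_mul_of_nonneg_right hpi (sq_nonneg κ)]

end

/-! ### Winding numbers on a grid -/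

noncomputable section

theorem Complex.eq_zero_of_exp_eq_one {s : ℂ} (h : Complex.exp s = 1) (hs : ‖s‖ < 2 * Real.pi) :
    s = 0 := by
  obtain ⟨n, hn⟩ := Complex.exp_eq_one_iff.1 h
  rcases eq_or_ne n 0 with rfl | h0
  · simpa using hn
  · have h1 : (1 : ℝ) ≤ |(n : ℝ)| := by exact_mod_cast Int.one_le_abs h0
    rw [hn, norm_mul, norm_mul, norm_mul, Complex.norm_I, Complex.norm_real, Complex.norm_intCast,
      Real.norm_eq_abs, abs_of_pos Real.pi_pos, mul_one] at hs
    norm_num at hs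
    nlinarith [Real.pi_pos]

/-- A relative increment of at most `1/2` has logarithm of modulus at most `3/4`. In a grid cell
four increments of this size, and one turn of at most `π`, add up to less than `2π`. -/
theorem norm_log_div_le {a b : ℂ} (ha : a ≠ 0) (h : ‖b - a‖ ≤ ‖a‖ / 2) :
    ‖Complex.log (b / a)‖ ≤ 3 / 4 := by
  have h0 : 0 < ‖a‖ := norm_pos_iff.2 ha
  have h1 : ‖(b - a) / a‖ ≤ 1 / 2 := by
    rw [norm_div, div_le_iff₀ h0]; linarith
  have h2 := Complex.norm_log_one_add_half_le_self h1
  have h3 : 1 + (b - a) / a = b / a := by field_simp; ring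
  rw [h3] at h2
  linarith

/-- A nowhere vanishing function on a grid cannot at the same time be periodic in the second
variable, be multiplied by a unimodular factor of winding number one in `k` when the first variable
runs through the grid, and vary slowly: the increments of its logarithm add up to zero around each
cell, while their sum around the whole grid is `2πi`. -/
theorem false_of_slowly_varying_quasiperiodic {N M : ℕ} (hM : 2 ≤ M)
    {q : ℕ → ℕ → ℂ} {w : ℂ} (hne : ∀ j ≤ N, ∀ k ≤ M, q j k ≠ 0)
    (hper : ∀ j ≤ N, q j M = q j 0)
    (hqp : ∀ k ≤ M, q N k = w * Complex.exp (2 * Real.pi * Complex.I * (k / M : ℂ)) * q 0 k)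
    (hh : ∀ j < N, ∀ k ≤ M, ‖q (j + 1) k - q j k‖ ≤ ‖q j k‖ / 2)
    (hv : ∀ j < N, ∀ k < M, ‖q j (k + 1) - q j k‖ ≤ ‖q j k‖ / 2) (hN : 0 < N) : False := by
  have hM0 : (M : ℂ) ≠ 0 := by norm_cast; omega
  set τ : ℂ := 2 * Real.pi * Complex.I * (1 / M : ℂ) with hτ
  have hτn : ‖τ‖ ≤ Real.pi := by
    rw [hτ, norm_mul, norm_mul, norm_mul, Complex.norm_I, Complex.norm_real, norm_div,
      Complex.norm_natCast, Real.norm_eq_abs, abs_of_pos Real.pi_pos, mul_one]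
    norm_num
    have h2 : (2 : ℝ) ≤ M := by exact_mod_cast hM
    rw [← div_eq_mul_inv, div_le_iff₀ (by linarith)]
    nlinarith [Real.pi_pos]
  set α : ℕ → ℕ → ℂ := fun j k => Complex.log (q (j + 1) k / q j k) with hα
  -- at the last column the increment is defined by the quasi-periodicity
  set β : ℕ → ℕ → ℂ := fun j k =>
    if j < N then Complex.log (q j (k + 1) / q j k) else Complex.log (q 0 (k + 1) / q 0 k) + τ
    with hβ
  have hαn : ∀ j < N, ∀ k ≤ M, ‖α j k‖ ≤ 3 / 4 := fun j hj k hk =>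
    norm_log_div_le (hne j hj.le k hk) (hh j hj k hk)
  have hβ0 : ∀ j < N, ∀ k < M, ‖β j k‖ ≤ 3 / 4 := fun j hj k hk => by
    simp only [hβ, if_pos hj]
    exact norm_log_div_le (hne j hj.le k hk.le) (hv j hj k hk)
  have hβn : ∀ j ≤ N, ∀ k < M, ‖β j k‖ ≤ 3 / 4 + Real.pi := fun j hj k hk => by
    rcases hj.lt_or_eq with hj | rfl
    · linarith [hβ0 j hj k hk, Real.pi_pos]
    · simp only [hβ, lt_irrefl, if_false]
      exact (norm_add_le _ _).trans
        (add_le_add (norm_log_div_le (hne 0 hN.le k hk.le) (hv 0 hN k hk)) hτn)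
  have hαe : ∀ j < N, ∀ k ≤ M, Complex.exp (α j k) = q (j + 1) k / q j k := fun j hj k hk =>
    Complex.exp_log (div_ne_zero (hne _ hj k hk) (hne j hj.le k hk))
  have hβe : ∀ j ≤ N, ∀ k < M, Complex.exp (β j k) = q j (k + 1) / q j k := fun j hj k hk => by
    rcases hj.lt_or_eq with hj | rfl
    · simp only [hβ, if_pos hj]
      exact Complex.exp_log (div_ne_zero (hne j hj.le _ hk) (hne j hj.le k hk.le))
    · simp only [hβ, lt_irrefl, if_false]
      have h0 := hne 0 hN.le k hk.le
      have h1 := hne j le_rfl k hk.le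
      rw [Complex.exp_add, Complex.exp_log (div_ne_zero (hne 0 hN.le _ hk) h0)]
      rw [eq_div_iff h1, hqp k hk.le, hqp (k + 1) hk, hτ]
      have h2 : (2 * Real.pi * Complex.I * (((k + 1 : ℕ) : ℂ) / M))
          = 2 * Real.pi * Complex.I * (k / M : ℂ) + 2 * Real.pi * Complex.I * (1 / M : ℂ) := by
        push_cast; ring
      rw [h2, Complex.exp_add]
      field_simp
  have hcell : ∀ j < N, ∀ k < M, α j k + β (j + 1) k - α j (k + 1) - β j k = 0 := by
    intro j hj k hk
    have n1 := hne j hj.le k hk.le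
    have n2 := hne j hj.le (k + 1) hk
    have n3 := hne (j + 1) hj k hk.le
    have n4 := hne (j + 1) hj (k + 1) hk
    refine Complex.eq_zero_of_exp_eq_one ?_ ?_
    · rw [Complex.exp_sub, Complex.exp_sub, Complex.exp_add, hαe j hj k hk.le, hαe j hj _ hk,
        hβe _ hj k hk, hβe j hj.le k hk]
      field_simp
    · have b1 := hαn j hj k hk.le
      have b2 := hαn j hj (k + 1) hk
      have b3 := hβn (j + 1) hj k hk
      have b4 := hβ0 j hj k hk
      have t1 := norm_sub_le (α j k + β (j + 1) k - α j (k + 1)) (β j k)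
      have t2 := norm_sub_le (α j k + β (j + 1) k) (α j (k + 1))
      have t3 := norm_add_le (α j k) (β (j + 1) k)
      linarith [Real.pi_gt_three]
  have htot : ∑ k ∈ Finset.range M, ∑ j ∈ Finset.range N,
      (α j k + β (j + 1) k - α j (k + 1) - β j k) = 0 :=
    Finset.sum_eq_zero fun k hk => Finset.sum_eq_zero fun j hj =>
      hcell j (Finset.mem_range.1 hj) k (Finset.mem_range.1 hk)
  have hsplit : ∀ j k, α j k + β (j + 1) k - α j (k + 1) - β j k
      = (β (j + 1) k - β j k) - (α j (k + 1) - α j k) := fun j k => by ring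
  have hαsum : ∑ k ∈ Finset.range M, ∑ j ∈ Finset.range N, (α j (k + 1) - α j k) = 0 := by
    rw [Finset.sum_comm]
    refine Finset.sum_eq_zero fun j hj => ?_
    have hj' := Finset.mem_range.1 hj
    rw [Finset.sum_range_sub (fun k => α j k)]
    simp only [hα]
    rw [hper j hj'.le, hper (j + 1) hj', sub_self]
  have hβsum : ∀ k, ∑ j ∈ Finset.range N, (β (j + 1) k - β j k) = τ := fun k => by
    rw [Finset.sum_range_sub (fun j => β j k)]
    simp [hβ, hN]
  have htot' : ∑ k ∈ Finset.range M, ∑ j ∈ Finset.range N, (β (j + 1) k - β j k)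
      - ∑ k ∈ Finset.range M, ∑ j ∈ Finset.range N, (α j (k + 1) - α j k) = 0 := by
    rw [← htot, ← Finset.sum_sub_distrib]
    refine Finset.sum_congr rfl fun k _ => ?_
    rw [← Finset.sum_sub_distrib]
    exact Finset.sum_congr rfl fun j _ => (hsplit j k).symm
  rw [hαsum, sub_zero] at htot'
  simp_rw [hβsum] at htot'
  rw [Finset.sum_const, Finset.card_range, nsmul_eq_mul, hτ] at htot'
  have : (2 * Real.pi * Complex.I : ℂ) = 0 := by
    rw [← htot']; field_simp
  exact Complex.two_pi_I_ne_zero this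

end

/-! ### Residuals of a convolution and grids in the cube -/

noncomputable section

open UnitAddTorus

variable {d : ℕ}

/-- The coefficients of `1 - symbol c`. -/
def residualCoeff (c : ℤ → ℂ) (j : ℤ) : ℂ := (if j = 0 then 1 else 0) - c j

theorem summable_norm_residual {c : ℤ → ℂ} (hc : Summable fun j => ‖c j‖) :
    Summable fun j => ‖residualCoeff c j‖ := by
  refine Summable.of_nonneg_of_le (fun _ => norm_nonneg _) (fun j => norm_sub_le _ _)
    (Summable.add ?_ hc)
  exact summable_of_ne_finset_zero (s := {0}) fun j hj => by
    rw [if_neg (by simpa using hj), norm_zero]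

theorem tsum_residual_mul {c : ℤ → ℂ} (hc : Summable fun j => ‖c j‖) {φ : ℤ → ℂ} {K : ℝ}
    (hK : ∀ j, ‖φ j‖ ≤ K) : ∑' j, residualCoeff c j * φ j = φ 0 - ∑' j, c j * φ j := by
  have h1 : Summable fun j => c j * φ j := Summable.of_norm_bounded (hc.mul_left K) fun j => by
    rw [norm_mul, mul_comm]
    exact mul_le_mul_of_nonneg_right (hK j) (norm_nonneg _)
  have h2 : HasSum (fun j : ℤ => (if j = 0 then (1 : ℂ) else 0) * φ j) (φ 0) := by
    convert hasSum_ite_eq (0 : ℤ) (φ 0) using 2 with j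
    split_ifs with h
    · rw [h, one_mul]
    · rw [zero_mul]
  simp_rw [residualCoeff, sub_mul]
  exact (h2.sub h1.hasSum).tsum_eq

theorem symbol_residual {c : ℤ → ℂ} (hc : Summable fun j => ‖c j‖) (θ : ℝ) :
    symbol (residualCoeff c) θ = 1 - symbol c θ := by
  rw [symbol, tsum_residual_mul hc (K := 1) fun j => (norm_exp_neg_two_pi _).le]
  simp [symbol]

/-- If `c` varies slowly, a bounded sequence varies slowly wherever it is close to its convolution
with `c`. -/
theorem norm_sub_le_of_residual {c : ℤ → ℂ} (hc : Summable fun j => ‖c j‖) {η : ℝ}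
    (hη : ∑' j, ‖c j - c (j - 1)‖ ≤ η) {φ : ℤ → ℂ} {b δ : ℝ} (hφ : ∀ j, ‖φ j‖ ≤ b) {n : ℤ}
    (h1 : ‖∑' j, residualCoeff c j * φ (n - j)‖ ≤ δ)
    (h2 : ‖∑' j, residualCoeff c j * φ (n + 1 - j)‖ ≤ δ) :
    ‖φ (n + 1) - φ n‖ ≤ 2 * δ + b * η := by
  have hb : 0 ≤ b := (norm_nonneg _).trans (hφ 0)
  rw [tsum_residual_mul hc fun j => hφ _, sub_zero] at h1 h2
  have hs : ∀ m, Summable fun j => c j * φ (m - j) := fun m =>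
    Summable.of_norm_bounded (hc.mul_left b) fun j => by
      rw [norm_mul, mul_comm]
      exact mul_le_mul_of_nonneg_right (hφ _) (norm_nonneg _)
  have hc1 : Summable fun j => ‖c (j - 1)‖ := (Equiv.subRight (1 : ℤ)).summable_iff.2 hc
  have hd : Summable fun j => ‖c j - c (j - 1)‖ :=
    Summable.of_nonneg_of_le (fun _ => norm_nonneg _) (fun j => norm_sub_le _ _) (hc.add hc1)
  have h3 : ∑' j, c j * φ (n - j) = ∑' j, c (j - 1) * φ (n + 1 - j) := by
    rw [← (Equiv.subRight (1 : ℤ)).tsum_eq]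
    refine tsum_congr fun j => ?_
    rw [Equiv.subRight_apply]
    congr 2
    ring
  have hs1 : Summable fun j => c (j - 1) * φ (n + 1 - j) :=
    Summable.of_norm_bounded (hc1.mul_left b) fun j => by
      rw [norm_mul, mul_comm]
      exact mul_le_mul_of_nonneg_right (hφ _) (norm_nonneg _)
  have h4 : ‖∑' j, c j * φ (n + 1 - j) - ∑' j, c j * φ (n - j)‖ ≤ b * η := by
    rw [h3, ← (hs _).tsum_sub hs1]
    simp_rw [← sub_mul]
    exact (norm_tsum_le_of_bound (fun j => hφ _) hd).trans (mul_le_mul_of_nonneg_left hη hb)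
  calc ‖φ (n + 1) - φ n‖
      = ‖(φ (n + 1) - ∑' j, c j * φ (n + 1 - j)) - (φ n - ∑' j, c j * φ (n - j))
          + (∑' j, c j * φ (n + 1 - j) - ∑' j, c j * φ (n - j))‖ := by congr 1; ring
    _ ≤ δ + δ + b * η := by
        refine (norm_add_le _ _).trans (add_le_add ((norm_sub_le _ _).trans (add_le_add h2 h1)) h4)
    _ = _ := by ring

/-- The vector `e_i / N`. -/
def gridStep (i : Fin d) (N : ℕ) : RSpace d := EuclideanSpace.single i (1 / (N : ℝ))

theorem gridStep_apply (i : Fin d) (N : ℕ) (l : Fin d) :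
    gridStep i N l = if l = i then 1 / (N : ℝ) else 0 := by
  simp [gridStep]

theorem inner_gridStep (i : Fin d) (N : ℕ) (ξ : RSpace d) :
    inner ℝ (gridStep i N) ξ = ξ i / N := by
  rw [gridStep, EuclideanSpace.inner_single_left]
  simp
  ring

theorem natCast_smul_gridStep (i : Fin d) {N : ℕ} (hN : 0 < N) :
    (N : ℝ) • gridStep i N = latticePoint (Pi.single i 1) := by
  ext l
  simp only [PiLp.smul_apply, gridStep_apply, latticePoint_apply, smul_eq_mul, Pi.single_apply]
  split_ifs <;> simp [hN.ne']

theorem mFourier_single_toTorus_gridStep (i : Fin d) (M k : ℕ) :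
    mFourier (Pi.single i 1) (toTorus ((k : ℝ) • gridStep i M))
      = Complex.exp (2 * Real.pi * Complex.I * (k / M : ℂ)) := by
  rw [mFourier_toTorus]
  congr 2
  simp only [PiLp.smul_apply, gridStep_apply, smul_eq_mul, Pi.single_apply]
  rw [Finset.sum_eq_single i (fun l _ hl => by simp [hl]) (by simp)]
  simp
  ring

/-- The part `x_i ≤ 1/N` of the unit cube. -/
def slab (i : Fin d) (N : ℕ) : Set (RSpace d) :=
  {x | ∀ l, x l ∈ Function.update (fun _ => Set.Ioc (0 : ℝ) 1) i (Set.Ioc 0 (1 / (N : ℝ))) l}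

theorem mem_slab_iff {i : Fin d} {N : ℕ} {x : RSpace d} :
    x ∈ slab i N ↔ x i ∈ Set.Ioc 0 (1 / (N : ℝ)) ∧ ∀ l ≠ i, x l ∈ Set.Ioc (0 : ℝ) 1 := by
  constructor
  · intro h
    refine ⟨by simpa using h i, fun l hl => ?_⟩
    have := h l
    rwa [Function.update_of_ne hl] at this
  · rintro ⟨h1, h2⟩ l
    rcases eq_or_ne l i with rfl | hl
    · simpa using h1
    · rw [Function.update_of_ne hl]
      exact h2 l hl

theorem measurableSet_slab (i : Fin d) (N : ℕ) : MeasurableSet (slab i N) := by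
  have : slab i N = ⋂ l, (fun x : RSpace d => x l) ⁻¹'
      (Function.update (fun _ => Set.Ioc (0 : ℝ) 1) i (Set.Ioc 0 (1 / (N : ℝ))) l) := by
    ext x; simp [slab]
  rw [this]
  refine MeasurableSet.iInter fun l => MeasurableSet.preimage ?_ (by fun_prop)
  rcases eq_or_ne l i with rfl | hl
  · simp
  · rw [Function.update_of_ne hl]; exact measurableSet_Ioc

theorem volume_slab (i : Fin d) (N : ℕ) : volume (slab i N) = ENNReal.ofReal (1 / (N : ℝ)) := by
  have h := (measurePreserving_toLp_restrict
    (Function.update (fun _ : Fin d => Set.Ioc (0 : ℝ) 1) i (Set.Ioc 0 (1 / (N : ℝ))))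
    ).measure_preimage (s := Set.univ) MeasurableSet.univ.nullMeasurableSet
  rw [Set.preimage_univ, Measure.pi_univ, Measure.restrict_apply_univ] at h
  rw [slab, ← h, Finset.prod_eq_single i (fun l _ hl => by rw [Function.update_of_ne hl]; simp)
    (by simp)]
  simp

theorem add_gridStep_mem_unitCube {i : Fin d} {N : ℕ} {x : RSpace d} (hx : x ∈ slab i N) {j : ℕ}
    (hj : j < N) : x + (j : ℝ) • gridStep i N ∈ unitCube d := by
  rw [mem_slab_iff] at hx
  intro l
  have hN : (0 : ℝ) < N := by exact_mod_cast (Nat.zero_le j).trans_lt hj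
  simp only [PiLp.add_apply, PiLp.smul_apply, gridStep_apply, smul_eq_mul]
  split_ifs with h
  · subst h
    have h1 : (j : ℝ) + 1 ≤ N := by exact_mod_cast hj
    refine ⟨by have := hx.1.1; positivity, ?_⟩
    calc x l + j * (1 / N) ≤ 1 / N + j * (1 / N) := by linarith [hx.1.2]
      _ = (j + 1) / N := by ring
      _ ≤ 1 := (div_le_one hN).2 h1
  · simpa using hx.2 l h

/-- The translates of the slab by multiples of `e_i / N` are pairwise disjoint. -/
theorem disjoint_slab_translates {i : Fin d} {N : ℕ} {x : RSpace d} {j k : ℕ}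
    (hj : x - (j : ℝ) • gridStep i N ∈ slab i N) (hk : x - (k : ℝ) • gridStep i N ∈ slab i N) :
    j = k := by
  rw [mem_slab_iff] at hj hk
  have hj := hj.1
  have hk := hk.1
  simp only [PiLp.sub_apply, PiLp.smul_apply, gridStep_apply, smul_eq_mul, if_true,
    Set.mem_Ioc] at hj hk
  have hN : 0 < 1 / (N : ℝ) := hj.1.trans_le hj.2
  have key : ∀ a b : ℕ, 0 < x i - a * (1 / (N : ℝ)) → x i - b * (1 / (N : ℝ)) ≤ 1 / N → a ≤ b := by
    intro a b h1 h2
    have h3 : (a : ℝ) * (1 / N) < (b + 1) * (1 / N) := by linarith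
    have h4 := lt_of_mul_lt_mul_right h3 hN.le
    have h5 : a < b + 1 := by exact_mod_cast h4
    omega
  exact le_antisymm (key _ _ hj.1 hk.2) (key _ _ hk.1 hj.2)

end

/-! ### Grid points with a large residual -/

noncomputable section

open UnitAddTorus

variable {d : ℕ}

/-- The difference between the quasi-periodic extension of `F` and its convolution with `c` along
`v` in the space variable. -/
def spaceResidual (c : ℤ → ℂ) (v : RSpace d) (F : RSpace d × UnitAddTorus (Fin d) → ℂ)
    (p : RSpace d × UnitAddTorus (Fin d)) : ℂ :=
  ∑' j : ℤ, residualCoeff c j * qpExt F (p.1 - (j : ℝ) • v, p.2)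

/-- The difference between `F` and its convolution with `c` along `w` in the frequency variable. -/
def freqResidual (c : ℤ → ℂ) (w : RSpace d) (F : RSpace d × UnitAddTorus (Fin d) → ℂ)
    (p : RSpace d × UnitAddTorus (Fin d)) : ℂ :=
  ∑' j : ℤ, residualCoeff c j * F (p.1, p.2 - toTorus ((j : ℝ) • w))

theorem norm_spaceResidual_add_latticePoint (c : ℤ → ℂ) (v : RSpace d)
    (F : RSpace d × UnitAddTorus (Fin d) → ℂ) (x : RSpace d) (y : UnitAddTorus (Fin d))
    (m : Fin d → ℤ) :
    ‖spaceResidual c v F (x + latticePoint m, y)‖ = ‖spaceResidual c v F (x, y)‖ := by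
  have : spaceResidual c v F (x + latticePoint m, y)
      = mFourier m y * spaceResidual c v F (x, y) := by
    simp only [spaceResidual]
    rw [← tsum_mul_left]
    refine tsum_congr fun j => ?_
    rw [add_sub_right_comm, qpExt_add_latticePoint]
    ring
  rw [this, norm_mul, norm_mFourier_apply, one_mul]

/-- Along every grid of mesh `1/N × 1/M` in the `i`-th space and frequency variable, a
quasi-periodic function bounded away from `0` fails to be approximated by its convolutions with
`c` at some point: otherwise it would vary slowly along the grid, contrary to the winding of
`e^{2πi y_i}`. -/
theorem exists_grid_point_le_residual {F : RSpace d × UnitAddTorus (Fin d) → ℂ} {a b η δ : ℝ}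
    (ha0 : 0 < a) (ha : ∀ p, a ≤ ‖F p‖) (hb : ∀ p, ‖F p‖ ≤ b) {c : ℤ → ℂ}
    (hc : Summable fun j => ‖c j‖) (hη : ∑' j, ‖c j - c (j - 1)‖ ≤ η)
    (hδ : 2 * δ + b * η ≤ a / 2) {N M : ℕ} (hN : 0 < N) (hM : 2 ≤ M) {i : Fin d} {x : RSpace d}
    (hx : x ∈ slab i N) (y : UnitAddTorus (Fin d)) :
    ∃ j < N, ∃ k < M,
      δ ≤ ‖spaceResidual c (gridStep i N) F
        (x + (j : ℝ) • gridStep i N, y + toTorus ((k : ℝ) • gridStep i M))‖ ∨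
      δ ≤ ‖freqResidual c (gridStep i M) F
        (x + (j : ℝ) • gridStep i N, y + toTorus ((k : ℝ) • gridStep i M))‖ := by
  by_contra! H
  set v := gridStep i N with hv
  set w := gridStep i M with hw
  have hMw : toTorus ((M : ℝ) • w) = 0 := by
    rw [hw, natCast_smul_gridStep i (by omega), toTorus_latticePoint]
  have h0w : toTorus (((0 : ℕ) : ℝ) • w) = 0 := by
    rw [Nat.cast_zero, zero_smul, ← latticePoint_zero, toTorus_latticePoint]
  have hNv : x + (N : ℝ) • v = x + latticePoint (Pi.single i 1) := by
    rw [hv, natCast_smul_gridStep i hN]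
  have H' : ∀ j < N, ∀ k ≤ M,
      ‖spaceResidual c v F (x + (j : ℝ) • v, y + toTorus ((k : ℝ) • w))‖ < δ ∧
      ‖freqResidual c w F (x + (j : ℝ) • v, y + toTorus ((k : ℝ) • w))‖ < δ := by
    intro j hj k hk
    rcases hk.lt_or_eq with hk | rfl
    · exact H j hj k hk
    · have := H j hj 0 (by omega)
      rwa [h0w, ← hMw] at this
  have H1 : ∀ j ≤ N, ∀ k ≤ M,
      ‖spaceResidual c v F (x + (j : ℝ) • v, y + toTorus ((k : ℝ) • w))‖ < δ := by
    intro j hj k hk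
    rcases hj.lt_or_eq with hj | rfl
    · exact (H' j hj k hk).1
    · rw [hNv, norm_spaceResidual_add_latticePoint]
      simpa using (H' 0 hN k hk).1
  have hbq : ∀ p, ‖qpExt F p‖ ≤ b := fun p => by rw [norm_qpExt]; exact hb _
  have haq : ∀ p, a ≤ ‖qpExt F p‖ := fun p => by rw [norm_qpExt]; exact ha _
  refine false_of_slowly_varying_quasiperiodic (N := N) (M := M) hM
    (q := fun j k => qpExt F (x + (j : ℝ) • v, y + toTorus ((k : ℝ) • w)))
    (w := mFourier (Pi.single i 1) y) ?_ ?_ ?_ ?_ ?_ hN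
  · exact fun j _ k _ => norm_pos_iff.1 (ha0.trans_le (haq _))
  · intro j _
    simp only [hMw, h0w]
  · intro k _
    simp only [hNv, qpExt_add_latticePoint, mFourier_apply_add, hw,
      mFourier_single_toTorus_gridStep, Nat.cast_zero, zero_smul, add_zero]
  · intro j hj k hk
    obtain ⟨φ, hφ⟩ : ∃ φ : ℤ → ℂ, ∀ n : ℤ,
        φ n = qpExt F (x + (n : ℝ) • v, y + toTorus ((k : ℝ) • w)) := ⟨_, fun _ => rfl⟩
    have e : ∀ m : ℕ, spaceResidual c v F (x + (m : ℝ) • v, y + toTorus ((k : ℝ) • w))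
        = ∑' l : ℤ, residualCoeff c l * φ ((m : ℤ) - l) := by
      intro m
      simp only [spaceResidual, hφ]
      refine tsum_congr fun l => ?_
      rw [add_sub_assoc, ← sub_smul, Int.cast_sub, Int.cast_natCast]
    have b1 := (H1 j hj.le k hk).le
    have b2 := (H1 (j + 1) hj k hk).le
    rw [e] at b1 b2
    rw [Nat.cast_succ] at b2
    have h3 := norm_sub_le_of_residual hc hη (fun n => (hφ n).symm ▸ hbq _) b1 b2
    rw [hφ, hφ, Int.cast_add, Int.cast_natCast, Int.cast_one] at h3
    rw [Nat.cast_add, Nat.cast_one]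
    exact (h3.trans hδ).trans (by linarith [haq (x + (j : ℝ) • v, y + toTorus ((k : ℝ) • w))])
  · intro j hj k hk
    have hQ := add_gridStep_mem_unitCube hx hj
    rw [← hv] at hQ
    simp only [qpExt_of_mem F hQ]
    obtain ⟨φ, hφ⟩ : ∃ φ : ℤ → ℂ, ∀ n : ℤ,
        φ n = F (x + (j : ℝ) • v, y + toTorus ((n : ℝ) • w)) := ⟨_, fun _ => rfl⟩
    have e : ∀ m : ℕ, freqResidual c w F (x + (j : ℝ) • v, y + toTorus ((m : ℝ) • w))
        = ∑' l : ℤ, residualCoeff c l * φ ((m : ℤ) - l) := by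
      intro m
      simp only [freqResidual, hφ]
      refine tsum_congr fun l => ?_
      rw [add_sub_assoc, ← toTorus_sub, ← sub_smul, Int.cast_sub, Int.cast_natCast]
    have b1 := (H' j hj k hk.le).2.le
    have b2 := (H' j hj (k + 1) hk).2.le
    rw [e] at b1 b2
    rw [Nat.cast_succ] at b2
    have h3 := norm_sub_le_of_residual hc hη (fun n => (hφ n).symm ▸ hb _) b1 b2
    rw [hφ, hφ, Int.cast_add, Int.cast_natCast, Int.cast_one] at h3
    rw [Nat.cast_add, Nat.cast_one]
    exact (h3.trans hδ).trans (by linarith [ha (x + (j : ℝ) • v, y + toTorus ((k : ℝ) • w))])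

/-- A subset of `(0,1]^d × 𝕋^d` meeting every grid of mesh `1/N × 1/M` based in a slab has measure
at least `1/(NM)`: the translates of the slab by multiples of `e_i/N` are disjoint. -/
theorem one_le_mul_zakMeasure_of_grid {E : Set (RSpace d × UnitAddTorus (Fin d))}
    (hE : MeasurableSet E) {N M : ℕ} (hN : 0 < N) {i : Fin d}
    (h : ∀ x ∈ slab i N, ∀ y, ∃ j < N, ∃ k < M,
      (x + (j : ℝ) • gridStep i N, y + toTorus ((k : ℝ) • gridStep i M)) ∈ E) :
    1 ≤ (N : ℝ≥0∞) * M * zakMeasure d E := by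
  set v := gridStep i N
  set w := gridStep i M
  set ν : Measure (RSpace d × UnitAddTorus (Fin d)) :=
    (volume : Measure (RSpace d)).prod (torusMeasure (Fin d)) with hν
  have hzak : zakMeasure d = ν.restrict (unitCube d ×ˢ Set.univ) := by
    rw [zakMeasure, cubeMeasure, hν, ← Measure.prod_restrict, Measure.restrict_univ]
  -- the part of `E` over the `j`-th translate of the slab
  let T : ℕ → Set (RSpace d × UnitAddTorus (Fin d)) := fun j =>
    E ∩ {p | p.1 - (j : ℝ) • v ∈ slab i N}
  have hTm : ∀ j, MeasurableSet (T j) := fun j =>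
    hE.inter ((measurableSet_slab i N).preimage (by fun_prop))
  have hTd : Set.PairwiseDisjoint (↑(Finset.range N)) T := by
    intro j _ k _ hjk
    refine Set.disjoint_left.2 fun p hp hp' => hjk ?_
    exact disjoint_slab_translates hp.2 hp'.2
  have hTQ : ∀ j < N, T j ⊆ unitCube d ×ˢ Set.univ := fun j hj p hp => by
    refine ⟨?_, Set.mem_univ _⟩
    have := add_gridStep_mem_unitCube hp.2 hj
    simpa [v] using this
  have hsum : ∑ j ∈ Finset.range N, ν (T j) ≤ zakMeasure d E := by
    rw [← measure_biUnion_finset hTd fun j _ => hTm j, hzak, Measure.restrict_apply hE]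
    refine measure_mono (Set.iUnion₂_subset fun j hj => Set.subset_inter Set.inter_subset_left ?_)
    exact hTQ j (Finset.mem_range.1 hj)
  have hcover : slab i N ×ˢ (Set.univ : Set (UnitAddTorus (Fin d))) ⊆
      ⋃ k ∈ Finset.range M, ⋃ j ∈ Finset.range N,
        (fun p => (p.1 + (j : ℝ) • v, p.2 + toTorus ((k : ℝ) • w))) ⁻¹' T j := by
    rintro ⟨x, y⟩ ⟨hx, -⟩
    obtain ⟨j, hj, k, hk, hjk⟩ := h x hx y
    simp only [Set.mem_iUnion, Finset.mem_range, exists_prop]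
    refine ⟨k, hk, j, hj, hjk, ?_⟩
    simpa using hx
  have hshift : ∀ j k : ℕ, ν ((fun p : RSpace d × UnitAddTorus (Fin d) =>
      (p.1 + (j : ℝ) • v, p.2 + toTorus ((k : ℝ) • w))) ⁻¹' T j) = ν (T j) := fun j k =>
    ((measurePreserving_add_right volume ((j : ℝ) • v)).prod
      (measurePreserving_add_right (torusMeasure (Fin d)) (toTorus ((k : ℝ) • w)))).measure_preimage
      (hTm j).nullMeasurableSet
  have hν1 : ν (slab i N ×ˢ Set.univ) = (N : ℝ≥0∞)⁻¹ := by
    rw [hν, Measure.prod_prod, measure_univ, mul_one, volume_slab, one_div,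
      ENNReal.ofReal_inv_of_pos (by exact_mod_cast hN), ENNReal.ofReal_natCast]
  have hle : (N : ℝ≥0∞)⁻¹ ≤ M * zakMeasure d E := by
    rw [← hν1]
    calc ν (slab i N ×ˢ Set.univ)
        ≤ ∑ k ∈ Finset.range M, ∑ j ∈ Finset.range N, ν ((fun p =>
            (p.1 + (j : ℝ) • v, p.2 + toTorus ((k : ℝ) • w))) ⁻¹' T j) := by
          refine (measure_mono hcover).trans ((measure_biUnion_finset_le _ _).trans ?_)
          exact Finset.sum_le_sum fun k _ => measure_biUnion_finset_le _ _
      _ ≤ ∑ k ∈ Finset.range M, zakMeasure d E := by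
          refine Finset.sum_le_sum fun k _ => ?_
          simp_rw [hshift]
          exact hsum
      _ = M * zakMeasure d E := by simp
  have hN0 : (N : ℝ≥0∞) ≠ 0 := by exact_mod_cast hN.ne'
  rw [mul_assoc]
  calc (1 : ℝ≥0∞) = N * (N : ℝ≥0∞)⁻¹ := (ENNReal.mul_inv_cancel hN0 (ENNReal.natCast_ne_top N)).symm
    _ ≤ _ := by gcongr

end

/-! ### The lower bound -/

noncomputable section

variable {d : ℕ}

theorem measurableSet_rectangle (R : Fin d → ℝ) : MeasurableSet (rectangle R) := by
  have : rectangle R = ⋂ j, (fun x : RSpace d => x j) ⁻¹' Set.Ioo (-R j) (R j) := by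
    ext x; simp [rectangle]
  rw [this]
  exact MeasurableSet.iInter fun j => measurableSet_Ioo.preimage (by fun_prop)

theorem ofReal_setIntegral_norm_sq (u : L2 d) (S : Set (RSpace d)) :
    ENNReal.ofReal (∫ x in S, ‖u x‖ ^ 2) = ∫⁻ x in S, ‖u x‖ₑ ^ 2 := by
  have hi : Integrable (fun x => ‖u x‖ ^ 2) :=
    (memLp_two_iff_integrable_sq_norm (Lp.aestronglyMeasurable u)).1 (Lp.memLp u)
  rw [ofReal_integral_eq_lintegral_ofReal hi.restrict (ae_of_all _ fun x => by positivity)]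
  simp_rw [ENNReal.ofReal_pow (norm_nonneg _), ofReal_norm]

theorem tailMass_nonneg (u : L2 d) (R L : Fin d → ℝ) : 0 ≤ tailMass u R L :=
  add_nonneg (integral_nonneg fun _ => by positivity) (integral_nonneg fun _ => by positivity)

theorem ofReal_tailMass (u : L2 d) (R L : Fin d → ℝ) :
    ENNReal.ofReal (tailMass u R L) = (∫⁻ x in (rectangle R)ᶜ, ‖u x‖ₑ ^ 2)
      + ∫⁻ ξ in (rectangle L)ᶜ, ‖(𝓕 u : L2 d) ξ‖ₑ ^ 2 := by
  rw [tailMass, ENNReal.ofReal_add (integral_nonneg fun _ => by positivity)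
    (integral_nonneg fun _ => by positivity), ofReal_setIntegral_norm_sq,
    ofReal_setIntegral_norm_sq]

/-- Where `1 - symbol c` is supported outside a rectangle, it picks up at most four times the
tail. -/
theorem lintegral_symbol_residual_le {c : ℤ → ℂ} (hc : Summable fun j => ‖c j‖) {κ : ℝ}
    (h1 : ∀ θ : ℝ, |θ| ≤ κ → symbol c θ = 1) (h2 : ∀ θ, ‖symbol c θ‖ ≤ 1)
    {θ : RSpace d → ℝ} {R : Fin d → ℝ} (hθ : ∀ x ∈ rectangle R, |θ x| ≤ κ) (u : L2 d) :
    ∫⁻ x, ‖symbol (residualCoeff c) (θ x)‖ₑ ^ 2 * ‖u x‖ₑ ^ 2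
      ≤ 4 * ∫⁻ x in (rectangle R)ᶜ, ‖u x‖ₑ ^ 2 := by
  rw [← lintegral_const_mul' _ _ (by norm_num),
    ← lintegral_indicator (measurableSet_rectangle R).compl]
  refine lintegral_mono fun x => ?_
  rw [symbol_residual hc]
  by_cases hx : x ∈ rectangle R
  · rw [h1 _ (hθ x hx)]
    simp
  · rw [Set.indicator_of_mem hx]
    gcongr
    have h3 : ‖1 - symbol c (θ x)‖ ≤ 2 := by
      refine (norm_sub_le _ _).trans ?_
      rw [norm_one]
      linarith [h2 (θ x)]
    have h4 : ‖1 - symbol c (θ x)‖ₑ ≤ 2 := by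
      rw [← ofReal_norm]
      exact ENNReal.ofReal_le_of_le_toReal (by simpa using h3)
    calc ‖1 - symbol c (θ x)‖ₑ ^ 2 ≤ 2 ^ 2 := by gcongr
      _ = 4 := by norm_num

/-- The Zak transform of the generator of a Riesz basis has a representative which satisfies the
bounds everywhere. -/
theorem exists_isZak_bounded {u : L2 d} {A B : ℝ} (h : IsRieszBasisWith (gaborSystem u) A B) :
    ∃ F : RSpace d × UnitAddTorus (Fin d) → ℂ, StronglyMeasurable F ∧ IsZak u F ∧
      (∀ p, √A ≤ ‖F p‖) ∧ ∀ p, ‖F p‖ ≤ √B := by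
  obtain ⟨F₀, hm, hZ⟩ := exists_isZak (Lp.memLp u)
  have hae := hZ.bounds_of_isRieszBasisWith h
  have hAB : A ≤ B := by
    obtain ⟨p, hp⟩ := hae.exists
    exact hp.1.trans hp.2
  classical
  let S : Set (RSpace d × UnitAddTorus (Fin d)) := {p | √A ≤ ‖F₀ p‖ ∧ ‖F₀ p‖ ≤ √B}
  have hS : MeasurableSet S :=
    (measurableSet_le measurable_const hm.norm.measurable).inter
      (measurableSet_le hm.norm.measurable measurable_const)
  have hA : ‖((√A : ℝ) : ℂ)‖ = √A := by
    rw [Complex.norm_real, Real.norm_eq_abs, abs_of_nonneg (Real.sqrt_nonneg A)]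
  refine ⟨fun p => if p ∈ S then F₀ p else (√A : ℝ), StronglyMeasurable.ite hS hm
    stronglyMeasurable_const, hZ.congr_right ?_, fun p => ?_, fun p => ?_⟩
  · filter_upwards [hae] with p hp
    have : p ∈ S := ⟨Real.sqrt_le_iff.2 ⟨norm_nonneg _, hp.1⟩, Real.le_sqrt_of_sq_le hp.2⟩
    rw [if_pos this]
  · dsimp only
    split_ifs with hp
    · exact hp.1
    · rw [hA]
  · dsimp only
    split_ifs with hp
    · exact hp.2
    · rw [hA]
      exact Real.sqrt_le_sqrt hAB

/-- The lower bound. The grid has about `L_i/κ` points in space and `R_i/κ` in frequency, so that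
the convolution with mesh `1/N` (or `1/M`) changes the window only outside the rectangles; the set of
points with a large residual has measure at least `1/(NM)`, and Chebyshev's inequality bounds it by
the tails. -/
theorem exists_tailMass_lower_bound {A B : ℝ} (hA : 0 < A) (hB : 0 < B) :
    ∃ C : ℝ, 0 < C ∧ ∀ (d : ℕ) (g : L2 d), IsRieszBasisWith (gaborSystem g) A B →
      ∀ R L : Fin d → ℝ, (∀ j, 1 ≤ R j) → (∀ j, 1 ≤ L j) →
        ∀ i : Fin d, C / (R i * L i) ≤ tailMass g R L := by
  have hA' : 0 < √A := Real.sqrt_pos.2 hA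
  have hB' : 0 < √B := Real.sqrt_pos.2 hB
  obtain ⟨κ, hκ, c, hc, h1, h2, hη⟩ :=
    exists_trapezoid_multiplier (η := √A / (4 * √B)) (by positivity)
  -- `δ` and the variation of `c` are such that a step between points of small residual is at most
  -- `2 * √A / 8 + √B * √A / (4 * √B) = √A / 2`, half of the lower bound for the Zak transform
  set δ := √A / 8 with hδ
  have hδ0 : 0 < δ := by positivity
  have hδη : 2 * δ + √B * (√A / (4 * √B)) ≤ √A / 2 := by
    rw [hδ]
    field_simp
    norm_num
  set c₁ := 1 / κ + 1 with hc₁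
  set c₂ := 2 / κ + 2 with hc₂
  have hc₁0 : 0 < c₁ := by positivity
  have hc₂0 : 0 < c₂ := by positivity
  refine ⟨δ ^ 2 / (4 * c₁ * c₂), by positivity, fun d g hg R L hR hL i => ?_⟩
  obtain ⟨F, hFm, hF, hFa, hFb⟩ := exists_isZak_bounded hg
  have hRi := hR i
  have hLi := hL i
  set N := ⌈L i / κ⌉₊ with hN
  set M := ⌈2 * R i / κ⌉₊ + 1 with hM
  have hN0 : 0 < N := Nat.ceil_pos.2 (by positivity)
  have hM2 : 2 ≤ M := by
    have : 0 < ⌈2 * R i / κ⌉₊ := Nat.ceil_pos.2 (by positivity)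
    omega
  have hNle : (N : ℝ) ≤ L i * c₁ := by
    have := (Nat.ceil_lt_add_one (a := L i / κ) (by positivity)).le
    calc (N : ℝ) ≤ L i / κ + 1 := this
      _ ≤ L i / κ + L i := by linarith
      _ = L i * c₁ := by rw [hc₁]; ring
  have hMle : (M : ℝ) ≤ R i * c₂ := by
    have := (Nat.ceil_lt_add_one (a := 2 * R i / κ) (by positivity)).le
    calc (M : ℝ) = (⌈2 * R i / κ⌉₊ : ℝ) + 1 := by rw [hM]; push_cast; ring
      _ ≤ 2 * R i / κ + 2 * R i := by linarith
      _ = R i * c₂ := by rw [hc₂]; ring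
  have hNκ : L i ≤ κ * N := by
    have := Nat.le_ceil (L i / κ)
    rw [div_le_iff₀ hκ] at this
    linarith
  have hMκ : 2 * R i ≤ κ * M := by
    have := Nat.le_ceil (2 * R i / κ)
    rw [div_le_iff₀ hκ] at this
    rw [hM]
    push_cast
    linarith
  have hNr : (0 : ℝ) < N := by exact_mod_cast hN0
  have hMr : (0 : ℝ) < M := by positivity
  have hcr := summable_norm_residual hc
  -- the two residuals are controlled by the tails
  have hspace : ∫⁻ p, ‖spaceResidual c (gridStep i N) F p‖ₑ ^ 2 ∂zakMeasure d
      ≤ 4 * ∫⁻ ξ in (rectangle L)ᶜ, ‖(𝓕 g : L2 d) ξ‖ₑ ^ 2 := by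
    simp only [spaceResidual]
    rw [hF.lintegral_tsum_space hFm hFb hcr]
    refine lintegral_symbol_residual_le hc h1 h2 (fun ξ hξ => ?_) _
    rw [inner_gridStep, abs_div, abs_of_pos hNr, div_le_iff₀ hNr]
    exact (abs_le.2 ⟨(hξ i).1.le, (hξ i).2.le⟩).trans hNκ
  have hfreq : ∫⁻ p, ‖freqResidual c (gridStep i M) F p‖ₑ ^ 2 ∂zakMeasure d
      ≤ 4 * ∫⁻ x in (rectangle R)ᶜ, ‖g x‖ₑ ^ 2 := by
    simp only [freqResidual]
    rw [hF.lintegral_tsum_freq hFm hFb hcr]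
    refine lintegral_symbol_residual_le hc h1 h2 (fun x hx => ?_) _
    rw [inner_gridStep, abs_neg, abs_div, abs_of_pos hMr, div_le_iff₀ hMr, latticePoint_apply]
    -- the multiplier is evaluated at the cell index of `x i`, which may exceed `R i` by `1 ≤ R i`
    refine le_trans ?_ hMκ
    have hxi := hx i
    have u1 := Int.le_ceil (x i)
    have u2 := Int.ceil_lt_add_one (x i)
    simp only [cellIndex, Int.cast_sub, Int.cast_one]
    rw [abs_le]
    constructor <;> linarith [hxi.1, hxi.2]
  have hmq := stronglyMeasurable_qpExt hFm
  have hsm : StronglyMeasurable (spaceResidual c (gridStep i N) F) :=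
    stronglyMeasurable_tsum (K := √B) (fun j => hmq.comp_measurable (by fun_prop))
      (fun j p => (norm_qpExt F _).trans_le (hFb _)) hcr
  have hfm : StronglyMeasurable (freqResidual c (gridStep i M) F) :=
    stronglyMeasurable_tsum (K := √B) (fun j => hFm.comp_measurable (by fun_prop))
      (fun j p => hFb _) hcr
  set E₁ := {p | ENNReal.ofReal δ ^ 2 ≤ ‖spaceResidual c (gridStep i N) F p‖ₑ ^ 2} with hE₁
  set E₂ := {p | ENNReal.ofReal δ ^ 2 ≤ ‖freqResidual c (gridStep i M) F p‖ₑ ^ 2} with hE₂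
  have hE₁m : MeasurableSet E₁ := measurableSet_le measurable_const (hsm.enorm.pow_const 2)
  have hE₂m : MeasurableSet E₂ := measurableSet_le measurable_const (hfm.enorm.pow_const 2)
  have hgrid := one_le_mul_zakMeasure_of_grid (hE₁m.union hE₂m) (N := N) (M := M) (i := i) hN0
    (fun x hx y => by
      obtain ⟨j, hj, k, hk, h⟩ :=
        exists_grid_point_le_residual hA' hFa hFb hc hη hδη hN0 hM2 hx y
      refine ⟨j, hj, k, hk, ?_⟩
      rcases h with h | h
      · left
        rw [hE₁, Set.mem_ofPred_eq, ← ofReal_norm]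
        gcongr
      · right
        rw [hE₂, Set.mem_ofPred_eq, ← ofReal_norm]
        gcongr)
  have hcheb : ENNReal.ofReal δ ^ 2 * zakMeasure d (E₁ ∪ E₂)
      ≤ 4 * ENNReal.ofReal (tailMass g R L) := by
    calc ENNReal.ofReal δ ^ 2 * zakMeasure d (E₁ ∪ E₂)
        ≤ ENNReal.ofReal δ ^ 2 * (zakMeasure d E₁ + zakMeasure d E₂) := by
          gcongr; exact measure_union_le _ _
      _ = ENNReal.ofReal δ ^ 2 * zakMeasure d E₁ + ENNReal.ofReal δ ^ 2 * zakMeasure d E₂ :=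
          mul_add _ _ _
      _ ≤ 4 * (∫⁻ ξ in (rectangle L)ᶜ, ‖(𝓕 g : L2 d) ξ‖ₑ ^ 2)
            + 4 * ∫⁻ x in (rectangle R)ᶜ, ‖g x‖ₑ ^ 2 := by
          refine add_le_add (le_trans ?_ hspace) (le_trans ?_ hfreq)
          · exact mul_meas_ge_le_lintegral₀ (hsm.enorm.pow_const 2).aemeasurable _
          · exact mul_meas_ge_le_lintegral₀ (hfm.enorm.pow_const 2).aemeasurable _
      _ = 4 * ENNReal.ofReal (tailMass g R L) := by
          rw [ofReal_tailMass, mul_add, add_comm]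
  have hT := tailMass_nonneg g R L
  have hfinal : δ ^ 2 ≤ N * M * (4 * tailMass g R L) := by
    have h3 : ENNReal.ofReal (δ ^ 2) ≤ ENNReal.ofReal (N * M * (4 * tailMass g R L)) := by
      rw [ENNReal.ofReal_mul (by positivity), ENNReal.ofReal_mul (by positivity),
        ENNReal.ofReal_mul (by positivity), ENNReal.ofReal_natCast, ENNReal.ofReal_natCast,
        ENNReal.ofReal_pow hδ0.le]
      calc ENNReal.ofReal δ ^ 2 = ENNReal.ofReal δ ^ 2 * 1 := (mul_one _).symm
        _ ≤ ENNReal.ofReal δ ^ 2 * (N * M * zakMeasure d (E₁ ∪ E₂)) := by gcongr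
        _ = N * M * (ENNReal.ofReal δ ^ 2 * zakMeasure d (E₁ ∪ E₂)) := by ring
        _ ≤ N * M * (4 * ENNReal.ofReal (tailMass g R L)) := by gcongr
        _ = _ := by norm_num
    exact (ENNReal.ofReal_le_ofReal_iff (by positivity)).1 h3
  have hRL : 0 < R i * L i := by positivity
  rw [div_le_iff₀ hRL, div_le_iff₀ (by positivity)]
  calc δ ^ 2 ≤ N * M * (4 * tailMass g R L) := hfinal
    _ ≤ (L i * c₁) * (R i * c₂) * (4 * tailMass g R L) := by gcongr
    _ = _ := by ring

end

/-! ### Second differences of the radial projection and the chord -/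

noncomputable section

/-- The radial projection `w ↦ w / |w|` to the unit circle, with value `0` at `0`. -/
def direction (w : ℂ) : ℂ := w / (‖w‖ : ℂ)

theorem norm_direction {w : ℂ} (hw : w ≠ 0) : ‖direction w‖ = 1 := by
  rw [direction, norm_div, Complex.norm_real, norm_norm, div_self (norm_ne_zero_iff.2 hw)]

theorem norm_direction_le (w : ℂ) : ‖direction w‖ ≤ 1 := by
  rcases eq_or_ne w 0 with rfl | hw
  · simp [direction]
  · exact (norm_direction hw).le

theorem direction_mul (a b : ℂ) : direction (a * b) = direction a * direction b := by
  simp only [direction, norm_mul, Complex.ofReal_mul]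
  rw [mul_div_mul_comm]

theorem direction_of_norm_eq_one {u : ℂ} (hu : ‖u‖ = 1) : direction u = u := by
  simp [direction, hu]

theorem measurable_direction : Measurable direction :=
  measurable_id.div (Complex.measurable_ofReal.comp measurable_norm)

/-- First order expansion of the radial projection at `1`. -/
theorem norm_direction_one_add_sub_le {t : ℂ} (ht : ‖t‖ ≤ 1 / 2) :
    ‖direction (1 + t) - 1 - t.im * Complex.I‖ ≤ 4 * ‖t‖ ^ 2 := by
  set r := ‖1 + t‖ with hr
  have hre := (abs_le.1 (Complex.abs_re_le_norm t))
  have him := Complex.abs_im_le_norm t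
  have h1 : |r - 1| ≤ ‖t‖ := by
    have h := abs_norm_sub_norm_le (1 + t) 1
    rwa [norm_one, add_sub_cancel_left] at h
  have h1' := abs_le.1 h1
  have hr2 : 1 / 2 ≤ r := by linarith
  have hr0 : 0 < r := by linarith
  have hsq : r ^ 2 = (1 + t.re) ^ 2 + t.im ^ 2 := by
    rw [hr, ← Complex.normSq_eq_norm_sq, Complex.normSq_apply]
    simp only [Complex.add_re, Complex.one_re, Complex.add_im, Complex.one_im, zero_add]
    ring
  have hnt : t.im ^ 2 ≤ ‖t‖ ^ 2 := by
    rw [← sq_abs]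
    exact pow_le_pow_left₀ (abs_nonneg _) him 2
  have e : direction (1 + t) - 1 - t.im * Complex.I
      = (((1 + t.re) / r - 1 : ℝ) : ℂ) + ((t.im * (1 / r - 1) : ℝ) : ℂ) * Complex.I := by
    have h2 : (1 + t : ℂ) = ((1 + t.re : ℝ) : ℂ) + (t.im : ℂ) * Complex.I := by
      conv_lhs => rw [← Complex.re_add_im t]
      push_cast; ring
    rw [direction, ← hr]
    conv_lhs => rw [h2]
    push_cast
    ring
  have b1 : |(1 + t.re) / r - 1| ≤ 2 * ‖t‖ ^ 2 := by
    have h3 : (1 + t.re) / r - 1 = -(t.im ^ 2 / (r * (r + (1 + t.re)))) := by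
      have : 0 < r + (1 + t.re) := by linarith
      field_simp
      nlinarith
    rw [h3, abs_neg, abs_of_nonneg (by have : 0 < r + (1 + t.re) := by linarith
                                       positivity),
      div_le_iff₀ (by have : 0 < r + (1 + t.re) := by linarith
                      positivity)]
    have : 1 / 2 ≤ r * (r + (1 + t.re)) := by nlinarith
    nlinarith [sq_nonneg ‖t‖]
  have b2 : |t.im * (1 / r - 1)| ≤ 2 * ‖t‖ ^ 2 := by
    have h3 : 1 / r - 1 = (1 - r) / r := by field_simp
    rw [h3, abs_mul, abs_div, abs_of_pos hr0, abs_sub_comm]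
    have h4 : |r - 1| / r ≤ 2 * ‖t‖ := by
      rw [div_le_iff₀ hr0]
      nlinarith [norm_nonneg t]
    calc |t.im| * (|r - 1| / r) ≤ ‖t‖ * (2 * ‖t‖) := by gcongr
      _ = 2 * ‖t‖ ^ 2 := by ring
  rw [e]
  refine (norm_add_le _ _).trans ?_
  rw [norm_mul, Complex.norm_I, mul_one, Complex.norm_real, Complex.norm_real,
    Real.norm_eq_abs, Real.norm_eq_abs]
  linarith

theorem norm_second_difference_direction_le_four (w w₁ w₂ : ℂ) :
    ‖direction w₁ + direction w₂ - 2 * direction w‖ ≤ 4 := by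
  refine (norm_sub_le _ _).trans ?_
  have := norm_add_le (direction w₁) (direction w₂)
  rw [norm_mul, Complex.norm_ofNat]
  linarith [norm_direction_le w, norm_direction_le w₁, norm_direction_le w₂]

/-- Second differences of the radial projection: the linear part of the projection sees only the
second difference of the points, and the remainder is quadratic. -/
theorem norm_second_difference_direction_le {w w₁ w₂ : ℂ} (hw : w ≠ 0) {σ : ℝ}
    (h1 : ‖w₁ - w‖ ≤ σ) (h2 : ‖w₂ - w‖ ≤ σ) :
    ‖direction w₁ + direction w₂ - 2 * direction w‖
      ≤ ‖w₁ + w₂ - 2 * w‖ / ‖w‖ + 16 * σ ^ 2 / ‖w‖ ^ 2 := by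
  have hw0 : 0 < ‖w‖ := norm_pos_iff.2 hw
  have hσ : 0 ≤ σ := (norm_nonneg _).trans h1
  rcases le_or_gt σ (‖w‖ / 2) with h | h
  · set t₁ := (w₁ - w) / w with ht₁
    set t₂ := (w₂ - w) / w with ht₂
    have n1 : ‖t₁‖ ≤ σ / ‖w‖ := by rw [ht₁, norm_div]; gcongr
    have n2 : ‖t₂‖ ≤ σ / ‖w‖ := by rw [ht₂, norm_div]; gcongr
    have hσw : σ / ‖w‖ ≤ 1 / 2 := by rw [div_le_iff₀ hw0]; linarith
    have e1 : w₁ = w * (1 + t₁) := by rw [ht₁]; field_simp; ring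
    have e2 : w₂ = w * (1 + t₂) := by rw [ht₂]; field_simp; ring
    have d1 := norm_direction_one_add_sub_le (n1.trans hσw)
    have d2 := norm_direction_one_add_sub_le (n2.trans hσw)
    have e3 : direction w₁ + direction w₂ - 2 * direction w = direction w *
        ((direction (1 + t₁) - 1 - t₁.im * Complex.I) + (direction (1 + t₂) - 1 - t₂.im * Complex.I)
          + ((t₁ + t₂).im : ℂ) * Complex.I) := by
      rw [e1, e2, direction_mul, direction_mul, Complex.add_im]
      push_cast
      ring
    have e4 : t₁ + t₂ = (w₁ + w₂ - 2 * w) / w := by rw [ht₁, ht₂]; ring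
    have d3 : ‖((t₁ + t₂).im : ℂ) * Complex.I‖ ≤ ‖w₁ + w₂ - 2 * w‖ / ‖w‖ := by
      rw [norm_mul, Complex.norm_I, mul_one, Complex.norm_real, Real.norm_eq_abs, ← norm_div, ← e4]
      exact Complex.abs_im_le_norm _
    have q1 : ‖t₁‖ ^ 2 ≤ (σ / ‖w‖) ^ 2 := pow_le_pow_left₀ (norm_nonneg _) n1 2
    have q2 : ‖t₂‖ ^ 2 ≤ (σ / ‖w‖) ^ 2 := pow_le_pow_left₀ (norm_nonneg _) n2 2
    rw [e3, norm_mul, norm_direction hw, one_mul]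
    refine (norm_add_le _ _).trans ?_
    refine (add_le_add (norm_add_le _ _) d3).trans ?_
    have q3 : 16 * σ ^ 2 / ‖w‖ ^ 2 = 16 * (σ / ‖w‖) ^ 2 := by ring
    rw [q3]
    nlinarith [sq_nonneg (σ / ‖w‖)]
  · refine (norm_second_difference_direction_le_four w w₁ w₂).trans ?_
    have : 4 ≤ 16 * σ ^ 2 / ‖w‖ ^ 2 := by
      rw [le_div_iff₀ (by positivity)]
      nlinarith
    have h3 : 0 ≤ ‖w₁ + w₂ - 2 * w‖ / ‖w‖ := by positivity
    linarith

open AddCircle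

/-- The chord from `1` to `e^{2πi t}`, which passes through `0` only for `x = t = 1/2`. -/
def chord (x : ℝ) (t : UnitAddCircle) : ℂ := (1 - x) + x * fourier 1 t

theorem continuous_chord : Continuous fun p : ℝ × UnitAddCircle => chord p.1 p.2 := by
  unfold chord
  have : Continuous fun p : ℝ × UnitAddCircle => fourier 1 p.2 :=
    (fourier (T := 1) 1).continuous.comp continuous_snd
  fun_prop

theorem fourier_one_coe (y : ℝ) :
    fourier (T := (1 : ℝ)) 1 (y : UnitAddCircle)
      = Real.cos (2 * Real.pi * y) + Real.sin (2 * Real.pi * y) * Complex.I := by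
  rw [fourier_coe_apply, Complex.ofReal_cos, Complex.ofReal_sin, ← Complex.exp_mul_I]
  congr 1
  push_cast
  ring

theorem norm_sq_chord (x y : ℝ) :
    ‖chord x (y : UnitAddCircle)‖ ^ 2 = 1 - 4 * x * (1 - x) * Real.sin (Real.pi * y) ^ 2 := by
  have h1 : chord x (y : UnitAddCircle)
      = ((1 - x + x * Real.cos (2 * Real.pi * y) : ℝ) : ℂ)
        + ((x * Real.sin (2 * Real.pi * y) : ℝ) : ℂ) * Complex.I := by
    rw [chord, fourier_one_coe]; push_cast; ring
  rw [h1, ← Complex.normSq_eq_norm_sq, Complex.normSq_add_mul_I]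
  have h2 : 2 * Real.pi * y = 2 * (Real.pi * y) := by ring
  have h3 := Real.sin_sq_add_cos_sq (2 * (Real.pi * y))
  have h4 := Real.cos_two_mul' (Real.pi * y)
  have h5 := Real.sin_sq_add_cos_sq (Real.pi * y)
  rw [h2]
  have h6 : Real.cos (2 * (Real.pi * y)) = 1 - 2 * Real.sin (Real.pi * y) ^ 2 := by linarith
  have h7 : Real.sin (2 * (Real.pi * y)) ^ 2 = 1 - Real.cos (2 * (Real.pi * y)) ^ 2 := by linarith
  rw [mul_pow, h7, h6]
  ring

theorem four_mul_sq_le_norm_sq_chord_left {x : ℝ} (hx : x ∈ Set.Ioc (0 : ℝ) 1) (y : ℝ) :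
    4 * (x - 1 / 2) ^ 2 ≤ ‖chord x (y : UnitAddCircle)‖ ^ 2 := by
  rw [norm_sq_chord]
  have h1 := Real.sin_sq_le_one (Real.pi * y)
  have h2 : 0 ≤ x * (1 - x) := mul_nonneg hx.1.le (by linarith [hx.2])
  nlinarith

theorem four_mul_sq_le_norm_sq_chord_right {x : ℝ} {y : ℝ}
    (hy : y ∈ Set.Ioc (0 : ℝ) 1) :
    4 * (y - 1 / 2) ^ 2 ≤ ‖chord x (y : UnitAddCircle)‖ ^ 2 := by
  rw [norm_sq_chord]
  have h1 := Real.sin_sq_add_cos_sq (Real.pi * y)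
  have h2 : 2 * |y - 1 / 2| ≤ |Real.cos (Real.pi * y)| := by
    have h5 : |y - 1 / 2| ≤ 1 / 2 := by
      rw [abs_le]; constructor <;> linarith [hy.1, hy.2]
    have h3 : |Real.cos (Real.pi * y)| = Real.sin (Real.pi * |y - 1 / 2|) := by
      have h4 : Real.cos (Real.pi * y) = -Real.sin (Real.pi * (y - 1 / 2)) := by
        rw [mul_sub, mul_one_div, Real.sin_sub_pi_div_two, neg_neg]
      have h6 : 0 ≤ Real.sin (Real.pi * |y - 1 / 2|) :=
        Real.sin_nonneg_of_nonneg_of_le_pi (by positivity) (by nlinarith [Real.pi_pos])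
      rw [h4, abs_neg]
      rcases abs_cases (y - 1 / 2) with h | h
      · rw [h.1] at h6 ⊢
        exact abs_of_nonneg h6
      · rw [h.1, mul_neg, Real.sin_neg] at h6 ⊢
        exact abs_of_nonpos (by linarith)
    have h6 := Real.mul_le_sin (x := Real.pi * |y - 1 / 2|) (by positivity)
      (by nlinarith [Real.pi_pos])
    rw [h3]
    calc 2 * |y - 1 / 2| = 2 / Real.pi * (Real.pi * |y - 1 / 2|) := by
          field_simp
      _ ≤ _ := h6
  have h3 : 4 * (y - 1 / 2) ^ 2 ≤ Real.cos (Real.pi * y) ^ 2 := by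
    have := pow_le_pow_left₀ (by positivity) h2 2
    rw [mul_pow, sq_abs, sq_abs] at this
    linarith
  nlinarith [sq_nonneg (2 * x - 1), sq_nonneg (Real.sin (Real.pi * y)),
    mul_nonneg (sq_nonneg (2 * x - 1)) (sq_nonneg (Real.sin (Real.pi * y)))]

theorem chord_ne_zero {x : ℝ} (hx : x ∈ Set.Ioc (0 : ℝ) 1) (hx2 : x ≠ 1 / 2) (t : UnitAddCircle) :
    chord x t ≠ 0 := by
  induction t using QuotientAddGroup.induction_on with
  | H y =>
    intro h
    have h1 := four_mul_sq_le_norm_sq_chord_left hx y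
    change chord x (y : UnitAddCircle) = 0 at h
    rw [h, norm_zero] at h1
    have h2 : 0 < (x - 1 / 2) ^ 2 := by
      have : x - 1 / 2 ≠ 0 := sub_ne_zero.2 hx2
      positivity
    norm_num at h1
    linarith

theorem norm_chord_le_one {x : ℝ} (hx : x ∈ Set.Ioc (0 : ℝ) 1) (t : UnitAddCircle) :
    ‖chord x t‖ ≤ 1 := by
  rw [chord]
  refine (norm_add_le _ _).trans ?_
  rw [norm_mul, fourier_apply, Circle.norm_coe, mul_one, ← Complex.ofReal_one,
    ← Complex.ofReal_sub, Complex.norm_real, Complex.norm_real, Real.norm_eq_abs,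
    Real.norm_eq_abs, abs_of_nonneg (by linarith [hx.2]), abs_of_pos hx.1]
  linarith

end

/-! ### Second differences of the projected chord -/

noncomputable section

open AddCircle

/-- The quasi-periodic extension of `chord` in the first variable: a polygonal path with vertices
`e^{2πi mt}`, `m ∈ ℤ`. -/
def qpChord (x : ℝ) (t : UnitAddCircle) : ℂ :=
  fourier (⌈x⌉ - 1) t * chord (x - ((⌈x⌉ - 1 : ℤ) : ℝ)) t

theorem qpChord_of_mem {x : ℝ} (hx : x ∈ Set.Ioc (0 : ℝ) 1) (t : UnitAddCircle) :
    qpChord x t = chord x t := by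
  have : ⌈x⌉ = 1 := Int.ceil_eq_iff.2 (by simpa using hx)
  simp [qpChord, this]

theorem norm_fourier_apply (n : ℤ) (t : UnitAddCircle) : ‖fourier n t‖ = 1 := by
  rw [fourier_apply, Circle.norm_coe]

theorem qpChord_of_mem_Ioc_one_two {x : ℝ} (hx : x ∈ Set.Ioc (1 : ℝ) 2) (t : UnitAddCircle) :
    qpChord x t = fourier 1 t + (x - 1) * (fourier 1 t * (fourier 1 t - 1)) := by
  have : ⌈x⌉ = 2 := Int.ceil_eq_iff.2 (by norm_num; exact hx)
  simp only [qpChord, this, chord]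
  norm_num
  ring

theorem qpChord_of_mem_Ioc_neg_one_zero {x : ℝ} (hx : x ∈ Set.Ioc (-1 : ℝ) 0)
    (t : UnitAddCircle) : qpChord x t = 1 + (-x) * (fourier (-1) t - 1) := by
  have h0 : ⌈x⌉ = 0 := Int.ceil_eq_iff.2 (by norm_num; exact hx)
  have h1 : fourier (-1) t * fourier 1 t = 1 := by rw [← fourier_add]; simp
  simp only [qpChord, h0, chord, zero_sub]
  push_cast
  linear_combination (x + 1) * h1

theorem norm_one_sub_fourier_le_two (n : ℤ) (t : UnitAddCircle) : ‖fourier n t - 1‖ ≤ 2 := by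
  refine (norm_sub_le _ _).trans ?_
  rw [norm_fourier_apply, norm_one]
  norm_num

theorem norm_real_mul_le {a : ℝ} (ha : 0 ≤ a) {w : ℂ} {b : ℝ} (hw : ‖w‖ ≤ b) :
    ‖(a : ℂ) * w‖ ≤ a * b := by
  rw [norm_mul, Complex.norm_real, Real.norm_eq_abs, abs_of_nonneg ha]
  exact mul_le_mul_of_nonneg_left hw ha

theorem norm_qpChord_add_sub_le {x s : ℝ} (hx : x ∈ Set.Ioc (0 : ℝ) 1) (hs0 : 0 < s) (hs1 : s < 1)
    (t : UnitAddCircle) : ‖qpChord (x + s) t - chord x t‖ ≤ 2 * s := by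
  have hE := norm_one_sub_fourier_le_two 1 t
  rcases le_or_gt (x + s) 1 with h | h
  · rw [qpChord_of_mem ⟨by linarith [hx.1], h⟩]
    have e : chord (x + s) t - chord x t = (s : ℂ) * (fourier 1 t - 1) := by
      simp only [chord]; push_cast; ring
    rw [e]
    linarith [norm_real_mul_le hs0.le hE]
  · rw [qpChord_of_mem_Ioc_one_two ⟨h, by linarith [hx.2]⟩]
    have e : fourier 1 t + ((x + s : ℝ) - 1) * (fourier 1 t * (fourier 1 t - 1)) - chord x t
        = ((1 - x : ℝ) : ℂ) * (fourier 1 t - 1)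
          + ((x + s - 1 : ℝ) : ℂ) * (fourier 1 t * (fourier 1 t - 1)) := by
      simp only [chord]; push_cast; ring
    have hE2 : ‖fourier 1 t * (fourier 1 t - 1)‖ ≤ 2 := by
      rwa [norm_mul, norm_fourier_apply, one_mul]
    rw [e]
    refine (norm_add_le _ _).trans ?_
    linarith [norm_real_mul_le (by linarith [hx.2] : 0 ≤ 1 - x) hE,
      norm_real_mul_le (by linarith : 0 ≤ x + s - 1) hE2]

theorem norm_qpChord_sub_sub_le {x s : ℝ} (hx : x ∈ Set.Ioc (0 : ℝ) 1) (hs0 : 0 < s) (hs1 : s < 1)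
    (t : UnitAddCircle) : ‖qpChord (x - s) t - chord x t‖ ≤ 2 * s := by
  have hE := norm_one_sub_fourier_le_two 1 t
  rcases lt_or_ge 0 (x - s) with h | h
  · rw [qpChord_of_mem ⟨h, by linarith [hx.2]⟩]
    have e : chord (x - s) t - chord x t = (s : ℂ) * (-(fourier 1 t - 1)) := by
      simp only [chord]; push_cast; ring
    rw [e]
    linarith [norm_real_mul_le hs0.le ((norm_neg (fourier 1 t - 1)).trans_le hE)]
  · rw [qpChord_of_mem_Ioc_neg_one_zero ⟨by linarith [hx.1], h⟩]
    have e : 1 + (-((x - s : ℝ) : ℂ)) * (fourier (-1) t - 1) - chord x t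
        = ((s - x : ℝ) : ℂ) * (fourier (-1) t - 1) + (x : ℂ) * (-(fourier 1 t - 1)) := by
      simp only [chord]; push_cast; ring
    rw [e]
    refine (norm_add_le _ _).trans ?_
    linarith [norm_real_mul_le (by linarith : 0 ≤ s - x) (norm_one_sub_fourier_le_two (-1) t),
      norm_real_mul_le hx.1.le ((norm_neg (fourier 1 t - 1)).trans_le hE)]

theorem qpChord_second_difference_eq_zero {x s : ℝ} (hx : s < x) (hx1 : x + s ≤ 1) (hs0 : 0 < s)
    (t : UnitAddCircle) : qpChord (x + s) t + qpChord (x - s) t - 2 * chord x t = 0 := by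
  rw [qpChord_of_mem ⟨by linarith, hx1⟩, qpChord_of_mem ⟨by linarith, by linarith⟩]
  simp only [chord]
  push_cast
  ring

/-- The Poisson-type bump `s² / (s² + u²)`. -/
def bump (s u : ℝ) : ℝ := s ^ 2 / (s ^ 2 + u ^ 2)

theorem bump_nonneg (s u : ℝ) : 0 ≤ bump s u := by unfold bump; positivity

/-- A quantity which is bounded and `O(s² / max(u, v)²)` has square dominated by a product of two
bumps, each with integral `O(s)`. -/
theorem sq_le_mul_bump {D s u v : ℝ} (hs : 0 < s) (hD : 0 ≤ D) (hD4 : D ≤ 4)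
    (hu : D * u ^ 2 ≤ 210 * s ^ 2) (hv : D * v ^ 2 ≤ 210 * s ^ 2) :
    D ^ 2 ≤ 50000 * (bump s u * bump s v) := by
  have h1 : D * (s ^ 2 + u ^ 2) ≤ 214 * s ^ 2 := by nlinarith [sq_nonneg s]
  have h2 : D * (s ^ 2 + v ^ 2) ≤ 214 * s ^ 2 := by nlinarith [sq_nonneg s]
  have hu0 : 0 < s ^ 2 + u ^ 2 := by positivity
  have hv0 : 0 < s ^ 2 + v ^ 2 := by positivity
  rw [bump, bump, div_mul_div_comm, mul_div_assoc', le_div_iff₀ (by positivity)]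
  calc D ^ 2 * ((s ^ 2 + u ^ 2) * (s ^ 2 + v ^ 2))
      = (D * (s ^ 2 + u ^ 2)) * (D * (s ^ 2 + v ^ 2)) := by ring
    _ ≤ (214 * s ^ 2) * (214 * s ^ 2) := by gcongr
    _ ≤ 50000 * (s ^ 2 * s ^ 2) := by nlinarith [sq_nonneg (s ^ 2)]

theorem mul_sq_le_of_le_div {D r u s a : ℝ} (hr : 0 < r) (hu : 4 * u ^ 2 ≤ r ^ 2)
    (hD : 0 ≤ D) (h : D ≤ a * s ^ 2 / r ^ 2) (ha : a ≤ 840) : D * u ^ 2 ≤ 210 * s ^ 2 := by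
  rw [le_div_iff₀ (by positivity)] at h
  nlinarith [mul_le_mul_of_nonneg_left hu hD, mul_le_mul_of_nonneg_right ha (sq_nonneg s)]

/-- Second differences in the first variable. Along the chord the path is affine, so only the
quadratic error `s² / |chord|²` remains, whose square is integrable up to `O(s²)`; a first order
term `s / |chord|` would cost a factor `log (1 / s)`. -/
theorem second_difference_direction_chord_space {x y s : ℝ} (hx : x ∈ Set.Ioc (0 : ℝ) 1)
    (hy : y ∈ Set.Ioc (0 : ℝ) 1) (hs0 : 0 < s) (hs1 : s ≤ 1 / 4) :
    ‖direction (qpChord (x + s) y) + direction (qpChord (x - s) y)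
      - 2 * direction (chord x y)‖ ^ 2
      ≤ 50000 * (s ^ 2 + bump s (x - 1 / 2) * bump s (y - 1 / 2)) := by
  set D := ‖direction (qpChord (x + s) y) + direction (qpChord (x - s) y)
      - 2 * direction (chord x y)‖ with hDdef
  have hD0 : 0 ≤ D := norm_nonneg _
  have hD4 : D ≤ 4 := norm_second_difference_direction_le_four _ _ _
  have hux := four_mul_sq_le_norm_sq_chord_left hx y
  have huy := four_mul_sq_le_norm_sq_chord_right (x := x) hy
  have h1 := norm_qpChord_add_sub_le hx hs0 (by linarith) (y : UnitAddCircle)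
  have h2 := norm_qpChord_sub_sub_le hx hs0 (by linarith) (y : UnitAddCircle)
  have hb := mul_nonneg (bump_nonneg s (x - 1 / 2)) (bump_nonneg s (y - 1 / 2))
  rcases eq_or_ne (chord x (y : UnitAddCircle)) 0 with h0 | h0
  · rw [h0, norm_zero] at hux huy
    have := sq_le_mul_bump (u := x - 1 / 2) (v := y - 1 / 2) hs0 hD0 hD4 (by nlinarith)
      (by nlinarith)
    nlinarith [sq_nonneg s]
  have hr : 0 < ‖chord x (y : UnitAddCircle)‖ := norm_pos_iff.2 h0
  have hmain := norm_second_difference_direction_le h0 h1 h2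
  rw [← hDdef] at hmain
  by_cases hin : s < x ∧ x + s ≤ 1
  · rw [qpChord_second_difference_eq_zero hin.1 hin.2 hs0, norm_zero, zero_div, zero_add] at hmain
    have hmain' : D ≤ 64 * s ^ 2 / ‖chord x (y : UnitAddCircle)‖ ^ 2 := by
      refine hmain.trans (le_of_eq ?_); ring
    have := sq_le_mul_bump hs0 hD0 hD4 (mul_sq_le_of_le_div hr hux hD0 hmain' (by norm_num))
      (mul_sq_le_of_le_div hr huy hD0 hmain' (by norm_num))
    nlinarith [sq_nonneg s]
  · -- near the vertices of the path the chord stays away from `0`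
    have hr2 : 1 / 2 ≤ ‖chord x (y : UnitAddCircle)‖ := by
      have h3 : 1 / 16 ≤ (x - 1 / 2) ^ 2 := by
        rw [not_and_or, not_lt, not_le] at hin
        rcases hin with h | h <;> nlinarith
      by_contra hlt
      push Not at hlt
      nlinarith
    have h3 : ‖qpChord (x + s) y + qpChord (x - s) y - 2 * chord x y‖ ≤ 4 * s := by
      have e : qpChord (x + s) y + qpChord (x - s) y - 2 * chord x (y : UnitAddCircle)
          = (qpChord (x + s) y - chord x y) + (qpChord (x - s) y - chord x y) := by ring
      rw [e]
      linarith [norm_add_le (qpChord (x + s) y - chord x (y : UnitAddCircle))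
        (qpChord (x - s) y - chord x y)]
    have h4 : D ≤ 72 * s := by
      have a1 : ‖qpChord (x + s) y + qpChord (x - s) y - 2 * chord x (y : UnitAddCircle)‖
          / ‖chord x (y : UnitAddCircle)‖ ≤ 8 * s := by
        rw [div_le_iff₀ hr]; nlinarith
      have a2 : 16 * (2 * s) ^ 2 / ‖chord x (y : UnitAddCircle)‖ ^ 2 ≤ 64 * s := by
        rw [div_le_iff₀ (by positivity)]
        nlinarith [mul_le_mul hr2 hr2 (by norm_num) hr.le, mul_pos hs0 hs0]
      linarith
    nlinarith [sq_nonneg s]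

theorem chord_add (x : ℝ) (t a : UnitAddCircle) :
    chord x (t + a) - chord x t = x * (fourier 1 t * (fourier 1 a - 1)) := by
  simp only [chord, fourier_add_apply]
  ring

theorem norm_fourier_sub_one_le (s : ℝ) {n : ℤ} (hn : n = 1 ∨ n = -1) :
    ‖fourier n (s : UnitAddCircle) - 1‖ ≤ 7 * |s| := by
  have h1 : ‖1 - fourier 1 (s : UnitAddCircle)‖ ≤ 7 * |s| := by
    refine (norm_one_sub_fourier_one_le _).trans ?_
    have h2 : ‖(s : UnitAddCircle)‖ ≤ |s| := by
      rw [UnitAddCircle.norm_eq]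
      simpa using round_le s 0
    have h3 : 2 * Real.pi ≤ 7 := by linarith [Real.pi_lt_d2]
    gcongr
  rcases hn with rfl | rfl
  · rwa [norm_sub_rev]
  · rw [fourier_neg, ← map_one (starRingEnd ℂ), ← map_sub, RCLike.norm_conj, norm_sub_rev]
    exact h1

/-- Second differences in the second variable, in which the chord is smooth. -/
theorem second_difference_direction_chord_freq {x y s : ℝ} (hx : x ∈ Set.Ioc (0 : ℝ) 1)
    (hy : y ∈ Set.Ioc (0 : ℝ) 1) (hs0 : 0 < s) :
    ‖direction (chord x (y + (s : UnitAddCircle))) + direction (chord x (y - (s : UnitAddCircle)))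
      - 2 * direction (chord x y)‖ ^ 2
      ≤ 50000 * (bump s (x - 1 / 2) * bump s (y - 1 / 2)) := by
  set D := ‖direction (chord x (y + (s : UnitAddCircle)))
    + direction (chord x (y - (s : UnitAddCircle))) - 2 * direction (chord x y)‖ with hDdef
  have hD0 : 0 ≤ D := norm_nonneg _
  have hD4 : D ≤ 4 := norm_second_difference_direction_le_four _ _ _
  have hux := four_mul_sq_le_norm_sq_chord_left hx y
  have huy := four_mul_sq_le_norm_sq_chord_right (x := x) hy
  rcases eq_or_ne (chord x (y : UnitAddCircle)) 0 with h0 | h0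
  · rw [h0, norm_zero] at hux huy
    exact sq_le_mul_bump hs0 hD0 hD4 (by nlinarith) (by nlinarith)
  have hr : 0 < ‖chord x (y : UnitAddCircle)‖ := norm_pos_iff.2 h0
  have hr1 := norm_chord_le_one hx (y : UnitAddCircle)
  have e1 : fourier 1 (-(s : UnitAddCircle)) = fourier (-1) (s : UnitAddCircle) := by
    simp [fourier_apply]
  have f1 := norm_fourier_sub_one_le s (n := 1) (Or.inl rfl)
  have f2 := norm_fourier_sub_one_le s (n := -1) (Or.inr rfl)
  rw [abs_of_pos hs0] at f1 f2
  have hstep : ∀ a : UnitAddCircle, ‖fourier 1 a - 1‖ ≤ 7 * s →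
      ‖chord x (y + a) - chord x y‖ ≤ 7 * s := fun a ha => by
    rw [chord_add]
    refine (norm_real_mul_le hx.1.le (b := 7 * s) ?_).trans (by nlinarith [hx.2])
    rwa [norm_mul, norm_fourier_apply, one_mul]
  have h1 := hstep (s : UnitAddCircle) f1
  have h2 := hstep (-(s : UnitAddCircle)) (by rwa [e1])
  rw [← sub_eq_add_neg] at h2
  have hmain := norm_second_difference_direction_le h0 h1 h2
  rw [← hDdef] at hmain
  have h3 : ‖chord x (y + (s : UnitAddCircle)) + chord x (y - (s : UnitAddCircle))
      - 2 * chord x (y : UnitAddCircle)‖ ≤ 49 * s ^ 2 := by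
    have h11 : fourier 1 (s : UnitAddCircle) * fourier (-1) (s : UnitAddCircle) = 1 := by
      rw [← fourier_add]; simp
    have e : chord x (y + (s : UnitAddCircle)) + chord x (y - (s : UnitAddCircle))
        - 2 * chord x (y : UnitAddCircle) = x * (fourier 1 (y : UnitAddCircle) *
          -((fourier 1 (s : UnitAddCircle) - 1) * (fourier (-1) (s : UnitAddCircle) - 1))) := by
      have a1 := chord_add x (y : UnitAddCircle) (s : UnitAddCircle)
      have a2 := chord_add x (y : UnitAddCircle) (-(s : UnitAddCircle))
      rw [e1, ← sub_eq_add_neg] at a2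
      linear_combination a1 + a2 + x * fourier 1 (y : UnitAddCircle) * h11
    rw [e]
    refine (norm_real_mul_le hx.1.le (b := 49 * s ^ 2) ?_).trans
      (by nlinarith [hx.2, sq_nonneg s])
    rw [norm_mul, norm_fourier_apply, one_mul, norm_neg, norm_mul]
    nlinarith [norm_nonneg (fourier 1 (s : UnitAddCircle) - 1),
      norm_nonneg (fourier (-1) (s : UnitAddCircle) - 1)]
  have hmain' : D ≤ 833 * s ^ 2 / ‖chord x (y : UnitAddCircle)‖ ^ 2 := by
    refine hmain.trans ?_
    rw [div_add_div _ _ hr.ne' (by positivity), div_le_div_iff₀ (by positivity) (by positivity)]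
    set r := ‖chord x (y : UnitAddCircle)‖
    set T := ‖chord x (y + (s : UnitAddCircle)) + chord x (y - (s : UnitAddCircle))
      - 2 * chord x (y : UnitAddCircle)‖
    have hT : T * r ≤ 49 * s ^ 2 := by
      have : 0 ≤ T := norm_nonneg _
      nlinarith
    have : T * r * r ^ 3 ≤ 49 * s ^ 2 * r ^ 3 := by gcongr
    nlinarith
  exact sq_le_mul_bump hs0 hD0 hD4 (mul_sq_le_of_le_div hr hux hD0 hmain' (by norm_num))
    (mul_sq_le_of_le_div hr huy hD0 hmain' (by norm_num))

end

/-! ### From second differences to tails -/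

noncomputable section

open AddCircle

variable {d : ℕ}

theorem haarAddCircle_eq_volume : (haarAddCircle : Measure UnitAddCircle) = volume := by
  simp [AddCircle.volume_eq_smul_haarAddCircle]

theorem lintegral_haarAddCircle {φ : UnitAddCircle → ℝ≥0∞} (hφ : Measurable φ) :
    ∫⁻ t, φ t ∂haarAddCircle = ∫⁻ y in Set.Ioc (0 : ℝ) 1, φ (y : UnitAddCircle) := by
  have hm := AddCircle.measurePreserving_mk (1 : ℝ) 0
  rw [zero_add] at hm
  rw [haarAddCircle_eq_volume, ← hm.lintegral_comp hφ]

theorem lintegral_bump {s : ℝ} (hs : 0 < s) (a : ℝ) :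
    ∫⁻ u, ENNReal.ofReal (bump s (u - a)) = ENNReal.ofReal (Real.pi * s) := by
  have h1 : ∀ u, bump s (u - a) = (1 + ((u - a) / s) ^ 2)⁻¹ := fun u => by
    rw [bump]
    field_simp
  have hi : Integrable fun u => bump s (u - a) := by
    simp_rw [h1]
    exact (integrable_inv_one_add_sq.comp_div hs.ne').comp_sub_right a
  rw [← ofReal_integral_eq_lintegral_ofReal hi (ae_of_all _ fun u => bump_nonneg _ _)]
  congr 1
  simp_rw [h1]
  rw [integral_sub_right_eq_self (fun u => (1 + (u / s) ^ 2)⁻¹) a,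
    Measure.integral_comp_div (fun u => (1 + u ^ 2)⁻¹) s, integral_univ_inv_one_add_sq,
    abs_of_pos hs, smul_eq_mul, mul_comm]

theorem measurable_bump (s : ℝ) : Measurable (bump s) := by
  unfold bump
  fun_prop

theorem measurePreserving_coord (i : Fin d) :
    MeasurePreserving (fun p : RSpace d × UnitAddTorus (Fin d) => (p.1 i, p.2 i)) (zakMeasure d)
      ((volume.restrict (Set.Ioc (0 : ℝ) 1)).prod haarAddCircle) := by
  have : IsProbabilityMeasure (volume.restrict (Set.Ioc (0 : ℝ) 1)) := ⟨by simp⟩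
  have h1 : MeasurePreserving (fun x : RSpace d => x i) (cubeMeasure d)
      (volume.restrict (Set.Ioc (0 : ℝ) 1)) := by
    have h2 := measurePreserving_toLp_restrict fun _ : Fin d => Set.Ioc (0 : ℝ) 1
    have h3 := measurePreserving_eval (fun _ : Fin d => volume.restrict (Set.Ioc (0 : ℝ) 1)) i
    refine ⟨by fun_prop, ?_⟩
    have h4 : cubeMeasure d = volume.restrict {x : RSpace d | ∀ j, x j ∈ Set.Ioc (0 : ℝ) 1} := rfl
    rw [h4, ← h2.map_eq, Measure.map_map (by fun_prop) h2.measurable]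
    exact h3.map_eq
  exact h1.prod (measurePreserving_eval _ i)

/-- A function on `(0,1] × 𝕋` dominated by `s²` plus a product of bumps has integral `O(s²)`. -/
theorem lintegral_le_of_le_bump {h : ℝ → UnitAddCircle → ℂ}
    (hm : Measurable fun p : ℝ × UnitAddCircle => h p.1 p.2) {s : ℝ} (hs : 0 < s)
    (hb : ∀ x ∈ Set.Ioc (0 : ℝ) 1, ∀ y ∈ Set.Ioc (0 : ℝ) 1, ‖h x (y : UnitAddCircle)‖ ^ 2
      ≤ 50000 * (s ^ 2 + bump s (x - 1 / 2) * bump s (y - 1 / 2))) (i : Fin d) :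
    ∫⁻ p, ‖h (p.1 i) (p.2 i)‖ₑ ^ 2 ∂zakMeasure d ≤ ENNReal.ofReal (1000000 * s ^ 2) := by
  have hm2 : Measurable fun p : ℝ × UnitAddCircle => ‖h p.1 p.2‖ₑ ^ 2 := hm.enorm.pow_const 2
  have e1 := (measurePreserving_coord i).lintegral_comp hm2
  rw [e1, lintegral_prod _ hm2.aemeasurable]
  have hB := fun a => lintegral_bump hs a
  have hmb : Measurable fun u : ℝ => ENNReal.ofReal (bump s (u - 1 / 2)) :=
    ((measurable_bump s).comp (measurable_id.sub_const _)).ennreal_ofReal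
  have hIoc : ∫⁻ u in Set.Ioc (0 : ℝ) 1, ENNReal.ofReal (bump s (u - 1 / 2))
      ≤ ENNReal.ofReal (Real.pi * s) := (setLIntegral_le_lintegral _ _).trans (hB _).le
  calc ∫⁻ x in Set.Ioc (0 : ℝ) 1, ∫⁻ t, ‖h x t‖ₑ ^ 2 ∂haarAddCircle
      = ∫⁻ x in Set.Ioc (0 : ℝ) 1, ∫⁻ y in Set.Ioc (0 : ℝ) 1, ‖h x (y : UnitAddCircle)‖ₑ ^ 2 := by
        refine lintegral_congr fun x => ?_
        exact lintegral_haarAddCircle (hm2.comp measurable_prodMk_left)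
    _ ≤ ∫⁻ x in Set.Ioc (0 : ℝ) 1, ∫⁻ y in Set.Ioc (0 : ℝ) 1, 50000 * (ENNReal.ofReal (s ^ 2)
          + ENNReal.ofReal (bump s (x - 1 / 2)) * ENNReal.ofReal (bump s (y - 1 / 2))) := by
        refine setLIntegral_mono' measurableSet_Ioc fun x hx => ?_
        refine setLIntegral_mono' measurableSet_Ioc fun y hy => ?_
        rw [← ofReal_norm, ← ENNReal.ofReal_pow (norm_nonneg _),
          ← ENNReal.ofReal_mul (bump_nonneg _ _), ← ENNReal.ofReal_add (by positivity)
            (mul_nonneg (bump_nonneg _ _) (bump_nonneg _ _)),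
          show (50000 : ℝ≥0∞) = ENNReal.ofReal 50000 by norm_num,
          ← ENNReal.ofReal_mul (by norm_num)]
        exact ENNReal.ofReal_le_ofReal (hb x hx y hy)
    _ = 50000 * (ENNReal.ofReal (s ^ 2)
          + (∫⁻ x in Set.Ioc (0 : ℝ) 1, ENNReal.ofReal (bump s (x - 1 / 2)))
            * ∫⁻ y in Set.Ioc (0 : ℝ) 1, ENNReal.ofReal (bump s (y - 1 / 2))) := by
        have h1 : ∀ x : ℝ, ∫⁻ y in Set.Ioc (0 : ℝ) 1, 50000 * (ENNReal.ofReal (s ^ 2)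
            + ENNReal.ofReal (bump s (x - 1 / 2)) * ENNReal.ofReal (bump s (y - 1 / 2)))
            = 50000 * (ENNReal.ofReal (s ^ 2) + ENNReal.ofReal (bump s (x - 1 / 2))
              * ∫⁻ y in Set.Ioc (0 : ℝ) 1, ENNReal.ofReal (bump s (y - 1 / 2))) := fun x => by
          rw [lintegral_const_mul' _ _ (by norm_num), lintegral_add_left measurable_const,
            lintegral_const_mul' _ _ ENNReal.ofReal_ne_top]
          simp
        simp_rw [h1]
        rw [lintegral_const_mul' _ _ (by norm_num), lintegral_add_left measurable_const,
          lintegral_mul_const _ hmb]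
        simp
    _ ≤ 50000 * (ENNReal.ofReal (s ^ 2)
          + ENNReal.ofReal (Real.pi * s) * ENNReal.ofReal (Real.pi * s)) := by gcongr
    _ = ENNReal.ofReal (50000 * (s ^ 2 + (Real.pi * s) * (Real.pi * s))) := by
        rw [← ENNReal.ofReal_mul (by positivity), ← ENNReal.ofReal_add (by positivity)
          (by positivity), show (50000 : ℝ≥0∞) = ENNReal.ofReal 50000 by norm_num,
          ← ENNReal.ofReal_mul (by norm_num)]
    _ ≤ ENNReal.ofReal (1000000 * s ^ 2) := by
        refine ENNReal.ofReal_le_ofReal ?_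
        have : Real.pi ^ 2 ≤ 10 := by nlinarith [Real.pi_lt_d2, Real.pi_pos]
        nlinarith [mul_le_mul_of_nonneg_right this (sq_nonneg s), sq_nonneg s]

/-- The coefficients of the second difference operator. -/
def secondDifference (j : ℤ) : ℂ := if j = 0 then -2 else if j = 1 ∨ j = -1 then 1 else 0

theorem secondDifference_eq_zero {j : ℤ} (hj : j ∉ ({0, 1, -1} : Finset ℤ)) :
    secondDifference j = 0 := by
  simp only [Finset.mem_insert, Finset.mem_singleton, not_or] at hj
  simp [secondDifference, hj]

theorem summable_norm_secondDifference : Summable fun j => ‖secondDifference j‖ :=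
  summable_of_ne_finset_zero (s := {0, 1, -1}) fun j hj => by
    rw [secondDifference_eq_zero hj, norm_zero]

theorem tsum_secondDifference_mul (φ : ℤ → ℂ) :
    ∑' j, secondDifference j * φ j = φ 1 + φ (-1) - 2 * φ 0 := by
  rw [tsum_eq_sum (s := {0, 1, -1}) fun j hj => by rw [secondDifference_eq_zero hj, zero_mul],
    Finset.sum_insert (by simp), Finset.sum_insert (by simp), Finset.sum_singleton]
  simp [secondDifference]
  ring

/-- The symbol is `-4 sin² (πθ)`. -/
theorem two_le_norm_symbol_secondDifference {θ : ℝ} (h1 : 1 / 4 ≤ |θ|) (h2 : |θ| ≤ 1 / 2) :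
    2 ≤ ‖symbol secondDifference θ‖ := by
  have e : symbol secondDifference θ = ((2 * Real.cos (2 * Real.pi * θ) - 2 : ℝ) : ℂ) := by
    rw [symbol, tsum_secondDifference_mul]
    push_cast
    rw [Complex.cos]
    simp only [one_mul, zero_mul, mul_zero, neg_zero, Complex.exp_zero, neg_mul, mul_neg, neg_neg]
    ring_nf
  have hc : Real.cos (2 * Real.pi * θ) ≤ 0 := by
    rw [← Real.cos_abs, abs_mul, abs_of_pos Real.two_pi_pos]
    refine Real.cos_nonpos_of_pi_div_two_le_of_le ?_ ?_ <;> nlinarith [Real.pi_pos]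
  rw [e, Complex.norm_real, Real.norm_eq_abs, abs_of_nonpos (by linarith)]
  linarith

/-- Bounds on second differences at all small scales control the tail, by summation over dyadic
shells. -/
theorem lintegral_tail_le_of_secondDifference {ψ : RSpace d → ℝ≥0∞} {h : RSpace d → ℝ}
    (hh : Measurable h) {K : ℝ} (hK : 0 ≤ K)
    (hb : ∀ s : ℝ, 0 < s → s ≤ 1 / 4 →
      ∫⁻ x, ‖symbol secondDifference (s * h x)‖ₑ ^ 2 * ψ x ≤ ENNReal.ofReal (K * s ^ 2))
    {R : ℝ} (hR : 1 ≤ R) :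
    ∫⁻ x in {x | R ≤ |h x|}, ψ x ≤ ENNReal.ofReal (K / R ^ 2) := by
  have hR0 : 0 < R := by linarith
  set S : ℕ → Set (RSpace d) := fun k => {x | R * 2 ^ k ≤ |h x| ∧ |h x| ≤ R * 2 ^ (k + 1)} with hS
  have hSm : ∀ k, MeasurableSet (S k) := fun k =>
    (measurableSet_le measurable_const hh.abs).inter (measurableSet_le hh.abs measurable_const)
  have hcov : {x | R ≤ |h x|} ⊆ ⋃ k, S k := by
    intro x hx
    have h1 : 1 ≤ |h x| / R := by rw [le_div_iff₀ hR0]; simpa using hx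
    obtain ⟨k, hk1, hk2⟩ := exists_nat_pow_near h1 (by norm_num : (1 : ℝ) < 2)
    refine Set.mem_iUnion.2 ⟨k, ?_, ?_⟩
    · rw [le_div_iff₀ hR0] at hk1; linarith
    · rw [div_lt_iff₀ hR0] at hk2; linarith
  have hshell : ∀ k, ∫⁻ x in S k, ψ x ≤ ENNReal.ofReal (K / (64 * R ^ 2) * (1 / 4) ^ k) := by
    intro k
    -- the scale at which the shell is mapped to `[1/4, 1/2]`
    set s : ℝ := 1 / (4 * R * 2 ^ k) with hs
    have hp : (1 : ℝ) ≤ 2 ^ k := one_le_pow₀ (by norm_num)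
    have hs0 : 0 < s := by positivity
    have hs1 : s ≤ 1 / 4 := by
      rw [hs]
      refine one_div_le_one_div_of_le (by norm_num) ?_
      nlinarith
    have h4 : 4 * ∫⁻ x in S k, ψ x ≤ ENNReal.ofReal (K * s ^ 2) := by
      refine le_trans ?_ (hb s hs0 hs1)
      rw [← lintegral_const_mul' _ _ (by norm_num)]
      refine le_trans ?_ (setLIntegral_le_lintegral (S k) _)
      refine setLIntegral_mono' (hSm k) fun x hx => ?_
      gcongr
      have a1 : 1 / 4 ≤ |s * h x| := by
        rw [abs_mul, abs_of_pos hs0, hs]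
        have := hx.1
        rw [one_div_mul_eq_div, le_div_iff₀ (by positivity)]
        linarith
      have a2 : |s * h x| ≤ 1 / 2 := by
        rw [abs_mul, abs_of_pos hs0, hs]
        have := hx.2
        rw [pow_succ] at this
        rw [one_div_mul_eq_div, div_le_iff₀ (by positivity)]
        linarith
      have a3 := two_le_norm_symbol_secondDifference a1 a2
      have a4 : (2 : ℝ≥0∞) ≤ ‖symbol secondDifference (s * h x)‖ₑ := by
        rw [← ofReal_norm]
        exact ENNReal.ofNat_le_ofReal.2 a3
      calc (4 : ℝ≥0∞) = 2 ^ 2 := by norm_num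
        _ ≤ _ := by gcongr
    have h5 : ENNReal.ofReal (K * s ^ 2)
        = 4 * ENNReal.ofReal (K / (64 * R ^ 2) * (1 / 4) ^ k) := by
      rw [show (4 : ℝ≥0∞) = ENNReal.ofReal 4 by norm_num, ← ENNReal.ofReal_mul (by norm_num)]
      congr 1
      have : ((1 : ℝ) / 4) ^ k = 1 / (2 ^ k) ^ 2 := by
        rw [one_div_pow, ← pow_mul, mul_comm, pow_mul]; norm_num
      rw [hs, this]
      field_simp
      norm_num
    rw [h5] at h4
    exact (ENNReal.mul_le_mul_iff_right (by norm_num) (by norm_num)).1 h4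
  calc ∫⁻ x in {x | R ≤ |h x|}, ψ x ≤ ∫⁻ x in ⋃ k, S k, ψ x := lintegral_mono_set hcov
    _ ≤ ∑' k, ∫⁻ x in S k, ψ x := lintegral_iUnion_le _ _
    _ ≤ ∑' k : ℕ, ENNReal.ofReal (K / (64 * R ^ 2) * (1 / 4) ^ k) := ENNReal.tsum_le_tsum hshell
    _ = ENNReal.ofReal (K / (64 * R ^ 2) * (1 - 1 / 4)⁻¹) := by
        rw [← ENNReal.ofReal_tsum_of_nonneg (fun k => by positivity)
          ((summable_geometric_of_lt_one (by norm_num) (by norm_num)).mul_left _), tsum_mul_left,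
          tsum_geometric_of_lt_one (by norm_num) (by norm_num)]
    _ ≤ ENNReal.ofReal (K / R ^ 2) := by
        refine ENNReal.ofReal_le_ofReal ?_
        have : K / (64 * R ^ 2) * (1 - 1 / 4)⁻¹ = K / R ^ 2 * (1 / 48) := by
          field_simp; ring
        rw [this]
        have : 0 ≤ K / R ^ 2 := by positivity
        linarith

end

/-! ### The extremal window -/

noncomputable section

open AddCircle UnitAddTorus

variable {d : ℕ}

/-- The Zak transform of the extremal window: the direction of the chord from `1` to `e^{2πi t}`. It
is unimodular except at `x = t = 1/2`, where its value is `0`. -/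
def chordPhase (x : ℝ) (t : UnitAddCircle) : ℂ := direction (chord x t)

theorem measurable_chordPhase : Measurable fun p : ℝ × UnitAddCircle => chordPhase p.1 p.2 :=
  measurable_direction.comp continuous_chord.measurable

theorem norm_chordPhase_le (x : ℝ) (t : UnitAddCircle) : ‖chordPhase x t‖ ≤ 1 :=
  norm_direction_le _

/-- The extremal window: on `(0,1] - k` its values are the `k`-th Fourier coefficients of
`chordPhase` in the second variable. -/
def extremalWindow (x : ℝ) : ℂ :=
  fourierCoeff (fun t => chordPhase (x - ((⌈x⌉ - 1 : ℤ) : ℝ)) t) (1 - ⌈x⌉)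

theorem extremalWindow_sub {x : ℝ} (hx : x ∈ Set.Ioc (0 : ℝ) 1) (k : ℤ) :
    extremalWindow (x - k) = fourierCoeff (fun t => chordPhase x t) k := by
  have h1 : ⌈x⌉ = 1 := Int.ceil_eq_iff.2 (by simpa using hx)
  have h2 : ⌈x - (k : ℝ)⌉ = 1 - k := by rw [Int.ceil_sub_intCast, h1]
  rw [extremalWindow, h2]
  congr 1
  · ext t
    congr 1
    push_cast
    ring
  · ring

theorem measurable_extremalWindow : Measurable extremalWindow := by
  have h1 : ∀ n : ℤ, Measurable fun x : ℝ => fourierCoeff (fun t => chordPhase x t) n := by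
    intro n
    have : StronglyMeasurable fun p : ℝ × UnitAddCircle => fourier (-n) p.2 * chordPhase p.1 p.2 :=
      ((((fourier (T := 1) (-n)).continuous.comp continuous_snd).measurable).mul
        measurable_chordPhase).stronglyMeasurable
    have h2 := (this.integral_prod_right' (ν := haarAddCircle)).measurable
    simpa only [fourierCoeff, smul_eq_mul] using h2
  have h2 : Measurable fun q : ℤ × ℝ => fourierCoeff (fun t => chordPhase q.2 t) q.1 :=
    measurable_from_prod_countable_right h1
  have h3 : Measurable fun x : ℝ => ((1 - ⌈x⌉ : ℤ), x - ((⌈x⌉ - 1 : ℤ) : ℝ)) := by fun_prop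
  have h4 := h2.comp h3
  unfold extremalWindow
  exact h4

/-- The tensor power of `extremalWindow`. -/
def tensorWindow (x : RSpace d) : ℂ := ∏ j, extremalWindow (x j)

/-- The tensor power of `chordPhase`. -/
def tensorPhase (p : RSpace d × UnitAddTorus (Fin d)) : ℂ := ∏ j, chordPhase (p.1 j) (p.2 j)

theorem measurable_tensorWindow : Measurable (tensorWindow (d := d)) :=
  Finset.measurable_fun_prod _ fun j _ => measurable_extremalWindow.comp (by fun_prop)

theorem stronglyMeasurable_tensorPhase : StronglyMeasurable (tensorPhase (d := d)) := by
  refine (Finset.measurable_fun_prod _ fun j _ => ?_).stronglyMeasurable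
  have : Measurable fun p : RSpace d × UnitAddTorus (Fin d) => (p.1 j, p.2 j) := by fun_prop
  exact measurable_chordPhase.comp this

theorem norm_tensorPhase_le (p : RSpace d × UnitAddTorus (Fin d)) : ‖tensorPhase p‖ ≤ 1 := by
  rw [tensorPhase, norm_prod]
  exact Finset.prod_le_one (fun j _ => norm_nonneg _) fun j _ => norm_chordPhase_le _ _

theorem isZak_tensorWindow : IsZak (tensorWindow (d := d)) tensorPhase := by
  refine ⟨stronglyMeasurable_tensorPhase.aestronglyMeasurable, ?_⟩
  filter_upwards [ae_restrict_mem measurableSet_unitCube] with x hx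
  refine ⟨MemLp.of_bound (stronglyMeasurable_tensorPhase.comp_measurable
    measurable_prodMk_left).aestronglyMeasurable 1 (ae_of_all _ fun y => norm_tensorPhase_le _),
    fun k => ?_⟩
  have h1 : ∀ t : UnitAddTorus (Fin d), mFourier (-k) t * tensorPhase (x, t)
      = ∏ j, fourier (-k j) (t j) * chordPhase (x j) (t j) := fun t => by
    rw [Finset.prod_mul_distrib]; rfl
  simp only [torusCoeff, h1]
  rw [torusMeasure, integral_fintype_prod_eq_prod (f := fun j (t : UnitAddCircle) =>
    fourier (-k j) t * chordPhase (x j) t), tensorWindow]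
  refine Finset.prod_congr rfl fun j _ => ?_
  rw [PiLp.sub_apply, latticePoint_apply, extremalWindow_sub (hx j)]
  simp [fourierCoeff]

theorem memLp_tensorWindow : MemLp (tensorWindow (d := d)) 2 volume := by
  rw [memLp_two_iff measurable_tensorWindow.aestronglyMeasurable,
    ← isZak_tensorWindow.lintegral_eq measurable_tensorWindow.aestronglyMeasurable,
    ← memLp_two_iff stronglyMeasurable_tensorPhase.aestronglyMeasurable]
  exact MemLp.of_bound stronglyMeasurable_tensorPhase.aestronglyMeasurable 1
    (ae_of_all _ norm_tensorPhase_le)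

theorem memLp_extremalWindow : MemLp extremalWindow 2 volume := by
  have h1 : MeasurePreserving (fun x : ℝ => (WithLp.toLp 2 fun _ => x : RSpace 1)) :=
    (PiLp.volume_preserving_toLp (Fin 1)).comp (volume_preserving_funUnique (Fin 1) ℝ).symm
  have h2 := (memLp_tensorWindow (d := 1)).comp_measurePreserving h1
  have e : (tensorWindow ∘ fun x : ℝ => (WithLp.toLp 2 fun _ => x : RSpace 1))
      = extremalWindow := by
    funext x
    simp [tensorWindow]
  rwa [e] at h2

theorem ae_norm_chordPhase :
    ∀ᵐ q ∂(volume.restrict (Set.Ioc (0 : ℝ) 1)).prod (haarAddCircle : Measure UnitAddCircle),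
      ‖chordPhase q.1 q.2‖ = 1 := by
  have h1 : ∀ᵐ x ∂volume.restrict (Set.Ioc (0 : ℝ) 1), x ∈ Set.Ioc (0 : ℝ) 1 ∧ x ≠ 1 / 2 := by
    filter_upwards [ae_restrict_mem measurableSet_Ioc,
      ae_restrict_of_ae (Measure.ae_ne volume (1 / 2 : ℝ))] with x hx hx2
    exact ⟨hx, hx2⟩
  filter_upwards [Measure.quasiMeasurePreserving_fst.ae h1] with q hq
  exact norm_direction (chord_ne_zero hq.1 hq.2 _)

theorem ae_norm_tensorPhase : ∀ᵐ p ∂zakMeasure d, ‖tensorPhase p‖ = 1 := by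
  have h : ∀ᵐ p ∂zakMeasure d, ∀ j, ‖chordPhase (p.1 j) (p.2 j)‖ = 1 := ae_all_iff.2 fun j =>
    (measurePreserving_coord j).quasiMeasurePreserving.ae ae_norm_chordPhase
  filter_upwards [h] with p hp
  rw [tensorPhase, norm_prod]
  exact Finset.prod_eq_one fun j _ => hp j

/-- The Zak series of `g` converges in mean square. -/
theorem IsZak.tendsto_lintegral_sub_sum {g : RSpace d → ℂ}
    {F : RSpace d × UnitAddTorus (Fin d) → ℂ} (h : IsZak g F) (hg : MemLp g 2 volume) :
    Tendsto (fun s : Finset (Fin d → ℤ) => ∫⁻ p, ‖F p - ∑ k ∈ s,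
      g (p.1 - latticePoint k) * mFourier k p.2‖ₑ ^ 2 ∂zakMeasure d) atTop (𝓝 0) := by
  have hmk : ∀ k : Fin d → ℤ, AEMeasurable (fun x => ‖g (x - latticePoint k)‖ₑ ^ 2)
      (cubeMeasure d) := fun k =>
    (((hg.1.comp_measurePreserving (measurePreserving_sub_right volume (latticePoint k))
      ).enorm.pow_const 2).restrict)
  have e : ∀ s : Finset (Fin d → ℤ), ∫⁻ p, ‖F p - ∑ k ∈ s,
      g (p.1 - latticePoint k) * mFourier k p.2‖ₑ ^ 2 ∂zakMeasure d
      = ∑' k : {k // k ∉ s}, ∫⁻ x, ‖g (x - latticePoint k)‖ₑ ^ 2 ∂cubeMeasure d := by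
    intro s
    have hm : AEStronglyMeasurable (fun p : RSpace d × UnitAddTorus (Fin d) => F p - ∑ k ∈ s,
        g (p.1 - latticePoint k) * mFourier k p.2) (zakMeasure d) :=
      h.aesm.sub (memLp_finsetSum s fun k _ => memLp_zakTerm hg k).1
    rw [lintegral_zakMeasure (hm.enorm.pow_const 2), ← lintegral_tsum fun k : {k // k ∉ s} => hmk k]
    refine lintegral_congr_ae ?_
    filter_upwards [h.slice] with x hx
    have := lintegral_enorm_sq_sub_partialSum hx.1 s
    simp_rw [hx.2] at this
    exact this
  simp_rw [e]
  refine ENNReal.tendsto_tsum_compl_atTop_zero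
    (f := fun k => ∫⁻ x, ‖g (x - latticePoint k)‖ₑ ^ 2 ∂cubeMeasure d) ?_
  rw [← lintegral_eq_tsum_cube fun x => ‖g x‖ₑ ^ 2]
  exact ((memLp_two_iff hg.1).1 hg).ne

theorem measurePreserving_unitSquare :
    MeasurePreserving (fun p : ℝ × ℝ => (p.1, (p.2 : UnitAddCircle)))
      (volume.restrict unitSquare)
      ((volume.restrict (Set.Ioc (0 : ℝ) 1)).prod haarAddCircle) := by
  have h1 : volume.restrict unitSquare
      = (volume.restrict (Set.Ioc (0 : ℝ) 1)).prod (volume.restrict (Set.Ioc (0 : ℝ) 1)) := by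
    rw [unitSquare, Measure.volume_eq_prod, ← Measure.prod_restrict,
      Measure.restrict_congr_set Ioc_ae_eq_Icc]
  have hm := AddCircle.measurePreserving_mk (1 : ℝ) 0
  rw [zero_add, ← haarAddCircle_eq_volume] at hm
  rw [h1]
  exact (MeasurePreserving.id _).prod hm

theorem isZakTransform_extremalWindow :
    IsZakTransform extremalWindow (fun p => chordPhase p.1 (p.2 : UnitAddCircle)) := by
  have hmp := measurePreserving_unitSquare
  have hz : AEStronglyMeasurable (fun p : ℝ × ℝ => chordPhase p.1 (p.2 : UnitAddCircle))
      (volume.restrict unitSquare) :=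
    (measurable_chordPhase.comp hmp.measurable).aestronglyMeasurable
  have hfin : IsFiniteMeasure (volume.restrict unitSquare) :=
    ⟨by rw [Measure.restrict_apply_univ]
        exact (isCompact_Icc.prod isCompact_Icc).measure_lt_top⟩
  refine ⟨MemLp.of_bound hz 1 (ae_of_all _ fun p => norm_chordPhase_le _ _), ?_⟩
  -- the series over `ℤ` is the Zak series in dimension one
  let e : ℤ ≃ (Fin 1 → ℤ) := (Equiv.funUnique (Fin 1) ℤ).symm
  have htend : Tendsto (fun s : Finset ℤ => s.map e.toEmbedding) atTop atTop := by
    refine tendsto_atTop_finset_of_monotone (fun s t hst => Finset.map_subset_map.2 hst) fun k => ?_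
    exact ⟨{e.symm k}, by simp⟩
  have h0 := ((isZak_tensorWindow (d := 1)).tendsto_lintegral_sub_sum memLp_tensorWindow).comp htend
  have hsq : ∀ s : Finset ℤ, eLpNorm (fun p : ℝ × ℝ => (∑ k ∈ s, extremalWindow (p.1 - k)
      * Complex.exp (2 * Real.pi * Complex.I * k * p.2)) - chordPhase p.1 (p.2 : UnitAddCircle))
        2 (volume.restrict unitSquare) ^ 2
      = ∫⁻ p, ‖tensorPhase p - ∑ k ∈ s.map e.toEmbedding,
        tensorWindow (p.1 - latticePoint k) * mFourier k p.2‖ₑ ^ 2 ∂zakMeasure 1 := by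
    intro s
    have hΦ : Measurable fun q : ℝ × UnitAddCircle =>
        (∑ k ∈ s, extremalWindow (q.1 - k) * fourier k q.2) - chordPhase q.1 q.2 := by
      refine (Finset.measurable_fun_sum _ fun k _ => ?_).sub measurable_chordPhase
      exact (measurable_extremalWindow.comp (measurable_fst.sub_const _)).mul
        ((fourier (T := 1) k).continuous.measurable.comp measurable_snd)
    have hΦ2 := hΦ.enorm.pow_const 2
    rw [eLpNorm_two_sq]
    calc ∫⁻ p in unitSquare, ‖(∑ k ∈ s, extremalWindow (p.1 - k)
          * Complex.exp (2 * Real.pi * Complex.I * k * p.2))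
            - chordPhase p.1 (p.2 : UnitAddCircle)‖ₑ ^ 2
        = ∫⁻ p in unitSquare, ‖(∑ k ∈ s, extremalWindow (p.1 - k)
          * fourier k (p.2 : UnitAddCircle)) - chordPhase p.1 (p.2 : UnitAddCircle)‖ₑ ^ 2 := by
          simp_rw [fourier_coe_apply, Complex.ofReal_one, div_one]
      _ = ∫⁻ q, ‖(∑ k ∈ s, extremalWindow (q.1 - k) * fourier k q.2)
            - chordPhase q.1 q.2‖ₑ ^ 2 ∂(volume.restrict (Set.Ioc (0 : ℝ) 1)).prod haarAddCircle :=
          hmp.lintegral_comp hΦ2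
      _ = ∫⁻ p : RSpace 1 × UnitAddTorus (Fin 1), ‖(∑ k ∈ s, extremalWindow (p.1 0 - k)
            * fourier k (p.2 0)) - chordPhase (p.1 0) (p.2 0)‖ₑ ^ 2 ∂zakMeasure 1 :=
          ((measurePreserving_coord (d := 1) 0).lintegral_comp hΦ2).symm
      _ = _ := by
          refine lintegral_congr fun p => ?_
          rw [Finset.sum_map, ← enorm_neg, neg_sub]
          simp [tensorPhase, tensorWindow, mFourier, e]
  have hlim : Tendsto (fun s : Finset ℤ => eLpNorm (fun p : ℝ × ℝ =>
      (∑ k ∈ s, extremalWindow (p.1 - k) * Complex.exp (2 * Real.pi * Complex.I * k * p.2))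
        - chordPhase p.1 (p.2 : UnitAddCircle)) 2 (volume.restrict unitSquare) ^ 2)
      atTop (𝓝 0) := by
    simp_rw [hsq]
    exact h0
  have h3 := hlim.ennrpow_const (1 / 2 : ℝ)
  rw [ENNReal.zero_rpow_of_pos (by norm_num)] at h3
  refine h3.congr fun s => ?_
  rw [← ENNReal.rpow_natCast, ← ENNReal.rpow_mul]
  norm_num

end

/-! ### Tails of the extremal window -/

noncomputable section

open AddCircle UnitAddTorus

variable {d : ℕ}

theorem norm_prod_second_difference_le {a b c : Fin d → ℂ} {i : Fin d} (hb : ∀ l ≠ i, b l = a l)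
    (hc : ∀ l ≠ i, c l = a l) (ha : ∀ l, ‖a l‖ ≤ 1) :
    ‖∏ l, b l + ∏ l, c l - 2 * ∏ l, a l‖ ≤ ‖b i + c i - 2 * a i‖ := by
  have hb' : ∏ l ∈ Finset.univ.erase i, b l = ∏ l ∈ Finset.univ.erase i, a l :=
    Finset.prod_congr rfl fun l hl => hb l (Finset.ne_of_mem_erase hl)
  have hc' : ∏ l ∈ Finset.univ.erase i, c l = ∏ l ∈ Finset.univ.erase i, a l :=
    Finset.prod_congr rfl fun l hl => hc l (Finset.ne_of_mem_erase hl)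
  rw [← Finset.mul_prod_erase _ b (Finset.mem_univ i), ← Finset.mul_prod_erase _ c
    (Finset.mem_univ i), ← Finset.mul_prod_erase _ a (Finset.mem_univ i), hb', hc']
  have e : ∀ P : ℂ, b i * P + c i * P - 2 * (a i * P) = (b i + c i - 2 * a i) * P := fun P => by
    ring
  rw [e, norm_mul]
  refine mul_le_of_le_one_right (norm_nonneg _) ?_
  rw [norm_prod]
  exact Finset.prod_le_one (fun l _ => norm_nonneg _) fun l _ => ha l

theorem direction_qpChord (x : ℝ) (t : UnitAddCircle) :
    direction (qpChord x t) = fourier (⌈x⌉ - 1) t * chordPhase (x - ((⌈x⌉ - 1 : ℤ) : ℝ)) t := by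
  rw [qpChord, direction_mul, direction_of_norm_eq_one (norm_fourier_apply _ _), chordPhase]

theorem qpExt_tensorPhase (x : RSpace d) (y : UnitAddTorus (Fin d)) :
    qpExt tensorPhase (x, y) = ∏ j, direction (qpChord (x j) (y j)) := by
  simp_rw [direction_qpChord]
  rw [Finset.prod_mul_distrib]
  rfl

theorem measurable_qpChord : Measurable fun p : ℝ × UnitAddCircle => qpChord p.1 p.2 := by
  have h1 : Measurable fun q : ℤ × UnitAddCircle => fourier q.1 q.2 :=
    measurable_from_prod_countable_right fun n => (fourier (T := 1) n).continuous.measurable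
  have h2 : Measurable fun p : ℝ × UnitAddCircle => (⌈p.1⌉ - 1, p.2) := by fun_prop
  have h3 : Measurable fun p : ℝ × UnitAddCircle => (p.1 - ((⌈p.1⌉ - 1 : ℤ) : ℝ), p.2) := by
    fun_prop
  exact (h1.comp h2).mul (continuous_chord.measurable.comp h3)

theorem ae_mem_unitCube_zakMeasure : ∀ᵐ p ∂zakMeasure d, p.1 ∈ unitCube d :=
  Measure.quasiMeasurePreserving_fst.ae (ae_restrict_mem measurableSet_unitCube)

/-- Second differences of the Zak transform in space, on the Fourier side of the window. -/
theorem lintegral_symbol_space_le {g : L2 d} (hg : IsZak g tensorPhase) (i : Fin d) {s : ℝ}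
    (hs0 : 0 < s) (hs1 : s ≤ 1 / 4) :
    ∫⁻ ξ, ‖symbol secondDifference (s * ξ i)‖ₑ ^ 2 * ‖(𝓕 g : L2 d) ξ‖ₑ ^ 2
      ≤ ENNReal.ofReal (1000000 * s ^ 2) := by
  have h := hg.lintegral_tsum_space stronglyMeasurable_tensorPhase norm_tensorPhase_le
    summable_norm_secondDifference (EuclideanSpace.single i s)
  simp only [EuclideanSpace.inner_single_left, conj_trivial] at h
  rw [← h]
  let D : ℝ → UnitAddCircle → ℂ := fun x t =>
    direction (qpChord (x + s) t) + direction (qpChord (x - s) t) - 2 * direction (chord x t)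
  have hD : Measurable fun p : ℝ × UnitAddCircle => D p.1 p.2 := by
    have m1 : Measurable fun p : ℝ × UnitAddCircle => (p.1 + s, p.2) := by fun_prop
    have m2 : Measurable fun p : ℝ × UnitAddCircle => (p.1 - s, p.2) := by fun_prop
    exact ((measurable_direction.comp (measurable_qpChord.comp m1)).add
      (measurable_direction.comp (measurable_qpChord.comp m2))).sub
      ((measurable_direction.comp continuous_chord.measurable).const_mul 2)
  refine le_trans (lintegral_mono_ae ?_) (lintegral_le_of_le_bump hD hs0
    (fun x hx y hy => second_difference_direction_chord_space hx hy hs0 hs1) i)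
  filter_upwards [ae_mem_unitCube_zakMeasure] with p hp
  rw [tsum_secondDifference_mul fun j : ℤ =>
    qpExt tensorPhase (p.1 - (j : ℝ) • EuclideanSpace.single i s, p.2)]
  simp only [qpExt_tensorPhase]
  rw [add_comm (∏ _, _)]
  gcongr ?_ ^ 2
  rw [← ofReal_norm, ← ofReal_norm]
  refine ENNReal.ofReal_le_ofReal ?_
  refine (norm_prod_second_difference_le (i := i) (fun l hl => ?_) (fun l hl => ?_)
    fun l => norm_direction_le _).trans (le_of_eq ?_)
  · simp [hl]
  · simp [hl]
  · simp [D, qpChord_of_mem (hp i)]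

/-- Second differences of the Zak transform in frequency. The symbol is evaluated at the cell index,
since these differences act on each translate of the cube as a constant. -/
theorem lintegral_symbol_freq_le {g : L2 d} (hg : IsZak g tensorPhase) (i : Fin d) {s : ℝ}
    (hs0 : 0 < s) :
    ∫⁻ x, ‖symbol secondDifference (s * -(cellIndex x i : ℝ))‖ₑ ^ 2 * ‖g x‖ₑ ^ 2
      ≤ ENNReal.ofReal (1000000 * s ^ 2) := by
  have h := hg.lintegral_tsum_freq stronglyMeasurable_tensorPhase norm_tensorPhase_le
    summable_norm_secondDifference (EuclideanSpace.single i s)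
  simp only [EuclideanSpace.inner_single_left, conj_trivial, latticePoint_apply,
    ← mul_neg] at h
  rw [← h]
  let D : ℝ → UnitAddCircle → ℂ := fun x t =>
    direction (chord x (t + (s : UnitAddCircle))) + direction (chord x (t - (s : UnitAddCircle)))
      - 2 * direction (chord x t)
  have hD : Measurable fun p : ℝ × UnitAddCircle => D p.1 p.2 := by
    have m1 : Measurable fun p : ℝ × UnitAddCircle => (p.1, p.2 + (s : UnitAddCircle)) := by
      fun_prop
    have m2 : Measurable fun p : ℝ × UnitAddCircle => (p.1, p.2 - (s : UnitAddCircle)) := by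
      fun_prop
    exact ((measurable_direction.comp (continuous_chord.measurable.comp m1)).add
      (measurable_direction.comp (continuous_chord.measurable.comp m2))).sub
      ((measurable_direction.comp continuous_chord.measurable).const_mul 2)
  refine le_trans (lintegral_mono fun p => ?_) (lintegral_le_of_le_bump hD hs0
    (fun x hx y hy => (second_difference_direction_chord_freq hx hy hs0).trans
      (by nlinarith [sq_nonneg s])) i)
  rw [tsum_secondDifference_mul fun j : ℤ =>
    tensorPhase (p.1, p.2 - toTorus ((j : ℝ) • EuclideanSpace.single i s))]
  simp only [tensorPhase]
  rw [add_comm (∏ _, _)]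
  gcongr ?_ ^ 2
  rw [← ofReal_norm, ← ofReal_norm]
  refine ENNReal.ofReal_le_ofReal ?_
  refine (norm_prod_second_difference_le (i := i) (fun l hl => ?_) (fun l hl => ?_)
    fun l => norm_chordPhase_le _ _).trans (le_of_eq ?_)
  · simp [toTorus, hl]
  · simp [toTorus, hl]
  · simp [D, toTorus, chordPhase]

theorem lintegral_compl_rectangle_le {ψ : RSpace d → ℝ≥0∞} {R K : ℝ}
    (h : ∀ i : Fin d, ∫⁻ x in {x | R ≤ |x i|}, ψ x ≤ ENNReal.ofReal K) :
    ∫⁻ x in (rectangle fun _ => R)ᶜ, ψ x ≤ ENNReal.ofReal (d * K) := by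
  have hcov : (rectangle fun _ : Fin d => R)ᶜ ⊆ ⋃ i, {x : RSpace d | R ≤ |x i|} := by
    intro x hx
    by_contra hn
    refine hx fun j => ?_
    simp only [Set.mem_iUnion, not_exists] at hn
    exact abs_lt.1 (not_le.1 (hn j))
  calc ∫⁻ x in (rectangle fun _ => R)ᶜ, ψ x
      ≤ ∫⁻ x in ⋃ i, {x : RSpace d | R ≤ |x i|}, ψ x := lintegral_mono_set hcov
    _ ≤ ∑' i, ∫⁻ x in {x : RSpace d | R ≤ |x i|}, ψ x := lintegral_iUnion_le _ _
    _ ≤ ∑' _ : Fin d, ENNReal.ofReal K := ENNReal.tsum_le_tsum h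
    _ = ENNReal.ofReal (d * K) := by
        rw [tsum_fintype, Finset.sum_const, Finset.card_univ, Fintype.card_fin, nsmul_eq_mul,
          ENNReal.ofReal_mul (Nat.cast_nonneg d), ENNReal.ofReal_natCast]

/-- Both tails of the extremal window outside a cube of side `2R` are `O(R⁻²)`, without a
logarithm. -/
theorem tailMass_le_of_isZak_tensorPhase {g : L2 d} (hg : IsZak g tensorPhase) {R : ℝ}
    (hR : 2 ≤ R) : tailMass g (fun _ => R) (fun _ => R) ≤ d * 5000000 / R ^ 2 := by
  have hfreq : ∀ i : Fin d, ∫⁻ ξ in {ξ : RSpace d | R ≤ |ξ i|}, ‖(𝓕 g : L2 d) ξ‖ₑ ^ 2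
      ≤ ENNReal.ofReal (1000000 / R ^ 2) := fun i =>
    lintegral_tail_le_of_secondDifference (h := fun ξ : RSpace d => ξ i) (by fun_prop)
      (by norm_num) (fun s h0 h1 => lintegral_symbol_space_le hg i h0 h1) (by linarith)
  have hspace : ∀ i : Fin d, ∫⁻ x in {x : RSpace d | R ≤ |x i|}, ‖g x‖ₑ ^ 2
      ≤ ENNReal.ofReal (4000000 / R ^ 2) := fun i => by
    have h1 := lintegral_tail_le_of_secondDifference (ψ := fun x => ‖g x‖ₑ ^ 2)
      (h := fun x : RSpace d => -(cellIndex x i : ℝ))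
      (by have := (measurable_pi_apply i).comp (measurable_cellIndex (d := d))
          exact (measurable_from_top.comp this).neg)
      (by norm_num) (fun s h0 _ => lintegral_symbol_freq_le hg i h0) (R := R / 2) (by linarith)
    have h2 : (1000000 : ℝ) / (R / 2) ^ 2 = 4000000 / R ^ 2 := by field_simp; norm_num
    rw [h2] at h1
    refine le_trans (lintegral_mono_set fun x hx => ?_) h1
    -- `x i` and its cell index differ by at most `1 ≤ R / 2`
    have hx' : R ≤ |x i| := hx
    have u1 := Int.le_ceil (x i)
    have u2 := Int.ceil_lt_add_one (x i)
    change R / 2 ≤ |-((⌈x i⌉ - 1 : ℤ) : ℝ)|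
    rw [abs_neg]
    push_cast
    rcases le_abs.1 hx' with h | h
    · exact le_trans (by linarith) (le_abs_self _)
    · exact le_trans (by linarith) (neg_le_abs _)
  have h := add_le_add (lintegral_compl_rectangle_le hspace)
    (lintegral_compl_rectangle_le hfreq)
  rw [← ofReal_tailMass, ← ENNReal.ofReal_add (by positivity) (by positivity),
    ENNReal.ofReal_le_ofReal_iff (by positivity)] at h
  refine h.trans (le_of_eq ?_)
  ring

theorem exists_tailMass_lt_log {g : L2 d} (hg : IsZak g tensorPhase) {C : ℝ} (hC : 0 < C) :
    ∃ R L : Fin d → ℝ, (∀ j, 1 ≤ R j) ∧ (∀ j, 1 ≤ L j) ∧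
      ∀ i : Fin d, tailMass g R L < C * Real.log (R i * L i) / (R i * L i) := by
  obtain ⟨R, hlog, hR⟩ := ((Real.tendsto_log_atTop.eventually_gt_atTop
    (d * 5000000 / C)).and (eventually_ge_atTop 2)).exists
  refine ⟨fun _ => R, fun _ => R, fun _ => by linarith, fun _ => by linarith, fun _ => ?_⟩
  refine (tailMass_le_of_isZak_tensorPhase hg hR).trans_lt ?_
  rw [Real.log_mul (by linarith) (by linarith), ← sq]
  have hR2 : 0 < R ^ 2 := by positivity
  refine div_lt_div_of_pos_right ?_ hR2
  rw [div_lt_iff₀ hC] at hlog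
  have h0 : (0 : ℝ) ≤ d * 5000000 := by positivity
  nlinarith

end

theorem theorem1 :
    -- the lower bound, with a constant depending on the Riesz basis bounds only
    (∀ A B : ℝ, 0 < A → 0 < B → ∃ C : ℝ, 0 < C ∧
      ∀ (d : ℕ) (g : L2 d), IsRieszBasisWith (gaborSystem g) A B →
        ∀ R L : Fin d → ℝ, (∀ j, 1 ≤ R j) → (∀ j, 1 ≤ L j) →
          ∀ i : Fin d, C / (R i * L i) ≤ tailMass g R L) ∧
    -- sharpness, in every dimension
    (∃ (f : ℝ → ℂ) (z : ℝ × ℝ → ℂ), MemLp f 2 volume ∧ IsZakTransform f z ∧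
      (∀ᵐ p ∂(volume.restrict unitSquare), ‖z p‖ = 1) ∧
      ∀ d : ℕ, 0 < d → ∃ g : L2 d, IsTensorPower f g ∧ IsRieszBasisWith (gaborSystem g) 1 1 ∧
        ∀ C : ℝ, 0 < C → ∃ R L : Fin d → ℝ, (∀ j, 1 ≤ R j) ∧ (∀ j, 1 ≤ L j) ∧
          ∀ i : Fin d, tailMass g R L < C * Real.log (R i * L i) / (R i * L i)) := by
  refine ⟨fun A B hA hB => exists_tailMass_lower_bound hA hB, extremalWindow,
    fun p => chordPhase p.1 (p.2 : UnitAddCircle), memLp_extremalWindow,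
    isZakTransform_extremalWindow,
    measurePreserving_unitSquare.quasiMeasurePreserving.ae ae_norm_chordPhase, fun d _ => ?_⟩
  have hZ : IsZak ((memLp_tensorWindow (d := d)).toLp tensorWindow) tensorPhase :=
    isZak_tensorWindow.congr_left memLp_tensorWindow.coeFn_toLp.symm
  exact ⟨memLp_tensorWindow.toLp tensorWindow, memLp_tensorWindow.coeFn_toLp,
    hZ.isRieszBasisWith_one ae_norm_tensorPhase, fun C hC => exists_tailMass_lt_log hZ hC⟩
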